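/- Let $d\ge 1$ and $k>0$. Equip $\mathbb S^{d-1}\times\mathbb R$ with the measure $d\Omega\,db$ (unnormalized surface measure times Lebesgue measure). For $c:\mathbb S^{d-1}\times\mathbb R\to\mathbb R$, $v\in\mathbb R^d$, $\delta\in\mathbb R$ let $$f_{c,v,\delta}(x)=\int_{\mathbb S^{d-1}\times\mathbb R}[a^Tx-b]_+\,c(a,b)\,d\Omega(a)\,db+v^Tx+\delta ,\qquad x\in\mathbb R^d ,$$ an infinite-width ReLU network with linear and bias terms. Call $c$ even if $c(-a,-b)=c(a,b)$ for all $a,b$, and let $L^2_{\rm even,k}$ be the set of even $c$ that vanish for $|b|>k$ and are square integrable on $\mathbb S^{d-1}\times[-k,k]$; write $\|c\|_2=\big(\int_{\mathbb S^{d-1}\times[-k,k]}c^2\,d\Omega\,db\big)^{1/2}$. Let $\mathcal H$ be the RKHS of the kernel $K(x,y)=\int_{\mathbb S^{d-1}\times[-k,k]}[a^Tx-b]_+[a^Ty-b]_+\,d\Omega\,db$, with $$\|g\|_{\mathcal H}=\inf\Big\{\|c\|_2 : c\in L^2(\mathbb S^{d-1}\times[-k,k]),\ g(x)=\int_{\mathbb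 S^{d-1}\times[-k,k]}[a^Tx-b]_+\,c(a,b)\,d\Omega\,db\ \ \forall x\in\mathbb R^d\Big\}$$ (all densities $c$, even or not, are admitted). For functions with linear and bias terms put $$\|f\|=\inf\big\{\|f_{c,0,0}\|_{\mathcal H}+\|v\|_2+|\delta| : c\in L^2_{\rm even,k},\ v\in\mathbb R^d,\ \delta\in\mathbb R,\ f=f_{c,v,\delta}\big\}.$$ (1) For every $c\in L^2_{\rm even,k}$, $v\in\mathbb R^d$, $\delta\in\mathbb R$: $$\|f_{c,0,0}\|_{\mathcal H}=\|c\|_2,\qquad \|f_{c,v,\delta}\|=\|c\|_2+\|v\|_2+|\delta| .$$ The first equality also holds for the norm of every Hilbert space of functions on $\mathbb R^d$ with reproducing kernel $K$: such a space contains $f_{c,0,0}$, with norm $\|c\|_2$. Moreover $f_{c,v,\delta}$ determines its parameters: if $f_{c',v',\delta'}=f_{c,v,\delta}$ with $c'\in L^2_{\rm even,k}$, then $c'=c$ almost everywhere on $\mathbb S^{d-1}\times[-k,k]$, $v'=v$ and $\delta'=\delta$. (2) Let $c$ be even and $C^\infty$ on $\mathbb S^{d-1}\times\mathbb R$, with all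 partial derivatives $O(|b|^{-N})$ as $|b|\to\infty$ for every $N$, uniformly in $a$. Then for all $v,\delta$ the distribution $(-\Delta)^{\frac{d+1}{2}}f_{c,v,\delta}$ is a continuous function, integrable over every hyperplane, and for all $(a,b)$ $$c(a,b)=-\gamma_d\,\mathcal R\big\{(-\Delta)^{\frac{d+1}{2}}f_{c,v,\delta}\big\}(a,b),\qquad \gamma_d=\frac1{2(2\pi)^{d-1}},$$ where $\mathcal R\{h\}(a,b)$ is the integral of $h$ over the hyperplane $a^Tx=b$ with respect to $(d-1)$-dimensional Lebesgue measure, and $h=(-\Delta)^sf$ means $\int h\psi=\int f\,(-\Delta)^s\psi$ (all integrals absolutely convergent) for all Schwartz functions $\psi$, with $(-\Delta)^s\psi$ the Fourier multiplier $|\omega|^{2s}$ ($\omega$ angular frequency). -/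

import Mathlib

open MeasureTheory Set
open scoped ENNReal ContDiff FourierTransform SchwartzMap RealInnerProductSpace

namespace NeuralSpline

noncomputable section

/-- `ℝᵈ` with the Euclidean norm. -/
abbrev Space (d : ℕ) := EuclideanSpace ℝ (Fin d)

/-- The parameter space `𝕊^{d-1} × ℝ` of the weights `(a, b)`. -/
abbrev Weight (d : ℕ) := Metric.sphere (0 : Space d) 1 × ℝ

/-- The measure `dΩ db` on `𝕊^{d-1} × ℝ`: (unnormalized) surface measure times Lebesgue measure. -/
def weightMeasure (d : ℕ) : Measure (Weight d) :=
  (volume : Measure (Space d)).toSphere.prod volume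

/-- The measure `dΩ db` on the part `𝕊^{d-1} × [-k, k]` of the parameter space. -/
def weightMeasureOn (d : ℕ) (k : ℝ) : Measure (Weight d) :=
  (volume : Measure (Space d)).toSphere.prod (volume.restrict (Icc (-k) k))

/-- The ReLU feature `φ_{(a,b)}(x) = [aᵀx - b]_+`. -/
def relu {d : ℕ} (p : Weight d) (x : Space d) : ℝ :=
  max (⟪(p.1 : Space d), x⟫ - p.2) 0

/-- The infinite-width network `x ↦ ∫ [aᵀx - b]_+ c(a,b) da db + vᵀx + δ`. -/
def network {d : ℕ} (c : Weight d → ℝ) (v : Space d) (δ : ℝ) (x : Space d) : ℝ :=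
  (∫ p, relu p x * c p ∂(weightMeasure d)) + ⟪v, x⟫ + δ

/-- Evenness: `c(-a, -b) = c(a, b)`. -/
def IsEven {d : ℕ} (c : Weight d → ℝ) : Prop :=
  ∀ (a : Metric.sphere (0 : Space d) 1) (b : ℝ), c (-a, -b) = c (a, b)

/-- Even weight densities in `L²(𝕊^{d-1} × [-k, k])`, regarded as functions on `𝕊^{d-1} × ℝ`
that vanish for `|b| > k`. -/
structure IsEvenDensity {d : ℕ} (k : ℝ) (c : Weight d → ℝ) : Prop where
  even : IsEven c
  support : ∀ (a : Metric.sphere (0 : Space d) 1) (b : ℝ), k < |b| → c (a, b) = 0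
  memLp : MemLp c 2 (weightMeasureOn d k)

/-- The neural spline kernel `K(x, y) = ∫_{𝕊^{d-1} × [-k, k]} [aᵀx - b]_+ [aᵀy - b]_+ dΩ db`. -/
def splineKernel {d : ℕ} (k : ℝ) (x y : Space d) : ℝ :=
  ∫ p, relu p x * relu p y ∂(weightMeasureOn d k)

/-- The RKHS norm of the neural spline kernel in its feature form: the least `L²` norm of a
density `c` (even or not) on `𝕊^{d-1} × [-k, k]` with `g(x) = ∫ [aᵀx - b]_+ c(a,b) dΩ db`
for all `x`; it is `∞` if there is none. -/
def rkhsNorm {d : ℕ} (k : ℝ) (g : Space d → ℝ) : ℝ≥0∞ :=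
  ⨅ (c : Weight d → ℝ) (_ : MemLp c 2 (weightMeasureOn d k) ∧
      ∀ x, g x = ∫ p, relu p x * c p ∂(weightMeasureOn d k)),
    eLpNorm c 2 (weightMeasureOn d k)

/-- The norm on the space of networks with even weight density, linear term and bias:
the infimum of `‖g‖_RKHS + ‖v‖ + |δ|` over all ways of writing `f` as `g(x) + vᵀx + δ`
with `g` a network with even weight density and without linear and bias terms. -/
def networkNorm {d : ℕ} (k : ℝ) (f : Space d → ℝ) : ℝ≥0∞ :=
  ⨅ (c : Weight d → ℝ) (v : Space d) (δ : ℝ) (_ : IsEvenDensity k c ∧ f = network c v δ),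
    rkhsNorm k (network c 0 0) + ‖v‖ₑ + ‖δ‖ₑ

/-- The extension of a function on `𝕊^{d-1} × ℝ` to `ℝᵈ × ℝ` that is constant along rays
in the first variable. -/
def rayExtension {d : ℕ} (c : Weight d → ℝ) (p : Space d × ℝ) : ℝ :=
  if h : p.1 = 0 then 0
  else c (⟨‖p.1‖⁻¹ • p.1, by
    rw [mem_sphere_zero_iff_norm]; exact norm_smul_inv_norm (𝕜 := ℝ) h⟩, p.2)

/-- `c` is `C^∞` on `𝕊^{d-1} × ℝ` and all its partial derivatives are `O(|b|^{-N})` for every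
`N`, uniformly on the sphere; derivatives on the sphere are taken through the extension that is
constant along rays. -/
structure IsRapidlyDecreasing {d : ℕ} (c : Weight d → ℝ) : Prop where
  smooth : ContDiffOn ℝ ∞ (rayExtension c) {p | p.1 ≠ 0}
  decay : ∀ n N : ℕ, ∃ C : ℝ, ∀ (a : Metric.sphere (0 : Space d) 1) (b : ℝ),
    |b| ^ N * ‖iteratedFDeriv ℝ n (rayExtension c) ((a : Space d), b)‖ ≤ C

/-- The fractional Laplacian `(-Δ)^s`, the Fourier multiplier `(2π|ξ|)^{2s}`
(the Fourier transform has kernel `exp(-2πi xᵀξ)`). -/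
def fracLaplacian {d : ℕ} (s : ℝ) (ψ : 𝓢(Space d, ℂ)) : Space d → ℂ :=
  𝓕⁻ (fun ξ : Space d => (((2 * Real.pi * ‖ξ‖) ^ (2 * s) : ℝ) : ℂ) * 𝓕 (ψ : Space d → ℂ) ξ)

/-- `h = (-Δ)^s f` in the sense of distributions: `∫ h ψ = ∫ f (-Δ)^s ψ` for all Schwartz
functions `ψ`, all these integrals being absolutely convergent. -/
def IsWeakFracLaplacian {d : ℕ} (s : ℝ) (f h : Space d → ℝ) : Prop :=
  ∀ ψ : 𝓢(Space d, ℂ),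
    Integrable (fun x => (f x : ℂ) * fracLaplacian s ψ x) ∧
    Integrable (fun x => (h x : ℂ) * ψ x) ∧
    ∫ x, (h x : ℂ) * ψ x = ∫ x, (f x : ℂ) * fracLaplacian s ψ x

/-- `h` is integrable over the hyperplane `aᵀx = b`, parametrized by `y ↦ b a + y`, `y ⟂ a`. -/
def RadonIntegrable {d : ℕ} (h : Space d → ℝ) (p : Weight d) : Prop :=
  Integrable (fun y : (ℝ ∙ (p.1 : Space d))ᗮ => h (p.2 • (p.1 : Space d) + (y : Space d)))

/-- The Radon transform: the integral of `h` over the hyperplane `aᵀx = b` with respect to its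
`(d-1)`-dimensional Lebesgue measure. -/
def radon {d : ℕ} (h : Space d → ℝ) (p : Weight d) : ℝ :=
  ∫ y : (ℝ ∙ (p.1 : Space d))ᗮ, h (p.2 • (p.1 : Space d) + (y : Space d))

/-- `γ_d = 1 / (2 (2π)^{d-1})`. -/
def radonConst (d : ℕ) : ℝ := 1 / (2 * (2 * Real.pi) ^ (d - 1))

end

end NeuralSpline

/-!
Throughout, `Ψ = (-Δ)^{(d+1)/2} ψ` for a Schwartz function `ψ`. Everything rests on one identity,
`integral_network_mul_fracLaplacian`: if `f` is the network with even density `e`, then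
`∫ f Ψ = -2 (2π)^{d-1} ∫ 𝓕ψ · rayFourier e`, where `rayFourier e` is the function on frequency
space whose restriction to the ray through a unit vector `a` is the Fourier transform of `e(a, ·)`.

To prove it, write `[s]_+ = s/2 + |s|/2`. Since `𝓕Ψ = (2π‖ξ‖)^{d+1} 𝓕ψ` vanishes at the origin to
an order greater than one, `Ψ` is orthogonal to affine functions, so only `|aᵀx - b|` matters. The
plane-wave representation `2π² |s| = ∫ (1 - cos 2πτs) τ⁻² dτ` (`integral_one_sub_cos_mul_div_sq`)
turns `∫ |aᵀx - b| Ψ(x) dx` into an integral of `𝓕Ψ(τa) τ⁻²` over the line through `a`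
(`integral_relu_mul_fracLaplacian`); integrating this against `e` and passing to polar coordinates
gives the identity. Here the evenness of `e` is what makes the two half-lines contribute equally.
The interchanges of integrals are legitimate because `Ψ` is integrable against functions of linear
growth. This is the decay `‖x‖^{-(2d+1)}`, which follows from symbol estimates for the multiplier:
a function on frequency space that is singular at the origin like `‖ξ‖^α` and rapidly decreasing at
infinity has a Fourier transform decaying like `‖x‖^{-(d+α)}` (`IsSymbol.exists_norm_fourier_le`).

For the norm formula, the identity shows that an even density on the strip whose network is affine
has vanishing `rayFourier`, hence is zero (`ae_eq_zero_of_integral_relu_mul_eq_affine`). Reflecting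
a density changes its network by an affine function only, so the even part of a density of the zero
network has an affine network and vanishes: the densities of the zero function are odd. They are
therefore orthogonal to every even density, which gives the minimality of the `L²` norm
(Pythagoras), and also shows that an even density lies in the closed span of the features in `L²`.
On that span `L²` and every Hilbert space with reproducing kernel `K` are isometric, as the features
and the kernel functions have the same Gram matrix (`exists_of_gram_eq`).

For the inversion formula, the identity says that the distribution `(-Δ)^{(d+1)/2} f` is
`-2 (2π)^{d-1}` times the Fourier transform of `rayFourier c`. When `c` is smooth and rapidly
decreasing, `rayFourier c` is a symbol of order `0` (`isSymbol_rayFourier`), so its Fourier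
transform is `O((1 + ‖x‖)^{-d})`, hence continuous and integrable on hyperplanes. The
projection-slice theorem (`integral_fourier_hyperplane`) expresses its integral over the hyperplane
`aᵀx = b` through the values of `rayFourier c` on the line through `a`, and one-dimensional Fourier
inversion on that line returns `c(a, b)`.
-/

namespace NeuralSpline

/-! ### Functions with symbol estimates and a singularity at the origin -/

section Symbol

theorem norm_iteratedFDeriv_comp_const_smul {E F : Type*} [NormedAddCommGroup E] [NormedSpace ℝ E]
    [NormedAddCommGroup F] [NormedSpace ℝ F] (f : E → F) {t : ℝ} (ht : t ≠ 0) (n : ℕ) (x : E) :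
    ‖iteratedFDeriv ℝ n (fun z => f (t • z)) x‖ = |t| ^ n * ‖iteratedFDeriv ℝ n f (t • x)‖ := by
  have h := (ContinuousLinearEquiv.smulLeft (R₁ := ℝ) (M₁ := E)
    (Units.mk0 t ht)).iteratedFDerivWithin_comp_right f uniqueDiffOn_univ (x := x) (mem_univ _) n
  simp only [preimage_univ, iteratedFDerivWithin_univ] at h
  have e : (f ∘ (ContinuousLinearEquiv.smulLeft (R₁ := ℝ) (M₁ := E) (Units.mk0 t ht)))
      = fun z => f (t • z) := rfl
  rw [e] at h
  have e2 : iteratedFDeriv ℝ n (fun z => f (t • z)) x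
      = t ^ n • iteratedFDeriv ℝ n f (t • x) := by
    rw [h]
    ext v
    simp only [ContinuousMultilinearMap.compContinuousLinearMap_apply,
      smul_apply]
    have := (iteratedFDeriv ℝ n f (t • x)).map_smul_univ (fun _ => t) v
    simp only [Finset.prod_const, Finset.card_univ, Fintype.card_fin] at this
    exact this
  rw [e2, norm_smul, norm_pow, Real.norm_eq_abs]

variable {E : Type*} [NormedAddCommGroup E] [NormedSpace ℝ E]

/-- `m` is smooth away from the origin, where it behaves like a homogeneous function of degree `α`
(each derivative of order `n` is `O(‖ξ‖^(α-n))`), and all these bounds improve by a further factor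
`(1 + ‖ξ‖)^(-K)` at infinity. The value at the origin is not restricted. -/
structure IsSymbol (α K : ℕ) (m : E → ℂ) : Prop where
  smooth : ContDiffOn ℝ ∞ m {0}ᶜ
  bound : ∀ n : ℕ, ∃ C : ℝ, ∀ ξ : E, ξ ≠ 0 →
    ‖ξ‖ ^ n * ‖iteratedFDeriv ℝ n m ξ‖ * (1 + ‖ξ‖) ^ K ≤ C * ‖ξ‖ ^ α

/-- Leibniz' rule for the scale-invariant sizes `‖x‖ ^ n * ‖Dⁿ f x‖` of the derivatives. -/
theorem pow_mul_norm_iteratedFDeriv_mul_le {f g : E → ℂ} (hf : ContDiffOn ℝ ∞ f {0}ᶜ)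
    (hg : ContDiffOn ℝ ∞ g {0}ᶜ) {x : E} (hx : x ≠ 0) {A B : ℝ} {n : ℕ}
    (hA : ∀ i ≤ n, ‖x‖ ^ i * ‖iteratedFDeriv ℝ i f x‖ ≤ A)
    (hB : ∀ i ≤ n, ‖x‖ ^ i * ‖iteratedFDeriv ℝ i g x‖ ≤ B) :
    ‖x‖ ^ n * ‖iteratedFDeriv ℝ n (fun y => f y * g y) x‖ ≤ 2 ^ n * (A * B) := by
  have ho : IsOpen ({0}ᶜ : Set E) := isOpen_compl_singleton
  have hxs : x ∈ ({0}ᶜ : Set E) := hx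
  have h := norm_iteratedFDerivWithin_mul_le hf hg ho.uniqueDiffOn hxs
    (n := n) (by exact_mod_cast le_top)
  simp only [fun i (f : E → ℂ) => iteratedFDerivWithin_of_isOpen (𝕜 := ℝ) (f := f) i ho hxs] at h
  calc ‖x‖ ^ n * ‖iteratedFDeriv ℝ n (fun y => f y * g y) x‖
      ≤ ‖x‖ ^ n * ∑ i ∈ Finset.range (n + 1), (n.choose i : ℝ) * ‖iteratedFDeriv ℝ i f x‖
        * ‖iteratedFDeriv ℝ (n - i) g x‖ := by gcongr
    _ = ∑ i ∈ Finset.range (n + 1), (n.choose i : ℝ) * ((‖x‖ ^ i * ‖iteratedFDeriv ℝ i f x‖)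
        * (‖x‖ ^ (n - i) * ‖iteratedFDeriv ℝ (n - i) g x‖)) := by
      rw [Finset.mul_sum]
      refine Finset.sum_congr rfl fun i hi => ?_
      have : ‖x‖ ^ n = ‖x‖ ^ i * ‖x‖ ^ (n - i) := by
        rw [← pow_add]; congr 1; have := Finset.mem_range.1 hi; omega
      rw [this]; ring
    _ ≤ ∑ i ∈ Finset.range (n + 1), (n.choose i : ℝ) * (A * B) := by
      refine Finset.sum_le_sum fun i hi => ?_
      have h1 := hA i (by have := Finset.mem_range.1 hi; omega)
      have h2 := hB (n - i) (by omega)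
      gcongr
      exact le_trans (by positivity) h1
    _ = 2 ^ n * (A * B) := by
      rw [← Finset.sum_mul]
      have := Nat.sum_range_choose n
      have h3 : (∑ i ∈ Finset.range (n + 1), (n.choose i : ℝ)) = 2 ^ n := by exact_mod_cast this
      rw [h3]

/-- A single constant bounding the derivatives of order at most `N`. -/
theorem IsSymbol.exists_bound {α K : ℕ} {m : E → ℂ} (hm : IsSymbol α K m) (N : ℕ) :
    ∃ C : ℝ, 0 ≤ C ∧ ∀ n ≤ N, ∀ ξ : E, ξ ≠ 0 →
      ‖ξ‖ ^ n * ‖iteratedFDeriv ℝ n m ξ‖ * (1 + ‖ξ‖) ^ K ≤ C * ‖ξ‖ ^ α := by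
  choose C hC using hm.bound
  refine ⟨∑ n ∈ Finset.range (N + 1), |C n|, Finset.sum_nonneg fun _ _ => abs_nonneg _,
    fun n hn ξ hξ => (hC n ξ hξ).trans ?_⟩
  gcongr
  exact (le_abs_self _).trans (Finset.single_le_sum (f := fun n => |C n|)
    (fun _ _ => abs_nonneg _) (Finset.mem_range.2 (by omega)))

theorem IsSymbol.mul {α β K L : ℕ} {f g : E → ℂ} (hf : IsSymbol α K f) (hg : IsSymbol β L g) :
    IsSymbol (α + β) (K + L) (fun ξ => f ξ * g ξ) := by
  refine ⟨hf.smooth.mul hg.smooth, fun n => ?_⟩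
  obtain ⟨A, hA0, hA⟩ := hf.exists_bound n
  obtain ⟨B, hB0, hB⟩ := hg.exists_bound n
  refine ⟨2 ^ n * (A * B), fun ξ hξ => ?_⟩
  have h1 : (0 : ℝ) < (1 + ‖ξ‖) ^ K := by positivity
  have h2 : (0 : ℝ) < (1 + ‖ξ‖) ^ L := by positivity
  have h := pow_mul_norm_iteratedFDeriv_mul_le hf.smooth hg.smooth hξ (n := n)
    (A := A * ‖ξ‖ ^ α / (1 + ‖ξ‖) ^ K) (B := B * ‖ξ‖ ^ β / (1 + ‖ξ‖) ^ L)
    (fun i hi => (le_div_iff₀ h1).2 (hA i hi ξ hξ)) (fun i hi => (le_div_iff₀ h2).2 (hB i hi ξ hξ))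
  calc _ ≤ 2 ^ n * (A * ‖ξ‖ ^ α / (1 + ‖ξ‖) ^ K * (B * ‖ξ‖ ^ β / (1 + ‖ξ‖) ^ L))
        * (1 + ‖ξ‖) ^ (K + L) := by gcongr
    _ = _ := by rw [pow_add, pow_add]; field_simp

/-- The symbol estimates may be checked on the unit sphere, for all dilates of `m`. -/
theorem IsSymbol.of_sphere {α K : ℕ} {m : E → ℂ} (hs : ContDiffOn ℝ ∞ m {0}ᶜ)
    (h : ∀ n : ℕ, ∃ C : ℝ, ∀ t : ℝ, 0 < t → ∀ η : E, ‖η‖ = 1 →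
      ‖iteratedFDeriv ℝ n (fun z => m (t • z)) η‖ * (1 + t) ^ K ≤ C * t ^ α) : IsSymbol α K m := by
  refine ⟨hs, fun n => ?_⟩
  obtain ⟨C, hC⟩ := h n
  refine ⟨C, fun ξ hξ => ?_⟩
  have hpos : 0 < ‖ξ‖ := norm_pos_iff.2 hξ
  have := hC ‖ξ‖ hpos (‖ξ‖⁻¹ • ξ) (by simp [norm_smul, hpos.ne'])
  rwa [norm_iteratedFDeriv_comp_const_smul _ hpos.ne', smul_smul, mul_inv_cancel₀ hpos.ne',
    one_smul, abs_of_pos hpos] at this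

/-- Dilates of a symbol are symbols of the same order. -/
theorem IsSymbol.comp_smul {α K : ℕ} {m : E → ℂ} (hm : IsSymbol α K m) {t : ℝ} (ht : 0 < t)
    (ht1 : t ≤ 1) : IsSymbol α K (fun z => m (t • z)) := by
  refine ⟨hm.smooth.comp (contDiff_const_smul t).contDiffOn fun x hx => ?_, fun n => ?_⟩
  · simpa [ht.ne'] using hx
  obtain ⟨C, hC0, hC⟩ := hm.exists_bound n
  refine ⟨C * t ^ α / t ^ K, fun ξ hξ => ?_⟩
  have h := hC n le_rfl (t • ξ) (by simp [ht.ne', hξ])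
  rw [norm_smul, Real.norm_of_nonneg ht.le] at h
  rw [norm_iteratedFDeriv_comp_const_smul _ ht.ne', abs_of_pos ht]
  have h2 : (t * (1 + ‖ξ‖)) ^ K ≤ (1 + t * ‖ξ‖) ^ K := by
    gcongr; nlinarith [norm_nonneg ξ]
  rw [div_mul_eq_mul_div, le_div_iff₀ (by positivity)]
  calc _ = (t * ‖ξ‖) ^ n * ‖iteratedFDeriv ℝ n m (t • ξ)‖ * (t * (1 + ‖ξ‖)) ^ K := by
        rw [mul_pow, mul_pow]; ring
    _ ≤ (t * ‖ξ‖) ^ n * ‖iteratedFDeriv ℝ n m (t • ξ)‖ * (1 + t * ‖ξ‖) ^ K := by gcongr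
    _ ≤ C * (t * ‖ξ‖) ^ α := h
    _ = _ := by rw [mul_pow]; ring

theorem IsSymbol.norm_le {α K : ℕ} {m : E → ℂ} (hm : IsSymbol α K m) {r : ℕ} (hK : α + r ≤ K) :
    ∃ C : ℝ, 0 ≤ C ∧ ∀ ξ ≠ 0, ‖m ξ‖ ≤ C * ((1 + ‖ξ‖) ^ r)⁻¹ := by
  obtain ⟨C, hC0, hC⟩ := hm.exists_bound 0
  refine ⟨C, hC0, fun ξ hξ => ?_⟩
  have h := hC 0 le_rfl ξ hξ
  rw [pow_zero, one_mul, norm_iteratedFDeriv_zero] at h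
  rw [← div_eq_mul_inv, le_div_iff₀ (by positivity)]
  have h1 : (1 + ‖ξ‖) ^ α * (‖m ξ‖ * (1 + ‖ξ‖) ^ r) ≤ (1 + ‖ξ‖) ^ α * C := by
    calc _ = ‖m ξ‖ * (1 + ‖ξ‖) ^ (α + r) := by rw [pow_add]; ring
      _ ≤ ‖m ξ‖ * (1 + ‖ξ‖) ^ K := by gcongr; linarith [norm_nonneg ξ]
      _ ≤ C * ‖ξ‖ ^ α := h
      _ ≤ _ := by rw [mul_comm]; gcongr; linarith
  exact le_of_mul_le_mul_left h1 (by positivity)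

end Symbol

/-! ### Decay of the Fourier transform of a symbol -/

section Decay

theorem inv_one_add_norm_pow_integrable (E : Type*) [NormedAddCommGroup E] [InnerProductSpace ℝ E]
    [FiniteDimensional ℝ E] [MeasurableSpace E] [BorelSpace E] {r : ℕ}
    (hr : Module.finrank ℝ E < r) : Integrable (fun x : E => ((1 + ‖x‖) ^ r)⁻¹) := by
  have h := integrable_one_add_norm (E := E) (μ := volume) (r := r) (by exact_mod_cast hr)
  refine h.congr (Filter.Eventually.of_forall fun x => ?_)
  simp only
  rw [Real.rpow_neg (by positivity), Real.rpow_natCast]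

variable {E : Type*} [NormedAddCommGroup E] [InnerProductSpace ℝ E] [FiniteDimensional ℝ E]
  [MeasurableSpace E] [BorelSpace E]

theorem IsSymbol.integrable [Nontrivial E] {α K : ℕ} {m : E → ℂ} (hm : IsSymbol α K m)
    (hK : α + Module.finrank ℝ E + 1 ≤ K) : Integrable m := by
  obtain ⟨C, hC0, hC⟩ := hm.norm_le (r := Module.finrank ℝ E + 1) (by omega)
  refine Integrable.mono' ((inv_one_add_norm_pow_integrable E (Nat.lt_succ_self _)).const_mul C)
    ?_ ?_
  · rw [← Measure.restrict_univ (μ := (volume : Measure E)),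
      ← restrict_compl_singleton (μ := (volume : Measure E)) (0 : E), Measure.restrict_univ]
    exact hm.smooth.continuousOn.aestronglyMeasurable (measurableSet_singleton _).compl
  · have : ∀ᵐ ξ : E, ξ ≠ 0 := Measure.ae_ne volume 0
    filter_upwards [this] with ξ hξ using hC ξ hξ

/-- Decay of the Fourier transform by `N` integrations by parts. The exponent `2 * N` comes from
evaluating the multilinear map `𝓕 (D^N G) y` at the vectors `(y, …, y)`. -/
theorem pow_norm_mul_norm_fourier_le {G : E → ℂ} {N : ℕ} (hG : ContDiff ℝ ∞ G)
    (hint : ∀ n ≤ N, Integrable (iteratedFDeriv ℝ n G)) (y : E) :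
    ‖y‖ ^ (2 * N) * ‖𝓕 G y‖ ≤ ‖y‖ ^ N * ∫ x, ‖iteratedFDeriv ℝ N G x‖ := by
  have hG' : ContDiff ℝ (N : ℕ∞) G := hG.of_le (by exact_mod_cast le_top)
  have h := Real.fourier_iteratedFDeriv (N := (N : ℕ∞)) hG'
    (fun n hn => hint n (by exact_mod_cast hn)) (n := N) le_rfl
  have h1 := congrFun h y
  have h2 : ‖𝓕 (iteratedFDeriv ℝ N G) y‖ ≤ ∫ x, ‖iteratedFDeriv ℝ N G x‖ :=
    VectorFourier.norm_fourierIntegral_le_integral_norm _ _ _ _ _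
  have h3 := (𝓕 (iteratedFDeriv ℝ N G) y).le_opNorm (fun _ => y)
  rw [h1, VectorFourier.fourierPowSMulRight_apply] at h3
  simp only [Finset.prod_const, Finset.card_univ, Fintype.card_fin, norm_smul, norm_pow,
    norm_neg, norm_mul, Complex.norm_I, Complex.norm_real, neg_apply] at h3
  rw [← h1] at h3
  have hin : ‖(innerSL ℝ y) y‖ = ‖y‖ ^ 2 := by simp
  rw [hin] at h3
  have h2pi : (1 : ℝ) ≤ (‖(2 : ℂ)‖ * ‖Real.pi‖ * 1) ^ N := by
    apply one_le_pow₀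
    rw [Real.norm_of_nonneg Real.pi_pos.le]
    have : ‖(2 : ℂ)‖ = 2 := by norm_num
    rw [this]; linarith [Real.pi_gt_three]
  calc ‖y‖ ^ (2 * N) * ‖𝓕 G y‖ = 1 * ((‖y‖ ^ 2) ^ N * ‖𝓕 G y‖) := by rw [pow_mul, one_mul]
    _ ≤ (‖(2 : ℂ)‖ * ‖Real.pi‖ * 1) ^ N * ((‖y‖ ^ 2) ^ N * ‖𝓕 G y‖) := by gcongr
    _ ≤ ‖𝓕 (iteratedFDeriv ℝ N G) y‖ * ‖y‖ ^ N := h3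
    _ ≤ _ := by rw [mul_comm]; gcongr

/-- A smooth cutoff removing a neighbourhood of the origin, with its symbol estimates. -/
theorem exists_high_pass (E : Type*) [NormedAddCommGroup E] [InnerProductSpace ℝ E]
    [FiniteDimensional ℝ E] (N : ℕ) :
    ∃ (κ : E → ℂ) (A : ℝ), ContDiff ℝ ∞ κ ∧ (∀ x, ‖x‖ ≤ 1 → κ x = 0) ∧
      (∀ x, 2 ≤ ‖x‖ → κ x = 1) ∧ (∀ x, ‖1 - κ x‖ ≤ 1) ∧ 0 ≤ A ∧
      ∀ i ≤ N, ∀ x : E, ‖x‖ ^ i * ‖iteratedFDeriv ℝ i κ x‖ ≤ A := by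
  let χ : ContDiffBump (0 : E) := ⟨1, 2, one_pos, one_lt_two⟩
  have hχ : ContDiff ℝ ∞ (fun x => ((χ x : ℝ) : ℂ)) := Complex.ofRealCLM.contDiff.comp χ.contDiff
  have hs : HasCompactSupport (fun x => ((χ x : ℝ) : ℂ)) :=
    χ.hasCompactSupport.comp_left (g := fun r : ℝ => (r : ℂ)) (by simp)
  have hb : ∀ i : ℕ, ∃ C, ∀ x : E,
      ‖x‖ ^ i * ‖iteratedFDeriv ℝ i (fun x => ((χ x : ℝ) : ℂ)) x‖ ≤ C := by
    intro i
    have hc : Continuous (fun x : E =>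
        ‖x‖ ^ i • iteratedFDeriv ℝ i (fun x => ((χ x : ℝ) : ℂ)) x) :=
      (continuous_norm.pow i).smul (hχ.continuous_iteratedFDeriv (m := i)
        (by exact_mod_cast le_top))
    have := hc.bounded_above_of_compact_support
      ((hs.iteratedFDeriv i).smul_left (f := fun x : E => ‖x‖ ^ i))
    obtain ⟨C, hC⟩ := this
    exact ⟨C, fun x => by simpa [norm_smul] using hC x⟩
  choose C hC using hb
  have hC0 : ∀ i, 0 ≤ C i := fun i => le_trans (by positivity) (hC i 0)
  refine ⟨fun x => 1 - ((χ x : ℝ) : ℂ), 1 + ∑ i ∈ Finset.range (N + 1), C i,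
    contDiff_const.sub hχ, ?_, ?_, ?_, ?_, ?_⟩
  · intro x hx
    have : χ x = 1 := χ.one_of_mem_closedBall (by simpa [χ] using hx)
    simp [this]
  · intro x hx
    have : χ x = 0 := χ.zero_of_le_dist (by simpa [χ] using hx)
    simp [this]
  · intro x
    simp only [sub_sub_cancel, Complex.norm_real, Real.norm_of_nonneg (χ.nonneg)]
    exact χ.le_one
  · have := Finset.sum_nonneg fun i (_ : i ∈ Finset.range (N + 1)) => hC0 i
    linarith
  · intro i hi x
    have h1 : iteratedFDeriv ℝ i (fun x => 1 - ((χ x : ℝ) : ℂ)) x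
        = iteratedFDeriv ℝ i (fun _ : E => (1 : ℂ)) x
          - iteratedFDeriv ℝ i (fun x => ((χ x : ℝ) : ℂ)) x :=
      iteratedFDeriv_sub_apply (f := fun _ : E => (1 : ℂ)) contDiff_const.contDiffAt
        ((hχ.of_le (by exact_mod_cast le_top)).contDiffAt)
    have h2 : ‖x‖ ^ i * ‖iteratedFDeriv ℝ i (fun _ : E => (1 : ℂ)) x‖ ≤ 1 := by
      rcases Nat.eq_zero_or_pos i with rfl | hi'
      · simp
      · rw [iteratedFDeriv_const_of_ne hi'.ne']; simp
    calc _ ≤ ‖x‖ ^ i * (‖iteratedFDeriv ℝ i (fun _ : E => (1 : ℂ)) x‖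
          + ‖iteratedFDeriv ℝ i (fun x => ((χ x : ℝ) : ℂ)) x‖) := by
            rw [h1]; gcongr; exact norm_sub_le _ _
      _ ≤ 1 + C i := by rw [mul_add]; exact add_le_add h2 (hC i x)
      _ ≤ _ := by
        gcongr
        exact Finset.single_le_sum (f := C) (fun i _ => hC0 i) (Finset.mem_range.2 (by omega))

omit [FiniteDimensional ℝ E] [MeasurableSpace E] [BorelSpace E] in
theorem contDiff_high_pass_mul {κ g : E → ℂ} (hκ : ContDiff ℝ ∞ κ)
    (hκ0 : ∀ x, ‖x‖ ≤ 1 → κ x = 0) (hg : ContDiffOn ℝ ∞ g {0}ᶜ) :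
    ContDiff ℝ ∞ (fun x => κ x * g x) := by
  refine contDiff_iff_contDiffAt.2 fun x => ?_
  rcases lt_or_ge ‖x‖ 1 with hx | hx
  · have : (fun x => κ x * g x) =ᶠ[nhds x] fun _ => 0 := by
      filter_upwards [(isOpen_lt continuous_norm continuous_const).mem_nhds hx] with z hz
      rw [hκ0 z (le_of_lt hz), zero_mul]
    exact contDiffAt_const.congr_of_eventuallyEq this
  · have hx0 : x ∈ ({0}ᶜ : Set E) := by
      intro h; rw [mem_singleton_iff.1 h, norm_zero] at hx; linarith
    exact hκ.contDiffAt.mul (hg.contDiffAt (isOpen_compl_singleton.mem_nhds hx0))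

omit [FiniteDimensional ℝ E] [MeasurableSpace E] [BorelSpace E] in
/-- Away from the origin each derivative of a symbol gains one power of decay, up to the order of
derivatives that is controlled. -/
theorem norm_iteratedFDeriv_high_pass_mul_le {κ g : E → ℂ} {A B : ℝ} {n α K r : ℕ}
    (hκ : ContDiff ℝ ∞ κ) (hκ0 : ∀ x, ‖x‖ ≤ 1 → κ x = 0) (hA0 : 0 ≤ A) (hB0 : 0 ≤ B)
    (hA : ∀ i ≤ n, ∀ x : E, ‖x‖ ^ i * ‖iteratedFDeriv ℝ i κ x‖ ≤ A)
    (hg : ContDiffOn ℝ ∞ g {0}ᶜ)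
    (hB : ∀ i ≤ n, ∀ ξ : E, ξ ≠ 0 →
      ‖ξ‖ ^ i * ‖iteratedFDeriv ℝ i g ξ‖ * (1 + ‖ξ‖) ^ K ≤ B * ‖ξ‖ ^ α)
    (hr : α + r ≤ K + n) (x : E) :
    ‖iteratedFDeriv ℝ n (fun x => κ x * g x) x‖ ≤ 4 ^ n * (A * B) * ((1 + ‖x‖) ^ r)⁻¹ := by
  rcases lt_or_ge ‖x‖ 1 with hx | hx
  · have : (fun x => κ x * g x) =ᶠ[nhds x] fun _ => 0 := by
      filter_upwards [(isOpen_lt continuous_norm continuous_const).mem_nhds hx] with z hz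
      rw [hκ0 z (le_of_lt hz), zero_mul]
    rw [(this.iteratedFDeriv ℝ n).eq_of_nhds, iteratedFDeriv_fun_zero, Pi.zero_apply, norm_zero]
    positivity
  · have hx0 : x ≠ 0 := by rintro rfl; rw [norm_zero] at hx; linarith
    have h1 : (0 : ℝ) < (1 + ‖x‖) ^ K := by positivity
    have h := pow_mul_norm_iteratedFDeriv_mul_le hκ.contDiffOn hg hx0 (n := n) (A := A)
      (B := B * ‖x‖ ^ α / (1 + ‖x‖) ^ K) (fun i hi => hA i hi x)
      (fun i hi => (le_div_iff₀ h1).2 (hB i hi x hx0))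
    set D := ‖iteratedFDeriv ℝ n (fun x => κ x * g x) x‖
    have hD : 0 ≤ D := norm_nonneg _
    rw [← mul_div_assoc, ← mul_div_assoc, le_div_iff₀ h1] at h
    have h2 : (1 + ‖x‖) ^ n ≤ 2 ^ n * ‖x‖ ^ n := by
      rw [← mul_pow]; gcongr; linarith
    rw [← div_eq_mul_inv, le_div_iff₀ (by positivity)]
    have h3 : (1 + ‖x‖) ^ α * (D * (1 + ‖x‖) ^ r) ≤ (1 + ‖x‖) ^ α * (4 ^ n * (A * B)) := by
      calc _ = D * (1 + ‖x‖) ^ (α + r) := by rw [pow_add]; ring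
        _ ≤ D * (1 + ‖x‖) ^ (K + n) := by gcongr; linarith
        _ = (1 + ‖x‖) ^ n * D * (1 + ‖x‖) ^ K := by rw [pow_add]; ring
        _ ≤ 2 ^ n * ‖x‖ ^ n * D * (1 + ‖x‖) ^ K := by gcongr
        _ = 2 ^ n * (‖x‖ ^ n * D * (1 + ‖x‖) ^ K) := by ring
        _ ≤ 2 ^ n * (2 ^ n * (A * (B * ‖x‖ ^ α))) := by gcongr
        _ = ‖x‖ ^ α * (4 ^ n * (A * B)) := by
          rw [show (4 : ℝ) = 2 * 2 by norm_num, mul_pow]; ring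
        _ ≤ _ := by gcongr; linarith
    exact le_of_mul_le_mul_left h3 (by positivity)

/-- On the unit sphere the Fourier transform of a symbol is controlled by its scale-invariant
bounds alone; the frequencies below and above `1` are treated separately, the latter by
`α + dim E + 1` integrations by parts. -/
theorem exists_norm_fourier_le_of_norm_eq_one [Nontrivial E] (α : ℕ) :
    ∃ C₀ : ℝ, 0 ≤ C₀ ∧ ∀ (g : E → ℂ) (B : ℝ) (K : ℕ), 0 ≤ B → IsSymbol α K g →
      α + Module.finrank ℝ E + 1 ≤ K →
      (∀ n ≤ α + Module.finrank ℝ E + 1, ∀ η : E, η ≠ 0 →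
        ‖η‖ ^ n * ‖iteratedFDeriv ℝ n g η‖ ≤ B * ‖η‖ ^ α) →
      ∀ y : E, ‖y‖ = 1 → ‖𝓕 g y‖ ≤ C₀ * B := by
  set r := Module.finrank ℝ E + 1 with hr
  obtain ⟨κ, A, hκ, hκ0, hκ1, hκn, hA0, hA⟩ := exists_high_pass E (α + r)
  have hr' : Module.finrank ℝ E < r := Nat.lt_succ_self _
  have hI := inv_one_add_norm_pow_integrable E hr'
  refine ⟨(∫ x : E, 4 ^ (α + r) * A * ((1 + ‖x‖) ^ r)⁻¹)
    + 2 ^ α * (volume : Measure E).real (Metric.closedBall 0 2), ?_,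
    fun g B K hB0 hg hK hB y hy => ?_⟩
  · have : 0 ≤ ∫ x : E, 4 ^ (α + r) * A * ((1 + ‖x‖) ^ r)⁻¹ :=
      integral_nonneg fun x => by positivity
    positivity
  have hgi := hg.integrable hK
  have hGs := contDiff_high_pass_mul hκ hκ0 hg.smooth
  -- the high frequencies
  have hGint : ∀ n ≤ α + r, Integrable (iteratedFDeriv ℝ n (fun x => κ x * g x)) := by
    intro n hn
    obtain ⟨B', hB'0, hB'⟩ := hg.exists_bound n
    refine Integrable.mono' (hI.const_mul (4 ^ n * (A * B')))
      (hGs.continuous_iteratedFDeriv (m := n) (by exact_mod_cast le_top)).aestronglyMeasurable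
      (Filter.Eventually.of_forall fun x => ?_)
    exact norm_iteratedFDeriv_high_pass_mul_le hκ hκ0 hA0 hB'0
      (fun i hi => hA i (by omega)) hg.smooth hB' (by omega) x
  have hG : ‖𝓕 (fun x => κ x * g x) y‖ ≤ (∫ x : E, 4 ^ (α + r) * A * ((1 + ‖x‖) ^ r)⁻¹) * B := by
    have h := pow_norm_mul_norm_fourier_le hGs hGint y
    simp only [hy, one_pow, one_mul] at h
    refine h.trans ?_
    rw [← integral_mul_const]
    refine integral_mono (hGint _ le_rfl).norm ((hI.const_mul _).mul_const _) fun x => ?_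
    have := norm_iteratedFDeriv_high_pass_mul_le (n := α + r) (K := 0) (r := r) hκ hκ0 hA0 hB0 hA
      hg.smooth (fun i hi ξ hξ => by rw [pow_zero, mul_one]; exact hB i (by omega) ξ hξ)
      (by omega) x
    refine this.trans (le_of_eq ?_)
    ring
  -- the low frequencies
  have hGi : Integrable (fun x => κ x * g x) := by
    have := hGint 0 (Nat.zero_le _)
    refine this.norm.mono' hGs.continuous.aestronglyMeasurable
      (Filter.Eventually.of_forall fun x => ?_)
    rw [norm_iteratedFDeriv_zero]
  have hL : ‖𝓕 (fun x => (1 - κ x) * g x) y‖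
      ≤ 2 ^ α * (volume : Measure E).real (Metric.closedBall 0 2) * B := by
    refine (VectorFourier.norm_fourierIntegral_le_integral_norm _ _ _ _ _).trans ?_
    have h1 : ∀ᵐ x : E, ‖(1 - κ x) * g x‖
        ≤ (Metric.closedBall (0 : E) 2).indicator (fun _ => 2 ^ α * B) x := by
      have hne : ∀ᵐ ξ : E, ξ ≠ 0 := Measure.ae_ne volume 0
      filter_upwards [hne] with x hx
      by_cases h2 : x ∈ Metric.closedBall (0 : E) 2
      · rw [indicator_of_mem h2, norm_mul]
        have h3 := hB 0 (Nat.zero_le _) x hx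
        rw [pow_zero, one_mul, norm_iteratedFDeriv_zero] at h3
        have h4 : ‖x‖ ≤ 2 := by simpa using h2
        calc ‖1 - κ x‖ * ‖g x‖ ≤ 1 * (B * ‖x‖ ^ α) := by gcongr; exact hκn x
          _ ≤ 2 ^ α * B := by rw [one_mul, mul_comm]; gcongr
      · rw [indicator_of_notMem h2, hκ1 x (by simp at h2; exact h2.le)]
        simp
    calc _ ≤ ∫ x : E, (Metric.closedBall (0 : E) 2).indicator (fun _ => 2 ^ α * B) x := by
          refine integral_mono_of_nonneg (Filter.Eventually.of_forall fun x => norm_nonneg _) ?_ h1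
          exact (integrable_indicator_iff measurableSet_closedBall).2
              (integrableOn_const (isCompact_closedBall _ _).measure_lt_top.ne)
      _ = _ := by
        rw [integral_indicator_const _ measurableSet_closedBall, smul_eq_mul]; ring
  have hsum : 𝓕 g y = 𝓕 (fun x => κ x * g x) y + 𝓕 (fun x => (1 - κ x) * g x) y := by
    have hLi : Integrable (fun x => (1 - κ x) * g x) := by
      refine (hgi.sub hGi).congr (Filter.Eventually.of_forall fun x => ?_)
      simp only [Pi.sub_apply]; ring
    rw [Real.fourier_eq, Real.fourier_eq, Real.fourier_eq, ← integral_add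
      ((Real.fourierIntegral_convergent_iff y).2 hGi)
      ((Real.fourierIntegral_convergent_iff y).2 hLi)]
    refine integral_congr_ae (Filter.Eventually.of_forall fun x => ?_)
    simp only [← smul_add]
    congr 1; ring
  rw [hsum, add_mul]
  exact (norm_add_le _ _).trans (add_le_add hG hL)

theorem fourier_comp_smul (m : E → ℂ) {R : ℝ} (hR : 0 < R) (x : E) :
    𝓕 m (R • x) = ((R ^ Module.finrank ℝ E)⁻¹ : ℝ) • 𝓕 (fun z => m (R⁻¹ • z)) x := by
  rw [Real.fourier_eq, Real.fourier_eq]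
  have := Measure.integral_comp_smul (volume : Measure E)
    (fun z => Real.fourierChar (-⟪z, R • x⟫) • m z) R⁻¹
  simp only [real_inner_smul_left, real_inner_smul_right,
    mul_inv_cancel_left₀ hR.ne'] at this
  simp only [real_inner_smul_right]
  rw [this, smul_smul, abs_of_pos (by positivity), inv_pow, inv_inv,
    inv_mul_cancel₀ (by positivity), one_smul]

/-- The Fourier transform of a symbol of order `α` decays like `‖x‖ ^ (-(dim E + α))`. -/
theorem IsSymbol.exists_norm_fourier_le [Nontrivial E] {α K : ℕ} {m : E → ℂ}
    (hm : IsSymbol α K m) (hK : α + Module.finrank ℝ E + 1 ≤ K) :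
    ∃ C : ℝ, 0 ≤ C ∧ ∀ x, ‖𝓕 m x‖ ≤ C * ((1 + ‖x‖) ^ (Module.finrank ℝ E + α))⁻¹ := by
  set r := Module.finrank ℝ E + α with hr
  obtain ⟨C₀, hC₀, h⟩ := exists_norm_fourier_le_of_norm_eq_one (E := E) α
  obtain ⟨B, hB0, hB⟩ := hm.exists_bound (α + Module.finrank ℝ E + 1)
  have hint := hm.integrable hK
  have hI : 0 ≤ ∫ z, ‖m z‖ := integral_nonneg fun _ => norm_nonneg _
  refine ⟨2 ^ r * (C₀ * B + ∫ z, ‖m z‖), by positivity, fun x => ?_⟩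
  rw [← div_eq_mul_inv, le_div_iff₀ (by positivity)]
  rcases le_or_gt ‖x‖ 1 with hx | hx
  · have h1 : ‖𝓕 m x‖ ≤ ∫ z, ‖m z‖ := VectorFourier.norm_fourierIntegral_le_integral_norm _ _ _ _ _
    calc _ ≤ (∫ z, ‖m z‖) * (1 + 1) ^ r := by gcongr
      _ ≤ _ := by
        rw [mul_comm, one_add_one_eq_two]
        gcongr
        have : 0 ≤ C₀ * B := by positivity
        linarith
  · set R := ‖x‖ with hRdef
    have hR : 0 < R := by linarith
    have hR1 : R⁻¹ ≤ 1 := inv_le_one_of_one_le₀ hx.le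
    have hRi : 0 < R⁻¹ := inv_pos.2 hR
    have h1 := h (fun z => m (R⁻¹ • z)) (B * R⁻¹ ^ α) K (by positivity) (hm.comp_smul hRi hR1) hK
      (fun n hn η hη => by
        have h2 := hB n hn (R⁻¹ • η) (by simp [hR.ne', hη])
        rw [norm_iteratedFDeriv_comp_const_smul _ hRi.ne', abs_of_pos hRi]
        rw [norm_smul, Real.norm_of_nonneg hRi.le] at h2
        calc _ = (R⁻¹ * ‖η‖) ^ n * ‖iteratedFDeriv ℝ n m (R⁻¹ • η)‖ * 1 := by
              rw [mul_pow]; ring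
          _ ≤ (R⁻¹ * ‖η‖) ^ n * ‖iteratedFDeriv ℝ n m (R⁻¹ • η)‖ * (1 + R⁻¹ * ‖η‖) ^ K := by
            gcongr
            exact one_le_pow₀ (by have : 0 ≤ R⁻¹ * ‖η‖ := by positivity
                                  linarith)
          _ ≤ _ := h2.trans (le_of_eq (by rw [mul_pow]; ring)))
      (R⁻¹ • x) (by rw [norm_smul, Real.norm_of_nonneg hRi.le, ← hRdef, inv_mul_cancel₀ hR.ne'])
    have h3 := fourier_comp_smul m hR (R⁻¹ • x)
    rw [smul_smul, mul_inv_cancel₀ hR.ne', one_smul] at h3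
    rw [h3, norm_smul, Real.norm_of_nonneg (by positivity)]
    calc _ ≤ (R ^ Module.finrank ℝ E)⁻¹ * (C₀ * (B * R⁻¹ ^ α)) * (2 * R) ^ r := by
          gcongr; linarith
      _ = 2 ^ r * (C₀ * B) := by
        rw [mul_pow, hr, pow_add R, inv_pow]; field_simp
      _ ≤ _ := by gcongr; linarith

end Decay

/-! ### Partial Fourier transform of Schwartz functions -/

section PartialFourier

universe u

-- `E` and `F` share a universe, since the inductions on the order of derivatives below replace `F`
-- by the space of continuous linear maps from `E × ℝ` to `F`
variable {E F : Type u} [NormedAddCommGroup E] [NormedSpace ℝ E]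
  [NormedAddCommGroup F] [NormedSpace ℂ F]

theorem SchwartzMap.exists_one_add_pow_mul_norm_le {V : Type*} [NormedAddCommGroup V]
    [NormedSpace ℝ V] (Φ : 𝓢(V, F)) (N : ℕ) :
    ∃ C : ℝ, 0 ≤ C ∧ ∀ p, ‖Φ p‖ ≤ C * ((1 + ‖p‖) ^ N)⁻¹ := by
  have h := fun p => Φ.one_add_le_sup_seminorm_apply (𝕜 := ℝ) (m := (N, 0)) le_rfl le_rfl p
  simp only [norm_iteratedFDeriv_zero] at h
  exact ⟨_, le_trans (by positivity) (h 0), fun p => by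
    rw [← div_eq_mul_inv, le_div_iff₀ (by positivity), mul_comm]; exact h p⟩

theorem SchwartzMap.exists_norm_prod_le (Φ : 𝓢(E × ℝ, F)) :
    ∃ C : ℝ, 0 ≤ C ∧ ∀ η b, ‖Φ (η, b)‖ ≤ C * ((1 + ‖b‖) ^ 2)⁻¹ := by
  obtain ⟨C, hC0, hC⟩ := SchwartzMap.exists_one_add_pow_mul_norm_le Φ 2
  refine ⟨C, hC0, fun η b => (hC _).trans ?_⟩
  gcongr
  exact le_max_right _ _

theorem integrable_inv_one_add_norm_sq : Integrable (fun b : ℝ => ((1 + ‖b‖) ^ 2)⁻¹) :=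
  inv_one_add_norm_pow_integrable ℝ (by simp)

/-- The Fourier transform in the last variable. The kernel is `exp(2πiτb)`, with the sign of
Mathlib's inverse Fourier transform. -/
noncomputable def partialFourier (Φ : E × ℝ → F) (p : E × ℝ) : F :=
  ∫ b : ℝ, Complex.exp (2 * Real.pi * p.2 * b * Complex.I) • Φ (p.1, b)

theorem norm_exp_phase (τ b : ℝ) : ‖Complex.exp (2 * Real.pi * τ * b * Complex.I)‖ = 1 := by
  have : (2 * Real.pi * τ * b * Complex.I : ℂ) = ((2 * Real.pi * τ * b : ℝ) : ℂ) * Complex.I := by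
    push_cast; ring
  rw [this, Complex.norm_exp_ofReal_mul_I]

theorem norm_partialFourier_le (Φ : 𝓢(E × ℝ, F)) : ∃ C : ℝ, ∀ p, ‖partialFourier Φ p‖ ≤ C := by
  obtain ⟨C, hC0, hC⟩ := SchwartzMap.exists_norm_prod_le Φ
  refine ⟨∫ b : ℝ, C * ((1 + ‖b‖) ^ 2)⁻¹, fun p => ?_⟩
  refine norm_integral_le_of_norm_le (integrable_inv_one_add_norm_sq.const_mul C)
    (Filter.Eventually.of_forall fun b => ?_)
  rw [norm_smul, norm_exp_phase, one_mul]
  exact hC _ _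

/-- The derivative of the partial Fourier transform of `Φ` is the partial Fourier transform of
this Schwartz function, `v ↦ ∂_{(v₁, 0)} Φ + 2πib v₂ Φ`. -/
noncomputable def partialFourierDeriv (Φ : 𝓢(E × ℝ, F)) : 𝓢(E × ℝ, E × ℝ →L[ℝ] F) :=
  SchwartzMap.postcompCLM (𝕜 := ℝ) ((ContinuousLinearMap.compL ℝ (E × ℝ) (E × ℝ) F).flip
      ((ContinuousLinearMap.inl ℝ E ℝ).comp (ContinuousLinearMap.fst ℝ E ℝ)))
    (SchwartzMap.fderivCLM ℝ (E × ℝ) F Φ)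
  + SchwartzMap.smulRightCLM ℝ F ((ContinuousLinearMap.snd ℝ E ℝ).smulRight
      (ContinuousLinearMap.snd ℝ E ℝ))
    (SchwartzMap.postcompCLM (𝕜 := ℝ)
      (((2 * Real.pi * Complex.I : ℂ)) • ContinuousLinearMap.id ℝ F) Φ)

theorem partialFourierDeriv_apply (Φ : 𝓢(E × ℝ, F)) (p v : E × ℝ) :
    partialFourierDeriv Φ p v
      = fderiv ℝ Φ p (v.1, 0) + (p.2 * v.2) • ((2 * Real.pi * Complex.I : ℂ) • Φ p) := by
  simp [partialFourierDeriv]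

theorem hasFDerivAt_partialFourier (Φ : 𝓢(E × ℝ, F)) (p : E × ℝ) :
    HasFDerivAt (partialFourier Φ) (partialFourier (partialFourierDeriv Φ) p) p := by
  obtain ⟨C, hC0, hC⟩ := SchwartzMap.exists_norm_prod_le Φ
  obtain ⟨C', hC'0, hC'⟩ := SchwartzMap.exists_norm_prod_le (partialFourierDeriv Φ)
  have hm : ∀ p : E × ℝ, Continuous fun b : ℝ =>
      Complex.exp (2 * Real.pi * p.2 * b * Complex.I) • Φ (p.1, b) := fun p =>
    Continuous.smul (by fun_prop) (Φ.continuous.comp (by fun_prop : Continuous fun b : ℝ => (p.1, b)))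
  refine hasFDerivAt_integral_of_dominated_of_fderiv_le (s := univ)
    (F := fun (p : E × ℝ) (b : ℝ) =>
      Complex.exp (2 * Real.pi * p.2 * b * Complex.I) • Φ (p.1, b))
    (F' := fun (p : E × ℝ) (b : ℝ) =>
      Complex.exp (2 * Real.pi * p.2 * b * Complex.I) • partialFourierDeriv Φ (p.1, b))
    (bound := fun b => C' * ((1 + ‖b‖) ^ 2)⁻¹)
    Filter.univ_mem (Filter.Eventually.of_forall fun p => (hm p).aestronglyMeasurable)
    ?_ ?_ ?_ ?_ ?_
  · refine (integrable_inv_one_add_norm_sq.const_mul C).mono' (hm p).aestronglyMeasurable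
      (Filter.Eventually.of_forall fun b => ?_)
    rw [norm_smul, norm_exp_phase, one_mul]; exact hC _ _
  · refine Continuous.aestronglyMeasurable (Continuous.smul
      (f := fun b : ℝ => Complex.exp (2 * Real.pi * p.2 * b * Complex.I)) (by fun_prop) ?_)
    exact (partialFourierDeriv Φ).continuous.comp (by fun_prop : Continuous fun b : ℝ => (p.1, b))
  · refine Filter.Eventually.of_forall fun b q _ => ?_
    rw [norm_smul, norm_exp_phase, one_mul]; exact hC' _ _
  · exact integrable_inv_one_add_norm_sq.const_mul C'
  · refine Filter.Eventually.of_forall fun b q _ => ?_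
    have h1 : HasFDerivAt (fun q : E × ℝ => Complex.exp (2 * Real.pi * q.2 * b * Complex.I))
        ((ContinuousLinearMap.snd ℝ E ℝ).smulRight
          (Complex.exp (2 * Real.pi * q.2 * b * Complex.I) * (2 * Real.pi * b * Complex.I))) q := by
      have h0 : HasDerivAt (fun τ : ℝ => Complex.exp (2 * Real.pi * τ * b * Complex.I))
          (Complex.exp (2 * Real.pi * q.2 * b * Complex.I) * (2 * Real.pi * b * Complex.I)) q.2 := by
        have h3 : HasDerivAt (fun τ : ℝ => (2 * Real.pi * τ * b * Complex.I : ℂ))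
            (2 * Real.pi * b * Complex.I) q.2 := by
          have := ((Complex.ofRealCLM.hasDerivAt (x := q.2)).const_mul
            (2 * Real.pi : ℂ)).mul_const (b * Complex.I : ℂ)
          simp only [Complex.ofRealCLM_apply, Complex.ofReal_one, mul_one, ← mul_assoc] at this
          exact this
        exact h3.cexp
      exact h0.hasFDerivAt.comp q (ContinuousLinearMap.snd ℝ E ℝ).hasFDerivAt |>.congr_fderiv (by
        ext v <;> simp)
    have h2 : HasFDerivAt (fun q : E × ℝ => Φ (q.1, b)) ((fderiv ℝ Φ (q.1, b)).comp
        ((ContinuousLinearMap.inl ℝ E ℝ).comp (ContinuousLinearMap.fst ℝ E ℝ))) q := by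
      have h3 : HasFDerivAt Φ (fderiv ℝ Φ (q.1, b)) (q.1, b) := Φ.differentiableAt.hasFDerivAt
      have h4 : HasFDerivAt (fun q : E × ℝ => (q.1, b))
          ((ContinuousLinearMap.inl ℝ E ℝ).comp (ContinuousLinearMap.fst ℝ E ℝ)) q := by
        have := (ContinuousLinearMap.fst ℝ E ℝ).hasFDerivAt (x := q)
        exact (this.prodMk (hasFDerivAt_const b q)).congr_fderiv (by ext v <;> simp)
      exact h3.comp q h4
    refine (h1.smul h2).congr_fderiv ?_
    refine ContinuousLinearMap.ext fun v => ?_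
    simp only [add_apply, smul_apply,
      partialFourierDeriv_apply, ContinuousLinearMap.comp_apply, ContinuousLinearMap.smulRight_apply,
      ContinuousLinearMap.inl_apply, ContinuousLinearMap.coe_fst', ContinuousLinearMap.coe_snd',
      smul_add, Complex.real_smul]
    congr 1
    rw [← Complex.coe_smul, smul_smul, smul_smul]
    congr 1
    push_cast; ring

/-- One integration by parts in the last variable. -/
theorem norm_mul_norm_partialFourier (Φ : 𝓢(E × ℝ, F)) (p : E × ℝ) :
    ‖p.2‖ * ‖partialFourier Φ p‖
      ≤ ‖partialFourier (SchwartzMap.evalCLM ℝ (E × ℝ) F ((0 : E), (1 : ℝ))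
          (SchwartzMap.fderivCLM ℝ (E × ℝ) F Φ)) p‖ := by
  have key : ∀ Ψ : ℝ → F, (∫ b : ℝ, Complex.exp (2 * Real.pi * p.2 * b * Complex.I) • Ψ b)
      = 𝓕 Ψ (-p.2) := by
    intro Ψ
    rw [Real.fourier_real_eq_integral_exp_smul]
    congr 1; funext b; congr 2; push_cast; ring
  have hint : ∀ Ψ : 𝓢(E × ℝ, F), Integrable fun b => Ψ (p.1, b) := by
    intro Ψ
    obtain ⟨C, hC0, hC⟩ := SchwartzMap.exists_norm_prod_le Ψ
    exact (integrable_inv_one_add_norm_sq.const_mul C).mono'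
      (Ψ.continuous.comp (by fun_prop)).aestronglyMeasurable
      (Filter.Eventually.of_forall fun b => hC _ _)
  have hd : ∀ b, HasDerivAt (fun b => Φ (p.1, b)) (SchwartzMap.evalCLM ℝ (E × ℝ) F
      ((0 : E), (1 : ℝ)) (SchwartzMap.fderivCLM ℝ (E × ℝ) F Φ) (p.1, b)) b := by
    intro b
    have h3 : HasFDerivAt Φ (fderiv ℝ Φ (p.1, b)) (p.1, b) := Φ.differentiableAt.hasFDerivAt
    exact h3.comp_hasDerivAt b ((hasDerivAt_const b p.1).prodMk (hasDerivAt_id b))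
  have h := Real.fourier_deriv (hint Φ) (fun b => (hd b).differentiableAt)
    ((hint _).congr (Filter.Eventually.of_forall fun b => (hd b).deriv.symm))
  rw [funext fun b => (hd b).deriv] at h
  have h2 := congrFun h (-p.2)
  unfold partialFourier
  rw [key (fun b => Φ (p.1, b)), key (fun b => SchwartzMap.evalCLM ℝ (E × ℝ) F
      ((0 : E), (1 : ℝ)) (SchwartzMap.fderivCLM ℝ (E × ℝ) F Φ) (p.1, b)), h2, norm_smul]
  gcongr
  simp only [norm_mul, Complex.norm_I, Complex.norm_real, norm_neg]
  rw [Real.norm_of_nonneg Real.pi_pos.le]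
  have : ‖(2 : ℂ)‖ = 2 := by norm_num
  rw [this]
  nlinarith [Real.pi_gt_three, norm_nonneg p.2]

theorem fderiv_partialFourier (Φ : 𝓢(E × ℝ, F)) :
    fderiv ℝ (partialFourier Φ) = partialFourier (partialFourierDeriv Φ) :=
  funext fun p => (hasFDerivAt_partialFourier Φ p).fderiv

theorem differentiable_partialFourier (Φ : 𝓢(E × ℝ, F)) :
    Differentiable ℝ (partialFourier Φ) :=
  fun p => (hasFDerivAt_partialFourier Φ p).differentiableAt

theorem exists_pow_mul_norm_partialFourier_le (K : ℕ) : ∀ (Φ : 𝓢(E × ℝ, F)),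
    ∃ C : ℝ, ∀ p : E × ℝ, ‖p.2‖ ^ K * ‖partialFourier Φ p‖ ≤ C := by
  induction K with
  | zero => intro Φ; simpa using norm_partialFourier_le Φ
  | succ K ih =>
    intro Φ
    obtain ⟨C, hC⟩ := ih (SchwartzMap.evalCLM ℝ (E × ℝ) F ((0 : E), (1 : ℝ))
          (SchwartzMap.fderivCLM ℝ (E × ℝ) F Φ))
    refine ⟨C, fun p => ?_⟩
    rw [pow_succ, mul_assoc]
    exact (mul_le_mul_of_nonneg_left (norm_mul_norm_partialFourier Φ p) (by positivity)).trans (hC p)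

end PartialFourier

section PartialFourierSmooth

universe u

variable {E : Type u} [NormedAddCommGroup E] [NormedSpace ℝ E]

theorem contDiff_nat_partialFourier (n : ℕ) : ∀ {F : Type u} [NormedAddCommGroup F]
    [NormedSpace ℂ F] (Φ : 𝓢(E × ℝ, F)), ContDiff ℝ n (partialFourier Φ) := by
  induction n with
  | zero => intro F _ _ Φ; exact contDiff_zero.2 (differentiable_partialFourier Φ).continuous
  | succ n ih =>
    intro F _ _ Φ
    push_cast
    rw [contDiff_succ_iff_fderiv]
    refine ⟨differentiable_partialFourier Φ, by simp, ?_⟩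
    rw [fderiv_partialFourier]
    exact ih _

theorem contDiff_partialFourier {F : Type u} [NormedAddCommGroup F]
    [NormedSpace ℂ F] (Φ : 𝓢(E × ℝ, F)) : ContDiff ℝ ∞ (partialFourier Φ) :=
  contDiff_infty.2 fun n => contDiff_nat_partialFourier n Φ

theorem exists_pow_mul_norm_iteratedFDeriv_partialFourier_le (n : ℕ) :
    ∀ {F : Type u} [NormedAddCommGroup F] [NormedSpace ℂ F] (Φ : 𝓢(E × ℝ, F)) (K : ℕ),
    ∃ C : ℝ, ∀ p : E × ℝ, ‖p.2‖ ^ K * ‖iteratedFDeriv ℝ n (partialFourier Φ) p‖ ≤ C := by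
  induction n with
  | zero => intro F _ _ Φ K; simpa using exists_pow_mul_norm_partialFourier_le K Φ
  | succ n ih =>
    intro F _ _ Φ K
    obtain ⟨C, hC⟩ := ih (partialFourierDeriv Φ) K
    refine ⟨C, fun p => ?_⟩
    rw [← norm_iteratedFDeriv_fderiv, fderiv_partialFourier]
    exact hC p

/-- The partial Fourier transform of a Schwartz function is smooth, and its derivatives decrease
rapidly in the last variable. -/
theorem exists_norm_iteratedFDeriv_partialFourier_le {F : Type u} [NormedAddCommGroup F]
    [NormedSpace ℂ F] (Φ : 𝓢(E × ℝ, F)) (n K : ℕ) :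
    ∃ C : ℝ, 0 ≤ C ∧ ∀ p : E × ℝ,
      ‖iteratedFDeriv ℝ n (partialFourier Φ) p‖ * (1 + ‖p.2‖) ^ K ≤ C := by
  obtain ⟨C₀, h₀⟩ := exists_pow_mul_norm_iteratedFDeriv_partialFourier_le n Φ 0
  obtain ⟨C₁, h₁⟩ := exists_pow_mul_norm_iteratedFDeriv_partialFourier_le n Φ K
  have key : ∀ p : E × ℝ, ‖iteratedFDeriv ℝ n (partialFourier Φ) p‖ * (1 + ‖p.2‖) ^ K
      ≤ 2 ^ (K - 1) * (C₀ + C₁) := by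
    intro p
    have h2 := add_pow_le (zero_le_one (α := ℝ)) (norm_nonneg p.2) K
    calc _ ≤ ‖iteratedFDeriv ℝ n (partialFourier Φ) p‖ * (2 ^ (K - 1) * (1 ^ K + ‖p.2‖ ^ K)) := by
          gcongr
      _ = 2 ^ (K - 1) * (‖p.2‖ ^ 0 * ‖iteratedFDeriv ℝ n (partialFourier Φ) p‖
          + ‖p.2‖ ^ K * ‖iteratedFDeriv ℝ n (partialFourier Φ) p‖) := by
          rw [one_pow, pow_zero]; ring
      _ ≤ _ := by gcongr; exacts [h₀ p, h₁ p]
  exact ⟨_, le_trans (by positivity) (key 0), key⟩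

end PartialFourierSmooth

/-! ### Fourier transform of a density along rays -/

section RayFourier

variable {d : ℕ}

theorem rayExtension_smul (c : Weight d → ℝ) {t : ℝ} (ht : 0 < t) (ξ : Space d) (b : ℝ) :
    rayExtension c (t • ξ, b) = rayExtension c (ξ, b) := by
  unfold rayExtension
  by_cases h : ξ = 0
  · simp [h]
  · have h' : t • ξ ≠ 0 := smul_ne_zero ht.ne' h
    simp only [h, h', dif_neg, not_false_eq_true]
    congr 2
    ext1
    simp only [norm_smul, Real.norm_of_nonneg ht.le, smul_smul]
    congr 1
    field_simp

theorem rayExtension_sphere (c : Weight d → ℝ) (a : Metric.sphere (0 : Space d) 1) (b : ℝ) :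
    rayExtension c ((a : Space d), b) = c (a, b) := by
  have ha : ‖(a : Space d)‖ = 1 := by simp
  have h : (a : Space d) ≠ 0 := by intro h; rw [h, norm_zero] at ha; exact zero_ne_one ha
  unfold rayExtension
  simp only [h, dif_neg, not_false_eq_true]
  congr 2
  ext1
  simp [ha]

/-- `ξ ↦ ∫ c(ξ/‖ξ‖, b) exp(2πi‖ξ‖b) db`: the function on frequency space whose restriction to the
ray through `a` is the (inverse) Fourier transform of `c(a, ·)`. -/
noncomputable def rayFourier (c : Weight d → ℝ) (ξ : Space d) : ℂ :=
  partialFourier (fun p => (rayExtension c p : ℂ)) (ξ, ‖ξ‖)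

theorem rayFourier_smul (c : Weight d → ℝ) {t : ℝ} (ht : 0 < t) (ξ : Space d) :
    rayFourier c (t • ξ) = partialFourier (fun p => (rayExtension c p : ℂ)) (ξ, t * ‖ξ‖) := by
  simp only [rayFourier, partialFourier, norm_smul, Real.norm_of_nonneg ht.le,
    rayExtension_smul c ht]

/-- By homogeneity, the derivatives of the extension along rays are controlled by those on the
sphere. -/
theorem norm_iteratedFDeriv_rayExtension_le (c : Weight d → ℝ) (n : ℕ)
    {ξ : Space d} (hξ : ξ ≠ 0) (b : ℝ) :
    ∃ a : Metric.sphere (0 : Space d) 1, ‖iteratedFDeriv ℝ n (rayExtension c) (ξ, b)‖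
      ≤ (1 + ‖ξ‖⁻¹) ^ n * ‖iteratedFDeriv ℝ n (rayExtension c) ((a : Space d), b)‖ := by
  have hpos : 0 < ‖ξ‖ := norm_pos_iff.2 hξ
  have hi : 0 < ‖ξ‖⁻¹ := inv_pos.2 hpos
  refine ⟨⟨‖ξ‖⁻¹ • ξ, by
    rw [mem_sphere_zero_iff_norm]; exact norm_smul_inv_norm (𝕜 := ℝ) hξ⟩, ?_⟩
  let L : (Space d × ℝ) ≃L[ℝ] (Space d × ℝ) :=
    (ContinuousLinearEquiv.smulLeft (R₁ := ℝ) (M₁ := Space d) (Units.mk0 ‖ξ‖⁻¹ hi.ne')).prodCongr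
      (ContinuousLinearEquiv.refl ℝ ℝ)
  have hL : ∀ p : Space d × ℝ, L p = (‖ξ‖⁻¹ • p.1, p.2) := fun p => rfl
  have hcomp : rayExtension c ∘ L = rayExtension c := by
    funext p
    rw [Function.comp_apply, hL, rayExtension_smul c hi]
  have h := L.iteratedFDerivWithin_comp_right (rayExtension c) uniqueDiffOn_univ
    (x := (ξ, b)) (mem_univ _) n
  simp only [preimage_univ, iteratedFDerivWithin_univ] at h
  rw [hcomp] at h
  rw [h]
  refine (ContinuousMultilinearMap.norm_compContinuousLinearMap_le _ _).trans ?_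
  rw [Finset.prod_const, Finset.card_univ, Fintype.card_fin, mul_comm]
  gcongr
  · refine ContinuousLinearMap.opNorm_le_bound _ (by positivity) fun p => ?_
    change ‖L p‖ ≤ _
    rw [hL, Prod.norm_mk, norm_smul, Real.norm_of_nonneg hi.le]
    refine max_le ?_ ?_
    · gcongr
      · linarith
      · exact le_max_left _ _
    · calc ‖p.2‖ = 1 * ‖p.2‖ := (one_mul _).symm
        _ ≤ _ := by
          gcongr
          · linarith
          · exact le_max_right _ _
  · rfl

/-- A smooth function on space supported in an annulus that is `1` near the unit sphere. -/
theorem exists_annulus_cutoff (d : ℕ) : ∃ ρ : Space d → ℝ, ContDiff ℝ ∞ ρ ∧ HasCompactSupport ρ ∧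
    (∀ ξ ∈ tsupport ρ, 1 / 2 ≤ ‖ξ‖ ∧ ‖ξ‖ ≤ 2) ∧
    ∀ ξ : Space d, ‖ξ‖ = 1 → ∀ᶠ z in nhds ξ, ρ z = 1 := by
  let β : ContDiffBump (1 : ℝ) := ⟨1 / 4, 1 / 2, by norm_num, by norm_num⟩
  have hsupp : ∀ ξ ∈ tsupport (fun ξ : Space d => β (‖ξ‖ ^ 2)), 1 / 2 ≤ ‖ξ‖ ∧ ‖ξ‖ ≤ 2 := by
    intro ξ hξ
    have hcl : IsClosed {ξ : Space d | |‖ξ‖ ^ 2 - 1| ≤ 1 / 2} :=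
      isClosed_le (by fun_prop) continuous_const
    have hsub : tsupport (fun ξ : Space d => β (‖ξ‖ ^ 2)) ⊆ {ξ : Space d | |‖ξ‖ ^ 2 - 1| ≤ 1 / 2} := by
      refine closure_minimal (fun z hz => ?_) hcl
      by_contra hcon
      refine hz (β.zero_of_le_dist ?_)
      rw [Real.dist_eq]
      exact (not_le.1 hcon).le
    have h := hsub hξ
    rw [mem_ofPred_eq, abs_le] at h
    constructor
    · nlinarith [norm_nonneg ξ]
    · nlinarith [norm_nonneg ξ]
  refine ⟨fun ξ => β (‖ξ‖ ^ 2), β.contDiff.comp (contDiff_norm_sq ℝ), ?_, hsupp, ?_⟩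
  · refine HasCompactSupport.of_support_subset_isCompact (isCompact_closedBall (0 : Space d) 2)
      fun z hz => ?_
    simpa using (hsupp z (subset_closure hz)).2
  · intro ξ hξ
    have ho : IsOpen {z : Space d | |‖z‖ ^ 2 - 1| < 1 / 4} :=
      isOpen_lt (by fun_prop) continuous_const
    filter_upwards [ho.mem_nhds (by simp [hξ] : ξ ∈ {z : Space d | |‖z‖ ^ 2 - 1| < 1 / 4})] with z hz
    refine β.one_of_mem_closedBall ?_
    rw [Metric.mem_closedBall, Real.dist_eq]
    exact hz.le

theorem IsRapidlyDecreasing.exists_bound {c : Weight d → ℝ} (hc : IsRapidlyDecreasing c)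
    (n N : ℕ) : ∃ C : ℝ, 0 ≤ C ∧ ∀ i ≤ n, ∀ (a : Metric.sphere (0 : Space d) 1) (b : ℝ),
      |b| ^ N * ‖iteratedFDeriv ℝ i (rayExtension c) ((a : Space d), b)‖ ≤ C := by
  choose C hC using fun i => hc.decay i N
  refine ⟨∑ i ∈ Finset.range (n + 1), |C i|, Finset.sum_nonneg fun _ _ => abs_nonneg _,
    fun i hi a b => (hC i a b).trans ((le_abs_self _).trans ?_)⟩
  exact Finset.single_le_sum (f := fun i => |C i|) (fun _ _ => abs_nonneg _)
    (Finset.mem_range.2 (by omega))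

/-- Cutting the ray extension of a rapidly decreasing density off to an annulus gives a Schwartz
function. -/
theorem exists_schwartz_extension {c : Weight d → ℝ} (hc : IsRapidlyDecreasing c) :
    ∃ Φ : 𝓢(Space d × ℝ, ℝ), ∀ ξ : Space d, ‖ξ‖ = 1 →
      ∀ᶠ z in nhds ξ, ∀ b, Φ (z, b) = rayExtension c (z, b) := by
  obtain ⟨ρ, hρ, hρc, hρs, hρ1⟩ := exists_annulus_cutoff d
  have ho : IsOpen {p : Space d × ℝ | p.1 ≠ 0} := isOpen_ne_fun continuous_fst continuous_const
  have hρ' : ContDiff ℝ ∞ (fun p : Space d × ℝ => ρ p.1) := hρ.comp contDiff_fst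
  have hzero : ∀ p : Space d × ℝ, p.1 ∉ tsupport ρ →
      (fun p : Space d × ℝ => ρ p.1 * rayExtension c p) =ᶠ[nhds p] fun _ => 0 := by
    intro p hp
    have : ∀ᶠ z in nhds p.1, z ∉ tsupport ρ := (isClosed_tsupport ρ).isOpen_compl.mem_nhds hp
    filter_upwards [continuous_fst.continuousAt.eventually this] with z hz
    rw [image_eq_zero_of_notMem_tsupport hz, zero_mul]
  have hne : ∀ p : Space d × ℝ, p.1 ∈ tsupport ρ → p ∈ {p : Space d × ℝ | p.1 ≠ 0} := by
    intro p hp h0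
    have := (hρs _ hp).1
    rw [h0, norm_zero] at this
    linarith
  have hsm : ContDiff ℝ ∞ (fun p : Space d × ℝ => ρ p.1 * rayExtension c p) := by
    refine contDiff_iff_contDiffAt.2 fun p => ?_
    by_cases hp : p.1 ∈ tsupport ρ
    · exact hρ'.contDiffAt.mul (hc.smooth.contDiffAt (ho.mem_nhds (hne p hp)))
    · exact contDiffAt_const.congr_of_eventuallyEq (hzero p hp)
  have hρb : ∀ n : ℕ, ∃ C : ℝ, 0 ≤ C ∧ ∀ i ≤ n, ∀ p : Space d × ℝ,
      ‖iteratedFDeriv ℝ i (fun p : Space d × ℝ => ρ p.1) p‖ ≤ C := by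
    intro n
    have h1 : ∀ i : ℕ, ∃ C : ℝ, ∀ ξ, ‖iteratedFDeriv ℝ i ρ ξ‖ ≤ C := fun i =>
      (hρ.continuous_iteratedFDeriv (m := i) (by exact_mod_cast le_top)).bounded_above_of_compact_support
        (hρc.iteratedFDeriv i)
    choose C hC using h1
    have hC0 : ∀ i, 0 ≤ C i := fun i => (norm_nonneg _).trans (hC i 0)
    refine ⟨∑ i ∈ Finset.range (n + 1), C i, Finset.sum_nonneg fun i _ => hC0 i,
      fun i hi p => ?_⟩
    have h2 := (ContinuousLinearMap.fst ℝ (Space d) ℝ).iteratedFDeriv_comp_right hρ p (i := i)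
      (by exact_mod_cast le_top)
    have h3 : (ρ ∘ (ContinuousLinearMap.fst ℝ (Space d) ℝ)) = fun p : Space d × ℝ => ρ p.1 := rfl
    rw [h3] at h2
    rw [h2]
    refine (ContinuousMultilinearMap.norm_compContinuousLinearMap_le _ _).trans ?_
    rw [Finset.prod_const, Finset.card_univ, Fintype.card_fin]
    calc _ ≤ C i * 1 ^ i := by
          gcongr
          · exact hC0 i
          · exact hC i _
          · exact ContinuousLinearMap.norm_fst_le ℝ (Space d) ℝ
      _ = C i := by rw [one_pow, mul_one]
      _ ≤ _ := Finset.single_le_sum (f := C) (fun i _ => hC0 i) (Finset.mem_range.2 (by omega))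
  refine ⟨⟨fun p => ρ p.1 * rayExtension c p, hsm, fun k n => ?_⟩, ?_⟩
  · obtain ⟨A, hA0, hA⟩ := hρb n
    obtain ⟨C₀, hC₀0, hC₀⟩ := hc.exists_bound n 0
    obtain ⟨C₁, hC₁0, hC₁⟩ := hc.exists_bound n k
    refine ⟨2 ^ (k - 1) * (2 ^ n * (A * (3 ^ n * (2 ^ k * C₀ + C₁)))), fun p => ?_⟩
    by_cases hp : p.1 ∈ tsupport ρ
    swap
    · rw [((hzero p hp).iteratedFDeriv ℝ n).eq_of_nhds, iteratedFDeriv_fun_zero, Pi.zero_apply,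
        norm_zero, mul_zero]
      positivity
    obtain ⟨hl, hu⟩ := hρs _ hp
    have hp0 : p.1 ≠ 0 := hne p hp
    have hnorm : ‖p‖ ≤ 2 + |p.2| := by
      rw [Prod.norm_def]
      refine max_le (by linarith [abs_nonneg p.2]) ?_
      rw [Real.norm_eq_abs]; linarith
    have hinv : ‖p.1‖⁻¹ ≤ 2 := by
      have := inv_anti₀ (by norm_num) hl
      simpa using this
    have hbd : ∀ i ≤ n, (2 ^ k + |p.2| ^ k) * ‖iteratedFDeriv ℝ i (rayExtension c) p‖
        ≤ 3 ^ n * (2 ^ k * C₀ + C₁) := by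
      intro i hi
      obtain ⟨a, ha⟩ := norm_iteratedFDeriv_rayExtension_le c i hp0 p.2
      have h0 := hC₀ i hi a p.2
      have h1 := hC₁ i hi a p.2
      rw [pow_zero, one_mul] at h0
      set D := ‖iteratedFDeriv ℝ i (rayExtension c) ((a : Space d), p.2)‖
      have hD : 0 ≤ D := norm_nonneg _
      have h3 : (1 + ‖p.1‖⁻¹) ^ i ≤ 3 ^ n :=
        calc (1 + ‖p.1‖⁻¹) ^ i ≤ 3 ^ i := by gcongr; linarith
          _ ≤ 3 ^ n := by gcongr; norm_num
      calc _ ≤ (2 ^ k + |p.2| ^ k) * (3 ^ n * D) := by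
            gcongr
            exact ha.trans (by gcongr)
        _ = 3 ^ n * (2 ^ k * D + |p.2| ^ k * D) := by ring
        _ ≤ _ := by gcongr
    have hmul := norm_iteratedFDerivWithin_mul_le hρ'.contDiffOn hc.smooth ho.uniqueDiffOn
      (hne p hp) (n := n) (by exact_mod_cast le_top)
    simp only [fun i (f : Space d × ℝ → ℝ) =>
      iteratedFDerivWithin_of_isOpen (𝕜 := ℝ) (f := f) i ho (hne p hp)] at hmul
    calc _ ≤ (2 + |p.2|) ^ k * ∑ i ∈ Finset.range (n + 1), (n.choose i : ℝ)
          * ‖iteratedFDeriv ℝ i (fun p : Space d × ℝ => ρ p.1) p‖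
          * ‖iteratedFDeriv ℝ (n - i) (rayExtension c) p‖ := by gcongr
      _ ≤ (2 ^ (k - 1) * (2 ^ k + |p.2| ^ k)) * ∑ i ∈ Finset.range (n + 1), (n.choose i : ℝ)
          * ‖iteratedFDeriv ℝ i (fun p : Space d × ℝ => ρ p.1) p‖
          * ‖iteratedFDeriv ℝ (n - i) (rayExtension c) p‖ := by
        gcongr
        exact add_pow_le zero_le_two (abs_nonneg _) k
      _ = 2 ^ (k - 1) * ∑ i ∈ Finset.range (n + 1), (n.choose i : ℝ)
          * (‖iteratedFDeriv ℝ i (fun p : Space d × ℝ => ρ p.1) p‖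
          * ((2 ^ k + |p.2| ^ k) * ‖iteratedFDeriv ℝ (n - i) (rayExtension c) p‖)) := by
        rw [mul_assoc, Finset.mul_sum]
        congr 1
        exact Finset.sum_congr rfl fun i _ => by ring
      _ ≤ 2 ^ (k - 1) * ∑ i ∈ Finset.range (n + 1), (n.choose i : ℝ)
          * (A * (3 ^ n * (2 ^ k * C₀ + C₁))) := by
        gcongr ?_ * ?_
        refine Finset.sum_le_sum fun i hi => mul_le_mul_of_nonneg_left ?_ (Nat.cast_nonneg _)
        exact mul_le_mul (hA i (by have := Finset.mem_range.1 hi; omega) p) (hbd _ (by omega))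
          (by positivity) hA0
      _ = _ := by
        rw [← Finset.sum_mul]
        have h3 : (∑ i ∈ Finset.range (n + 1), (n.choose i : ℝ)) = 2 ^ n := by
          exact_mod_cast Nat.sum_range_choose n
        rw [h3]
  · intro ξ hξ
    filter_upwards [hρ1 ξ hξ] with z hz b
    change ρ z * rayExtension c (z, b) = _
    rw [hz, one_mul]

/-- For a rapidly decreasing density, `rayFourier` is a symbol of order `0`: it jumps at the
origin, but is otherwise as good as a Schwartz function. -/
theorem isSymbol_rayFourier {c : Weight d → ℝ} (hc : IsRapidlyDecreasing c) (K : ℕ) :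
    IsSymbol 0 K (rayFourier c) := by
  obtain ⟨Φ₀, hΦ₀⟩ := exists_schwartz_extension hc
  let Φ : 𝓢(Space d × ℝ, ℂ) := SchwartzMap.postcompCLM (𝕜 := ℝ) Complex.ofRealCLM Φ₀
  have hA := contDiff_partialFourier Φ
  have ho : IsOpen ({0}ᶜ : Set (Space d)) := isOpen_compl_singleton
  let T : ℝ → (Space d × ℝ) →L[ℝ] (Space d × ℝ) := fun t =>
    (ContinuousLinearMap.id ℝ (Space d)).prodMap (t • ContinuousLinearMap.id ℝ ℝ)
  have hι : ContDiffOn ℝ ∞ (fun z : Space d => (z, ‖z‖)) {0}ᶜ := fun z hz =>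
    (contDiffAt_id.prodMk (contDiffAt_norm ℝ hz)).contDiffWithinAt
  have hloc : ∀ t : ℝ, 0 < t → ∀ η : Space d, ‖η‖ = 1 →
      (fun z => rayFourier c (t • z)) =ᶠ[nhds η]
        (partialFourier Φ ∘ T t) ∘ (fun z : Space d => (z, ‖z‖)) := by
    intro t ht η hη
    filter_upwards [hΦ₀ η hη] with z hz
    rw [rayFourier_smul c ht]
    simp only [partialFourier, Function.comp_apply]
    congr 1
    funext b
    change _ = Complex.exp (2 * Real.pi * ((t * ‖z‖ : ℝ) : ℂ) * b * Complex.I)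
      • ((Φ₀ (z, b) : ℝ) : ℂ)
    rw [hz b]
  have hTs : ∀ t, ContDiff ℝ ∞ (partialFourier Φ ∘ T t) := fun t => hA.comp (T t).contDiff
  refine IsSymbol.of_sphere ?_ ?_
  · intro ξ hξ
    have hpos : 0 < ‖ξ‖ := norm_pos_iff.2 hξ
    have hη : ‖‖ξ‖⁻¹ • ξ‖ = 1 := by simp [norm_smul, hpos.ne']
    have hη0 : ‖ξ‖⁻¹ • ξ ∈ ({0}ᶜ : Set (Space d)) := by
      intro h; rw [mem_singleton_iff.1 h, norm_zero] at hη; exact zero_ne_one hη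
    have h1 : ContDiffAt ℝ ∞ (fun z => rayFourier c (‖ξ‖ • z)) (‖ξ‖⁻¹ • ξ) :=
      ((hTs _).contDiffAt.comp _ (hι.contDiffAt (ho.mem_nhds hη0))).congr_of_eventuallyEq
        (hloc _ hpos _ hη)
    have h2 : ContDiffAt ℝ ∞ (fun z => rayFourier c (‖ξ‖ • (‖ξ‖⁻¹ • z))) ξ :=
      h1.comp ξ (contDiff_const_smul ‖ξ‖⁻¹).contDiffAt
    simp only [smul_smul, mul_inv_cancel₀ hpos.ne', one_smul] at h2
    exact h2.contDiffWithinAt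
  · intro n
    -- near the sphere, `rayFourier c (t • z)` is the partial Fourier transform of a Schwartz
    -- function, precomposed with `z ↦ (z, t ‖z‖)`; each derivative costs a factor `1 + t`, which
    -- the rapid decrease in the last variable absorbs
    have hιb : ∃ D : ℝ, 1 ≤ D ∧ ∀ i ≤ n, ∀ η : Space d, ‖η‖ = 1 →
        ‖iteratedFDerivWithin ℝ i (fun z : Space d => (z, ‖z‖)) {0}ᶜ η‖ ≤ D := by
      have h1 : ∀ i : ℕ, ∃ C : ℝ, ∀ η ∈ Metric.sphere (0 : Space d) 1,
          ‖iteratedFDerivWithin ℝ i (fun z : Space d => (z, ‖z‖)) {0}ᶜ η‖ ≤ C := by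
        intro i
        refine (isCompact_sphere (0 : Space d) 1).exists_bound_of_continuousOn
          ((hι.continuousOn_iteratedFDerivWithin (m := i) (by exact_mod_cast le_top)
            ho.uniqueDiffOn).mono fun z hz h0 => ?_)
        rw [mem_singleton_iff.1 h0] at hz
        simp at hz
      choose C hC using h1
      refine ⟨1 + ∑ i ∈ Finset.range (n + 1), |C i|, ?_, fun i hi η hη => ?_⟩
      · have := Finset.sum_nonneg fun i (_ : i ∈ Finset.range (n + 1)) => abs_nonneg (C i)
        linarith
      · have h2 := Finset.single_le_sum (f := fun i => |C i|) (fun _ _ => abs_nonneg _)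
          (Finset.mem_range.2 (by omega : i < n + 1))
        have h3 := hC i η (by simpa using hη)
        have h4 := le_abs_self (C i)
        linarith
    obtain ⟨D, hD1, hD⟩ := hιb
    choose C hC0 hC using fun i => exists_norm_iteratedFDeriv_partialFourier_le Φ i (K + i)
    have hS : ∀ i ≤ n, C i ≤ ∑ i ∈ Finset.range (n + 1), C i := fun i hi =>
      Finset.single_le_sum (fun i _ => hC0 i) (Finset.mem_range.2 (by omega))
    set S := ∑ i ∈ Finset.range (n + 1), C i with hSdef
    refine ⟨n.factorial * S * D ^ n, fun t ht η hη => ?_⟩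
    have hη0 : η ∈ ({0}ᶜ : Set (Space d)) := by
      intro h; rw [mem_singleton_iff.1 h, norm_zero] at hη; exact zero_ne_one hη
    rw [((hloc t ht η hη).iteratedFDeriv ℝ n).eq_of_nhds]
    have hTn : ‖T t‖ ≤ 1 + t := by
      refine ContinuousLinearMap.opNorm_le_bound _ (by positivity) fun p => ?_
      change ‖(p.1, t • p.2)‖ ≤ _
      rw [Prod.norm_mk, norm_smul, Real.norm_of_nonneg ht.le]
      refine max_le ?_ ?_
      · nlinarith [norm_fst_le p, norm_nonneg p]
      · nlinarith [norm_snd_le p, norm_nonneg p]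
    have hb : ∀ i ≤ n, ‖iteratedFDerivWithin ℝ i (partialFourier Φ ∘ T t) univ (η, ‖η‖)‖
        ≤ S / (1 + t) ^ K := by
      intro i hi
      rw [iteratedFDerivWithin_univ, (T t).iteratedFDeriv_comp_right hA _
        (by exact_mod_cast le_top), le_div_iff₀ (by positivity)]
      have h1 := ContinuousMultilinearMap.norm_compContinuousLinearMap_le
        (iteratedFDeriv ℝ i (partialFourier Φ) (T t (η, ‖η‖))) (fun _ => T t)
      rw [Finset.prod_const, Finset.card_univ, Fintype.card_fin] at h1
      have h2 := hC i (T t (η, ‖η‖))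
      have h3 : (T t (η, ‖η‖)).2 = t := by
        change t * ‖η‖ = t
        rw [hη, mul_one]
      rw [h3, Real.norm_of_nonneg ht.le] at h2
      calc _ ≤ (‖iteratedFDeriv ℝ i (partialFourier Φ) (T t (η, ‖η‖))‖ * (1 + t) ^ i)
            * (1 + t) ^ K := by gcongr; exact h1.trans (by gcongr)
        _ = ‖iteratedFDeriv ℝ i (partialFourier Φ) (T t (η, ‖η‖))‖ * (1 + t) ^ (K + i) := by
          rw [pow_add]; ring
        _ ≤ _ := h2.trans (hS i hi)
    have h := norm_iteratedFDerivWithin_comp_le (n := n) (hTs t).contDiffOn hι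
      (by exact_mod_cast le_top) uniqueDiffOn_univ ho.uniqueDiffOn (mapsTo_univ _ _) hη0 hb
      (D := D) (fun i hi1 hi => (hD i hi η hη).trans (le_self_pow₀ hD1 (by omega)))
    rw [iteratedFDerivWithin_of_isOpen n ho hη0] at h
    rw [pow_zero, mul_one, ← le_div_iff₀ (by positivity)]
    refine h.trans (le_of_eq ?_)
    ring

end RayFourier

/-! ### Plane-wave representation of the absolute value -/

section AbsoluteValue

/-- The triangle function `(1 - |s|)₊`. -/
noncomputable def triangle (s : ℝ) : ℂ := ((max (1 - |s|) 0 : ℝ) : ℂ)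

theorem continuous_triangle : Continuous triangle := by unfold triangle; fun_prop

theorem triangle_eq_zero {s : ℝ} (hs : s ∉ Ioc (-1 : ℝ) 1) : triangle s = 0 := by
  have : 1 ≤ |s| := by
    by_contra h
    have := abs_lt.1 (not_le.1 h)
    exact hs ⟨this.1, this.2.le⟩
  simp [triangle, this]

theorem integrable_triangle : Integrable triangle := by
  refine continuous_triangle.integrable_of_hasCompactSupport
    (HasCompactSupport.of_support_subset_isCompact (isCompact_Icc (a := (-1 : ℝ)) (b := 1))
      fun s hs => ?_)
  by_contra h
  exact hs (triangle_eq_zero fun h' => h (Ioc_subset_Icc_self h'))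

theorem fourier_triangle {w : ℝ} (hw : w ≠ 0) :
    𝓕 triangle w = ((1 - Real.cos (2 * Real.pi * w)) / (2 * Real.pi ^ 2 * w ^ 2) : ℝ) := by
  set c : ℂ := -(2 * Real.pi * w * Complex.I) with hc
  have hc0 : c ≠ 0 := by
    simp [hc, hw, Real.pi_ne_zero]
  have h1 : 𝓕 triangle w = ∫ s in (-1 : ℝ)..1, Complex.exp (c * s) * triangle s := by
    rw [Real.fourier_real_eq_integral_exp_smul, intervalIntegral.integral_of_le (by norm_num),
      ← integral_indicator measurableSet_Ioc]
    refine integral_congr_ae (Filter.Eventually.of_forall fun s => ?_)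
    by_cases hs : s ∈ Ioc (-1 : ℝ) 1
    · simp only [indicator_of_mem hs, smul_eq_mul]
      congr 2; rw [hc]; push_cast; ring
    · simp only [indicator_of_notMem hs, triangle_eq_zero hs, smul_zero]
  have hcont : Continuous fun s : ℝ => Complex.exp (c * s) * triangle s := by
    have := continuous_triangle; fun_prop
  have hexp : ∀ s : ℝ, HasDerivAt (fun s : ℝ => Complex.exp (c * s)) (Complex.exp (c * s) * c) s := by
    intro s
    have := ((Complex.ofRealCLM.hasDerivAt (x := s)).const_mul c).cexp
    simpa using this
  have hid : ∀ s : ℝ, HasDerivAt (fun s : ℝ => (s : ℂ)) 1 s := fun s => by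
    simpa using (hasDerivAt_id s).ofReal_comp
  have h2 : ∫ s in (0 : ℝ)..1, Complex.exp (c * s) * triangle s
      = Complex.exp c / c ^ 2 - 1 / c - 1 / c ^ 2 := by
    have hF : ∀ s ∈ uIcc (0 : ℝ) 1, HasDerivAt
        (fun s : ℝ => (1 - (s : ℂ)) * Complex.exp (c * s) / c + Complex.exp (c * s) / c ^ 2)
        (Complex.exp (c * s) * triangle s) s := by
      intro s hs
      rw [uIcc_of_le zero_le_one] at hs
      have ht : triangle s = 1 - (s : ℂ) := by
        rw [triangle, abs_of_nonneg hs.1, max_eq_left (by linarith [hs.2])]; push_cast; ring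
      rw [ht]
      refine ((((hid s).const_sub 1).mul (hexp s)).div_const c |>.add
        ((hexp s).div_const (c ^ 2))).congr_deriv ?_
      field_simp; ring
    rw [intervalIntegral.integral_eq_sub_of_hasDerivAt hF (hcont.intervalIntegrable _ _)]
    simp
    ring
  have h3 : ∫ s in (-1 : ℝ)..0, Complex.exp (c * s) * triangle s
      = 1 / c - 1 / c ^ 2 + Complex.exp (-c) / c ^ 2 := by
    have hF : ∀ s ∈ uIcc (-1 : ℝ) 0, HasDerivAt
        (fun s : ℝ => (1 + (s : ℂ)) * Complex.exp (c * s) / c - Complex.exp (c * s) / c ^ 2)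
        (Complex.exp (c * s) * triangle s) s := by
      intro s hs
      rw [uIcc_of_le (by norm_num)] at hs
      have ht : triangle s = 1 + (s : ℂ) := by
        rw [triangle, abs_of_nonpos hs.2, max_eq_left (by linarith [hs.1])]; push_cast; ring
      rw [ht]
      refine ((((hid s).const_add 1).mul (hexp s)).div_const c |>.sub
        ((hexp s).div_const (c ^ 2))).congr_deriv ?_
      field_simp; ring
    rw [intervalIntegral.integral_eq_sub_of_hasDerivAt hF (hcont.intervalIntegrable _ _)]
    simp
  rw [h1, ← intervalIntegral.integral_add_adjacent_intervals (hcont.intervalIntegrable (-1) 0)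
    (hcont.intervalIntegrable 0 1), h2, h3]
  have hcos : (Complex.cos (2 * Real.pi * w)) = (Complex.exp c + Complex.exp (-c)) / 2 := by
    rw [Complex.cos, hc, neg_neg, add_comm]; congr 2; ring_nf
  push_cast
  rw [hcos]
  have hc2 : c ^ 2 = -(4 * Real.pi ^ 2 * w ^ 2) := by
    rw [hc, neg_sq, mul_pow, mul_pow, mul_pow, Complex.I_sq]; ring
  have hw' : (w : ℂ) ≠ 0 := by exact_mod_cast hw
  have hpi : (Real.pi : ℂ) ≠ 0 := by exact_mod_cast Real.pi_ne_zero
  rw [hc2]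
  field_simp
  ring

theorem integrable_fourier_triangle : Integrable (𝓕 triangle) := by
  have hc : Continuous (𝓕 triangle) := VectorFourier.fourierIntegral_continuous
    Real.continuous_fourierChar (by exact continuous_inner) integrable_triangle
  have hb : ∀ w, ‖𝓕 triangle w‖ ≤ ∫ s, ‖triangle s‖ := fun w =>
    VectorFourier.norm_fourierIntegral_le_integral_norm _ _ _ _ _
  refine (integrable_inv_one_add_sq.const_mul ((∫ s, ‖triangle s‖) + 1)).mono'
    hc.aestronglyMeasurable (Filter.Eventually.of_forall fun w => ?_)
  rw [← div_eq_mul_inv, le_div_iff₀ (by positivity), mul_add, mul_one]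
  refine add_le_add (hb w) ?_
  rcases eq_or_ne w 0 with rfl | hw
  · simp
  rw [fourier_triangle hw, Complex.norm_real, Real.norm_of_nonneg
    (div_nonneg (by linarith [Real.cos_le_one (2 * Real.pi * w)]) (by positivity)),
    div_mul_eq_mul_div, div_le_one (by positivity)]
  gcongr
  nlinarith [Real.neg_one_le_cos (2 * Real.pi * w), Real.pi_gt_three]

/-- Fourier inversion for the triangle function at the origin. -/
theorem integrable_one_sub_cos_div_sq :
    Integrable (fun τ : ℝ => (1 - Real.cos (2 * Real.pi * τ)) / τ ^ 2) ∧
      ∫ τ : ℝ, (1 - Real.cos (2 * Real.pi * τ)) / τ ^ 2 = 2 * Real.pi ^ 2 := by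
  have hae : ∀ᵐ w : ℝ, ((2 * Real.pi ^ 2 : ℝ) : ℂ) * 𝓕 triangle w
      = (((1 - Real.cos (2 * Real.pi * w)) / w ^ 2 : ℝ) : ℂ) := by
    have : ∀ᵐ w : ℝ, w ≠ 0 := Measure.ae_ne volume 0
    filter_upwards [this] with w hw
    rw [fourier_triangle hw, ← Complex.ofReal_mul]
    congr 1
    field_simp
  have hi := (integrable_fourier_triangle.const_mul ((2 * Real.pi ^ 2 : ℝ) : ℂ)).congr hae
  have hinv := integrable_triangle.fourierInv_fourier_eq integrable_fourier_triangle
    (v := 0) continuous_triangle.continuousAt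
  have h0 : ∫ w, 𝓕 triangle w = 1 := by
    rw [Real.fourierInv_eq'] at hinv
    simpa [triangle] using hinv
  refine ⟨?_, ?_⟩
  · exact hi.re.congr (Filter.Eventually.of_forall fun x => Complex.ofReal_re _)
  · have h2 := integral_congr_ae hae
    rw [integral_const_mul, h0, mul_one, integral_complex_ofReal] at h2
    exact (Complex.ofReal_injective h2).symm

/-- The plane-wave representation of the absolute value. -/
theorem integral_one_sub_cos_mul_div_sq (s : ℝ) :
    Integrable (fun τ : ℝ => (1 - Real.cos (2 * Real.pi * τ * s)) / τ ^ 2) ∧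
      ∫ τ : ℝ, (1 - Real.cos (2 * Real.pi * τ * s)) / τ ^ 2 = 2 * Real.pi ^ 2 * |s| := by
  rcases eq_or_ne s 0 with rfl | hs
  · simp
  obtain ⟨h1, h2⟩ := integrable_one_sub_cos_div_sq
  have he : (fun τ : ℝ => (1 - Real.cos (2 * Real.pi * τ * s)) / τ ^ 2)
      = fun τ => s ^ 2 * ((fun τ : ℝ => (1 - Real.cos (2 * Real.pi * τ)) / τ ^ 2) (s * τ)) := by
    funext τ
    rcases eq_or_ne τ 0 with rfl | hτ
    · simp
    · simp only
      rw [show 2 * Real.pi * τ * s = 2 * Real.pi * (s * τ) by ring]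
      field_simp
  rw [he]
  refine ⟨(h1.comp_mul_left' hs).const_mul _, ?_⟩
  have h3 := Measure.integral_comp_mul_left
    (fun τ : ℝ => (1 - Real.cos (2 * Real.pi * τ)) / τ ^ 2) s
  rw [integral_const_mul, h3, h2, smul_eq_mul, abs_inv, ← sq_abs s]
  have : |s| ≠ 0 := abs_ne_zero.2 hs
  field_simp

end AbsoluteValue

/-! ### Fractional Laplacian of a Schwartz function -/

section FracLaplacian

theorem isSymbol_norm_pow {E : Type*} [NormedAddCommGroup E] [InnerProductSpace ℝ E]
    [FiniteDimensional ℝ E] (p : ℕ) :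
    IsSymbol p 0 (fun ξ : E => (((2 * Real.pi * ‖ξ‖) ^ p : ℝ) : ℂ)) := by
  have ho : IsOpen ({0}ᶜ : Set E) := isOpen_compl_singleton
  have hs : ContDiffOn ℝ ∞ (fun ξ : E => (((2 * Real.pi * ‖ξ‖) ^ p : ℝ) : ℂ)) {0}ᶜ := fun z hz =>
    (Complex.ofRealCLM.contDiff.contDiffAt.comp z
      ((contDiffAt_const.mul (contDiffAt_norm ℝ hz)).pow p)).contDiffWithinAt
  refine IsSymbol.of_sphere hs fun n => ?_
  obtain ⟨C, hC⟩ := (isCompact_sphere (0 : E) 1).exists_bound_of_continuousOn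
    ((hs.continuousOn_iteratedFDerivWithin (m := n) (by exact_mod_cast le_top)
      ho.uniqueDiffOn).mono fun z hz h0 => by
        rw [mem_singleton_iff.1 h0] at hz
        simp at hz)
  refine ⟨C, fun t ht η hη => ?_⟩
  have hη0 : η ∈ ({0}ᶜ : Set E) := by
    intro h; rw [mem_singleton_iff.1 h, norm_zero] at hη; exact zero_ne_one hη
  have he : (fun z : E => (((2 * Real.pi * ‖t • z‖) ^ p : ℝ) : ℂ))
      = fun z => (t ^ p) • (((2 * Real.pi * ‖z‖) ^ p : ℝ) : ℂ) := by
    funext z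
    rw [norm_smul, Real.norm_of_nonneg ht.le, Complex.real_smul, ← Complex.ofReal_mul]
    congr 1; ring
  have h1 := iteratedFDeriv_const_smul_apply (a := t ^ p)
    (((hs.contDiffAt (ho.mem_nhds hη0))).of_le (m := n) (by exact_mod_cast le_top))
  have h2 : (t ^ p) • (fun ξ : E => (((2 * Real.pi * ‖ξ‖) ^ p : ℝ) : ℂ))
      = fun z => (t ^ p) • (((2 * Real.pi * ‖z‖) ^ p : ℝ) : ℂ) := rfl
  rw [h2] at h1
  rw [he, h1, pow_zero, mul_one, norm_smul, Real.norm_of_nonneg (by positivity), mul_comm]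
  have h3 := hC η (by simpa using hη)
  rw [iteratedFDerivWithin_of_isOpen n ho hη0] at h3
  gcongr

theorem isSymbol_schwartz {E : Type*} [NormedAddCommGroup E] [NormedSpace ℝ E]
    (ψ : 𝓢(E, ℂ)) (K : ℕ) : IsSymbol 0 K ψ := by
  refine ⟨(ψ.smooth ⊤).contDiffOn, fun n => ?_⟩
  refine ⟨2 ^ (n + K) * ((Finset.Iic (n + K, n)).sup fun m => SchwartzMap.seminorm ℝ m.1 m.2) ψ,
    fun ξ _ => ?_⟩
  have h := ψ.one_add_le_sup_seminorm_apply (𝕜 := ℝ) (m := (n + K, n)) le_rfl le_rfl ξ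
  rw [pow_zero, mul_one]
  refine le_trans ?_ h
  rw [pow_add]
  have h1 : ‖ξ‖ ^ n ≤ (1 + ‖ξ‖) ^ n := by gcongr; linarith
  calc _ ≤ (1 + ‖ξ‖) ^ n * ‖iteratedFDeriv ℝ n ψ ξ‖ * (1 + ‖ξ‖) ^ K := by gcongr
    _ = _ := by ring

variable {d : ℕ}

/-- The multiplier `(2π‖ξ‖)^{d+1} 𝓕ψ(ξ)` defining `(-Δ)^{(d+1)/2} ψ`. -/
noncomputable def fracSymbol (ψ : 𝓢(Space d, ℂ)) (ξ : Space d) : ℂ :=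
  (((2 * Real.pi * ‖ξ‖) ^ (d + 1) : ℝ) : ℂ) * 𝓕 (ψ : Space d → ℂ) ξ

theorem fracLaplacian_eq (ψ : 𝓢(Space d, ℂ)) :
    fracLaplacian (((d : ℝ) + 1) / 2) ψ = 𝓕⁻ (fracSymbol ψ) := by
  unfold fracLaplacian
  congr 1
  funext ξ
  have : 2 * (((d : ℝ) + 1) / 2) = ((d + 1 : ℕ) : ℝ) := by push_cast; ring
  rw [this, Real.rpow_natCast]
  rfl

theorem continuous_fracSymbol (ψ : 𝓢(Space d, ℂ)) : Continuous (fracSymbol ψ) := by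
  have : Continuous (𝓕 (ψ : Space d → ℂ)) := by
    rw [← SchwartzMap.fourier_coe]; exact (𝓕 ψ).continuous
  unfold fracSymbol
  fun_prop

theorem isSymbol_fracSymbol (ψ : 𝓢(Space d, ℂ)) (K : ℕ) : IsSymbol (d + 1) K (fracSymbol ψ) := by
  have := (isSymbol_norm_pow (E := Space d) (d + 1)).mul (isSymbol_schwartz (𝓕 ψ) K)
  rw [zero_add, add_zero] at this
  exact this

theorem integrable_fracSymbol [NeZero d] (ψ : 𝓢(Space d, ℂ)) : Integrable (fracSymbol ψ) :=
  (isSymbol_fracSymbol ψ _).integrable le_rfl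

theorem continuous_fourierInv {E : Type*} [NormedAddCommGroup E] [InnerProductSpace ℝ E]
    [FiniteDimensional ℝ E] [MeasurableSpace E] [BorelSpace E] {m : E → ℂ} (hm : Integrable m) :
    Continuous (𝓕⁻ m) := by
  have h : Continuous (𝓕 m) := VectorFourier.fourierIntegral_continuous
    Real.continuous_fourierChar (by exact continuous_inner) hm
  have : 𝓕⁻ m = fun x => 𝓕 m (-x) := funext fun x => Real.fourierInv_eq_fourier_neg m x
  rw [this]
  exact h.comp continuous_neg

theorem continuous_fracLaplacian [NeZero d] (ψ : 𝓢(Space d, ℂ)) :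
    Continuous (fracLaplacian (((d : ℝ) + 1) / 2) ψ) := by
  rw [fracLaplacian_eq]
  exact continuous_fourierInv (integrable_fracSymbol ψ)

/-- `(-Δ)^{(d+1)/2} ψ` decays fast enough to be integrated against functions of linear growth. -/
theorem exists_norm_fracLaplacian_le [NeZero d] (ψ : 𝓢(Space d, ℂ)) :
    ∃ C : ℝ, 0 ≤ C ∧ ∀ x, ‖fracLaplacian (((d : ℝ) + 1) / 2) ψ x‖
      ≤ C * ((1 + ‖x‖) ^ (2 * d + 1))⁻¹ := by
  obtain ⟨C, hC0, hC⟩ := (isSymbol_fracSymbol ψ _).exists_norm_fourier_le le_rfl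
  refine ⟨C, hC0, fun x => ?_⟩
  rw [fracLaplacian_eq, Real.fourierInv_eq_fourier_neg]
  refine (hC (-x)).trans (le_of_eq ?_)
  rw [norm_neg, finrank_euclideanSpace_fin]
  congr 3; ring

theorem integrable_one_add_norm_mul_fracLaplacian [NeZero d] (ψ : 𝓢(Space d, ℂ)) :
    Integrable (fun x => (1 + ‖x‖) * ‖fracLaplacian (((d : ℝ) + 1) / 2) ψ x‖) := by
  obtain ⟨C, hC0, hC⟩ := exists_norm_fracLaplacian_le ψ
  have hd : 1 ≤ d := Nat.one_le_iff_ne_zero.2 (NeZero.ne d)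
  have hI := inv_one_add_norm_pow_integrable (Space d) (r := 2 * d)
    (by rw [finrank_euclideanSpace_fin]; omega)
  have hcont := (continuous_fracLaplacian ψ).norm
  refine (hI.const_mul C).mono' (by fun_prop) (Filter.Eventually.of_forall fun x => ?_)
  rw [Real.norm_of_nonneg (by positivity)]
  calc _ ≤ (1 + ‖x‖) * (C * ((1 + ‖x‖) ^ (2 * d + 1))⁻¹) := by gcongr; exact hC x
    _ = _ := by
      rw [pow_succ]
      have : (1 + ‖x‖) ≠ 0 := by positivity
      field_simp

theorem integrable_mul_fracLaplacian [NeZero d] (ψ : 𝓢(Space d, ℂ)) {g : Space d → ℂ}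
    (hg : AEStronglyMeasurable g) {C : ℝ} (hC : ∀ x, ‖g x‖ ≤ C * (1 + ‖x‖)) :
    Integrable (fun x => g x * fracLaplacian (((d : ℝ) + 1) / 2) ψ x) := by
  refine ((integrable_one_add_norm_mul_fracLaplacian ψ).const_mul C).mono'
    (hg.mul (continuous_fracLaplacian ψ).aestronglyMeasurable)
    (Filter.Eventually.of_forall fun x => ?_)
  rw [norm_mul, ← mul_assoc]
  gcongr
  exact hC x

theorem integrable_fracLaplacian [NeZero d] (ψ : 𝓢(Space d, ℂ)) :
    Integrable (fracLaplacian (((d : ℝ) + 1) / 2) ψ) := by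
  have := integrable_mul_fracLaplacian ψ (g := fun _ => 1) (C := 1) (by fun_prop)
    (fun x => by simp)
  simpa using this

theorem fourier_fracLaplacian [NeZero d] (ψ : 𝓢(Space d, ℂ)) :
    𝓕 (fracLaplacian (((d : ℝ) + 1) / 2) ψ) = fracSymbol ψ := by
  have h := integrable_fracLaplacian ψ
  rw [fracLaplacian_eq] at h ⊢
  have h' : Integrable (𝓕 (fracSymbol ψ)) := by
    refine h.comp_neg.congr (Filter.Eventually.of_forall fun x => ?_)
    simp only [Real.fourierInv_eq_fourier_neg, neg_neg]
  exact (continuous_fracSymbol ψ).fourier_fourierInv_eq (integrable_fracSymbol ψ) h'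

theorem integral_fracLaplacian [NeZero d] (ψ : 𝓢(Space d, ℂ)) :
    ∫ x, fracLaplacian (((d : ℝ) + 1) / 2) ψ x = 0 := by
  have h := congrFun (fourier_fracLaplacian ψ) 0
  rw [Real.fourier_eq'] at h
  simpa [fracSymbol] using h

/-- `(-Δ)^{(d+1)/2} ψ` is orthogonal to linear functions, because its Fourier transform vanishes
to order `d + 1 ≥ 2` at the origin. -/
theorem integral_inner_mul_fracLaplacian [NeZero d] (ψ : 𝓢(Space d, ℂ)) (v : Space d) :
    ∫ x, (⟪v, x⟫ : ℂ) * fracLaplacian (((d : ℝ) + 1) / 2) ψ x = 0 := by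
  have hd : 1 ≤ d := Nat.one_le_iff_ne_zero.2 (NeZero.ne d)
  set Ψ := fracLaplacian (((d : ℝ) + 1) / 2) ψ with hΨ
  have hi := integrable_fracLaplacian ψ
  have hi1 : Integrable (fun x => ‖x‖ * ‖Ψ x‖) := by
    refine (integrable_one_add_norm_mul_fracLaplacian ψ).mono'
      (continuous_norm.mul (continuous_fracLaplacian ψ).norm).aestronglyMeasurable
      (Filter.Eventually.of_forall fun x => ?_)
    rw [Real.norm_of_nonneg (by positivity)]
    gcongr
    linarith
  have h1 := Real.hasFDerivAt_fourier hi hi1 0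
  rw [fourier_fracLaplacian] at h1
  have h2 : HasFDerivAt (fracSymbol ψ) (0 : Space d →L[ℝ] ℂ) 0 := by
    obtain ⟨C, hC0, hC⟩ := (isSymbol_fracSymbol ψ 0).exists_bound 0
    refine Asymptotics.IsBigO.hasFDerivAt (n := d + 1) ?_ (by omega)
    refine Asymptotics.IsBigO.of_bound C (Filter.Eventually.of_forall fun ξ => ?_)
    rw [sub_zero, norm_pow, norm_norm]
    rcases eq_or_ne ξ 0 with rfl | hξ
    · simp [fracSymbol]
    · simpa using hC 0 le_rfl ξ hξ
  have h3 := h1.unique h2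
  rw [Real.fourier_eq'] at h3
  simp only [inner_zero_right, mul_zero, Complex.ofReal_zero, zero_mul, Complex.exp_zero,
    one_smul] at h3
  have hint : Integrable (VectorFourier.fourierSMulRight (innerSL ℝ) Ψ) := by
    refine (hi1.const_mul (2 * Real.pi * ‖(innerSL ℝ : Space d →L[ℝ] Space d →L[ℝ] ℝ)‖)).mono'
      hi.aestronglyMeasurable.fourierSMulRight (Filter.Eventually.of_forall fun x => ?_)
    exact (VectorFourier.norm_fourierSMulRight_le _ _ _).trans (le_of_eq (by ring))
  have h4 := congrArg (fun L : Space d →L[ℝ] ℂ => L v) h3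
  simp only [zero_apply] at h4
  rw [← hΨ, ContinuousLinearMap.integral_apply hint] at h4
  simp only [VectorFourier.fourierSMulRight_apply] at h4
  rw [integral_smul, smul_eq_zero] at h4
  rcases h4 with h4 | h4
  · simp [Real.pi_ne_zero] at h4
  · rw [← h4]
    refine integral_congr_ae (Filter.Eventually.of_forall fun x => ?_)
    change ((⟪v, x⟫ : ℝ) : ℂ) * Ψ x = (⟪x, v⟫ : ℝ) • Ψ x
    rw [real_inner_comm, Complex.real_smul]

end FracLaplacian

/-! ### Ridge functions tested against the fractional Laplacian -/

section Relu

variable {d : ℕ}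

/-- The one-dimensional spectrum `(2π|τ|)^{d-1} 𝓕ψ(τa)` on the line spanned by `a`. It is the
multiplier of `(-Δ)^{(d+1)/2} ψ` divided by `(2πτ)²`, the factor that the second derivative of the
ReLU accounts for. -/
noncomputable def lineSpectrum (ψ : 𝓢(Space d, ℂ)) (q : Weight d) : ℂ :=
  (((2 * Real.pi * |q.2|) ^ (d - 1) : ℝ) : ℂ) * 𝓕 (ψ : Space d → ℂ) (q.2 • (q.1 : Space d))

theorem continuous_fourier_schwartz (ψ : 𝓢(Space d, ℂ)) : Continuous (𝓕 (ψ : Space d → ℂ)) := by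
  rw [← SchwartzMap.fourier_coe]; exact (𝓕 ψ).continuous

theorem continuous_lineSpectrum (ψ : 𝓢(Space d, ℂ)) : Continuous (lineSpectrum ψ) := by
  have := continuous_fourier_schwartz ψ
  unfold lineSpectrum
  fun_prop

theorem exists_norm_lineSpectrum_le (ψ : 𝓢(Space d, ℂ)) :
    ∃ C : ℝ, 0 ≤ C ∧ ∀ q, ‖lineSpectrum ψ q‖ ≤ C * ((1 + ‖q.2‖) ^ 2)⁻¹ := by
  obtain ⟨C, hC0, hC⟩ := SchwartzMap.exists_one_add_pow_mul_norm_le (𝓕 ψ) (d - 1 + 2)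
  refine ⟨(2 * Real.pi) ^ (d - 1) * C, by positivity, fun q => ?_⟩
  have h := hC (q.2 • (q.1 : Space d))
  have hn : ‖q.2 • (q.1 : Space d)‖ = ‖q.2‖ := by rw [norm_smul]; simp
  rw [hn] at h
  have h1 : ‖(((2 * Real.pi * |q.2|) ^ (d - 1) : ℝ) : ℂ)‖
      ≤ (2 * Real.pi) ^ (d - 1) * (1 + ‖q.2‖) ^ (d - 1) := by
    rw [Complex.norm_real, Real.norm_of_nonneg (by positivity), ← mul_pow, ← Real.norm_eq_abs]
    gcongr; linarith
  unfold lineSpectrum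
  rw [norm_mul]
  calc _ ≤ (2 * Real.pi) ^ (d - 1) * (1 + ‖q.2‖) ^ (d - 1)
        * (C * ((1 + ‖q.2‖) ^ (d - 1 + 2))⁻¹) := by gcongr; exact h
    _ = _ := by
      rw [pow_add]
      have : (1 + ‖q.2‖) ≠ 0 := by positivity
      field_simp

theorem fracSymbol_smul [NeZero d] (ψ : 𝓢(Space d, ℂ)) (a : Metric.sphere (0 : Space d) 1)
    (τ : ℝ) : fracSymbol ψ (τ • (a : Space d))
      = ((4 * Real.pi ^ 2 * τ ^ 2 : ℝ) : ℂ) * lineSpectrum ψ (a, τ) := by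
  have hd : d + 1 = d - 1 + 2 := by have := NeZero.ne d; omega
  have hn : ‖τ • (a : Space d)‖ = |τ| := by rw [norm_smul]; simp
  simp only [fracSymbol, lineSpectrum, hn]
  rw [← mul_assoc, ← Complex.ofReal_mul]
  congr 2
  rw [hd, pow_add, mul_pow (2 * Real.pi) |τ| 2, sq_abs]
  ring

theorem continuous_relu : Continuous fun q : Weight d × Space d => relu q.1 q.2 := by
  unfold relu; fun_prop

theorem abs_inner_sphere_le (a : Metric.sphere (0 : Space d) 1) (x : Space d) :
    |⟪(a : Space d), x⟫| ≤ ‖x‖ := by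
  have := abs_real_inner_le_norm (a : Space d) x
  simpa using this

theorem abs_relu_le (p : Weight d) (x : Space d) : |relu p x| ≤ (1 + |p.2|) * (1 + ‖x‖) := by
  have h1 := abs_inner_sphere_le p.1 x
  have h2 : |relu p x| ≤ |⟪(p.1 : Space d), x⟫ - p.2| := by
    unfold relu
    rw [abs_of_nonneg (le_max_right _ _)]
    exact max_le (le_abs_self _) (abs_nonneg _)
  have h3 := abs_sub (⟪(p.1 : Space d), x⟫) p.2
  nlinarith [abs_nonneg p.2, norm_nonneg x]

theorem integral_exp_inner_mul_fracLaplacian [NeZero d] (ψ : 𝓢(Space d, ℂ)) (ξ : Space d) :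
    ∫ x, Complex.exp (((-2 * Real.pi * ⟪x, ξ⟫ : ℝ) : ℂ) * Complex.I)
      * fracLaplacian (((d : ℝ) + 1) / 2) ψ x = fracSymbol ψ ξ := by
  have h := congrFun (fourier_fracLaplacian ψ) ξ
  rw [Real.fourier_eq'] at h
  exact h

theorem integrable_exp_phase_mul_lineSpectrum (ψ : 𝓢(Space d, ℂ)) (p : Weight d) :
    Integrable fun τ : ℝ =>
      Complex.exp (2 * Real.pi * τ * p.2 * Complex.I) * lineSpectrum ψ (p.1, τ) := by
  obtain ⟨C, hC0, hC⟩ := exists_norm_lineSpectrum_le ψ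
  have hc := continuous_lineSpectrum ψ
  refine (integrable_inv_one_add_norm_sq.const_mul C).mono'
    (Continuous.aestronglyMeasurable (by fun_prop)) (Filter.Eventually.of_forall fun τ => ?_)
  rw [norm_mul, norm_exp_phase, one_mul]
  exact hC (p.1, τ)

/-- The inner integral in the plane-wave decomposition of
`∫ |⟪a, x⟫ - b| (-Δ)^{(d+1)/2} ψ(x) dx`. -/
theorem integral_cos_mul_fracLaplacian [NeZero d] (ψ : 𝓢(Space d, ℂ)) (p : Weight d) {τ : ℝ}
    (hτ : τ ≠ 0) :
    ∫ x, (((1 - Real.cos (2 * Real.pi * τ * (⟪(p.1 : Space d), x⟫ - p.2))) / τ ^ 2 : ℝ) : ℂ)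
        * fracLaplacian (((d : ℝ) + 1) / 2) ψ x
      = -(2 * Real.pi ^ 2 : ℝ) * (Complex.exp (2 * Real.pi * τ * p.2 * Complex.I)
          * lineSpectrum ψ (p.1, τ)
        + Complex.exp (2 * Real.pi * (-τ : ℝ) * p.2 * Complex.I) * lineSpectrum ψ (p.1, -τ)) := by
  set Ψ := fracLaplacian (((d : ℝ) + 1) / 2) ψ with hΨ
  have hi : Integrable Ψ := integrable_fracLaplacian ψ
  have hcx : ∀ x, (((1 - Real.cos (2 * Real.pi * τ * (⟪(p.1 : Space d), x⟫ - p.2))) / τ ^ 2 : ℝ) : ℂ)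
      * Ψ x = ((1 / τ ^ 2 : ℝ) : ℂ) * Ψ x - (((1 / (2 * τ ^ 2) : ℝ) : ℂ) *
        Complex.exp (2 * Real.pi * τ * p.2 * Complex.I)) *
          (Complex.exp (((-2 * Real.pi * ⟪x, τ • (p.1 : Space d)⟫ : ℝ) : ℂ) * Complex.I) * Ψ x)
        - (((1 / (2 * τ ^ 2) : ℝ) : ℂ) *
        Complex.exp (2 * Real.pi * (-τ : ℝ) * p.2 * Complex.I)) *
          (Complex.exp (((-2 * Real.pi * ⟪x, (-τ) • (p.1 : Space d)⟫ : ℝ) : ℂ) * Complex.I) * Ψ x) := by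
    intro x
    rw [real_inner_smul_right, real_inner_smul_right, real_inner_comm (p.1 : Space d) x]
    set s := ⟪(p.1 : Space d), x⟫
    have hcos : ((Real.cos (2 * Real.pi * τ * (s - p.2)) : ℝ) : ℂ)
        = (Complex.exp (2 * Real.pi * τ * p.2 * Complex.I)
            * Complex.exp (((-2 * Real.pi * (τ * s) : ℝ) : ℂ) * Complex.I)
          + Complex.exp (2 * Real.pi * (-τ : ℝ) * p.2 * Complex.I)
            * Complex.exp (((-2 * Real.pi * (-τ * s) : ℝ) : ℂ) * Complex.I)) / 2 := by
      rw [← Complex.exp_add, ← Complex.exp_add, Complex.ofReal_cos, Complex.cos, add_comm]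
      congr 2 <;> · congr 1; push_cast; ring
    have hτ' : (τ : ℂ) ≠ 0 := by exact_mod_cast hτ
    rw [Complex.ofReal_div, Complex.ofReal_sub, hcos]
    push_cast
    field_simp
    ring
  have hie : ∀ ξ : Space d, Integrable fun x =>
      Complex.exp (((-2 * Real.pi * ⟪x, ξ⟫ : ℝ) : ℂ) * Complex.I) * Ψ x := by
    intro ξ
    refine integrable_mul_fracLaplacian ψ (C := 1)
      (Continuous.aestronglyMeasurable (by fun_prop)) fun x => ?_
    rw [Complex.norm_exp_ofReal_mul_I]; linarith [norm_nonneg x]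
  have hlin : ∀ (u v w : ℂ) (f g h : Space d → ℂ), Integrable f → Integrable g → Integrable h →
      ∫ x, (u * f x - v * g x - w * h x) = u * (∫ x, f x) - v * (∫ x, g x) - w * ∫ x, h x := by
    intro u v w f g h hf hg hh
    have h1 : Integrable fun x => u * f x - v * g x := (hf.const_mul u).sub (hg.const_mul v)
    rw [integral_sub h1 (hh.const_mul w), integral_sub (hf.const_mul u) (hg.const_mul v),
      integral_const_mul, integral_const_mul, integral_const_mul]
  rw [integral_congr_ae (Filter.Eventually.of_forall hcx), hlin _ _ _ _ _ _ hi (hie _) (hie _),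
    integral_exp_inner_mul_fracLaplacian,
    integral_exp_inner_mul_fracLaplacian, integral_fracLaplacian, fracSymbol_smul, fracSymbol_smul]
  have hτ' : (τ : ℂ) ≠ 0 := by exact_mod_cast hτ
  push_cast
  field_simp
  ring

/-- Up to the factor `-2`, testing the ridge function `|⟪a, x⟫ - b|` gives the inverse Fourier
transform of the spectrum of `ψ` on the line through `a`. -/
theorem integral_abs_mul_fracLaplacian [NeZero d] (ψ : 𝓢(Space d, ℂ)) (p : Weight d) :
    ∫ x, ((|⟪(p.1 : Space d), x⟫ - p.2| : ℝ) : ℂ) * fracLaplacian (((d : ℝ) + 1) / 2) ψ x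
      = -2 * ∫ τ : ℝ, Complex.exp (2 * Real.pi * τ * p.2 * Complex.I) * lineSpectrum ψ (p.1, τ) := by
  set Ψ := fracLaplacian (((d : ℝ) + 1) / 2) ψ with hΨ
  have hΨc : Continuous Ψ := continuous_fracLaplacian ψ
  obtain ⟨φ, hφ⟩ : ∃ φ : Space d → ℝ → ℝ, ∀ x τ, φ x τ =
    (1 - Real.cos (2 * Real.pi * τ * (⟪(p.1 : Space d), x⟫ - p.2))) / τ ^ 2 := ⟨_, fun _ _ => rfl⟩
  have hφ0 : ∀ x τ, 0 ≤ φ x τ := fun x τ => by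
    rw [hφ]
    exact div_nonneg
      (by linarith [Real.cos_le_one (2 * Real.pi * τ * (⟪(p.1 : Space d), x⟫ - p.2))])
      (sq_nonneg _)
  have hφi : ∀ x, Integrable (φ x) := fun x => by
    rw [funext (hφ x)]; exact (integral_one_sub_cos_mul_div_sq _).1
  have hφs : ∀ x, ∫ τ, φ x τ = 2 * Real.pi ^ 2 * |⟪(p.1 : Space d), x⟫ - p.2| := fun x => by
    rw [funext (hφ x)]; exact (integral_one_sub_cos_mul_div_sq _).2
  have hmeas : Measurable fun q : Space d × ℝ => φ q.1 q.2 := by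
    simp only [hφ]
    have h1 : Measurable fun q : Space d × ℝ =>
        1 - Real.cos (2 * Real.pi * q.2 * (⟪(p.1 : Space d), q.1⟫ - p.2)) :=
      Continuous.measurable (by fun_prop)
    exact h1.div (measurable_snd.pow_const 2)
  have hprod : Integrable (fun q : Space d × ℝ => (φ q.1 q.2 : ℂ) * Ψ q.1)
      ((volume : Measure (Space d)).prod volume) := by
    rw [integrable_prod_iff]
    · refine ⟨Filter.Eventually.of_forall fun x => ?_, ?_⟩
      · have h1 : Integrable fun τ => (φ x τ : ℂ) := (hφi x).ofReal
        exact h1.mul_const (Ψ x)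
      have he : ∀ x, ∫ τ, ‖(φ x τ : ℂ) * Ψ x‖
          = 2 * Real.pi ^ 2 * (|⟪(p.1 : Space d), x⟫ - p.2| * ‖Ψ x‖) := by
        intro x
        simp only [norm_mul, Complex.norm_real, Real.norm_of_nonneg (hφ0 x _)]
        rw [integral_mul_const, hφs]
        ring
      simp only [he]
      refine Integrable.const_mul ?_ _
      refine ((integrable_one_add_norm_mul_fracLaplacian ψ).const_mul (1 + |p.2|)).mono'
        (Continuous.aestronglyMeasurable (by fun_prop)) (Filter.Eventually.of_forall fun x => ?_)
      rw [Real.norm_of_nonneg (by positivity), ← mul_assoc]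
      gcongr
      have h1 := abs_inner_sphere_le p.1 x
      have h3 := abs_sub (⟪(p.1 : Space d), x⟫) p.2
      nlinarith [abs_nonneg p.2, norm_nonneg x]
    · exact ((Complex.measurable_ofReal.comp hmeas).mul
        (hΨc.measurable.comp measurable_fst)).aestronglyMeasurable
  have hswap := integral_integral_swap (f := fun x τ => (φ x τ : ℂ) * Ψ x) hprod
  have hl : ∀ x, ∫ τ, (φ x τ : ℂ) * Ψ x
      = ((2 * Real.pi ^ 2 : ℝ) : ℂ) * (((|⟪(p.1 : Space d), x⟫ - p.2| : ℝ) : ℂ) * Ψ x) := by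
    intro x
    rw [integral_mul_const, integral_complex_ofReal, hφs]
    push_cast; ring
  simp only [hl] at hswap
  rw [integral_const_mul] at hswap
  have hr : ∀ᵐ τ : ℝ, ∫ x, (φ x τ : ℂ) * Ψ x
      = -(2 * Real.pi ^ 2 : ℝ) * (Complex.exp (2 * Real.pi * τ * p.2 * Complex.I)
          * lineSpectrum ψ (p.1, τ)
        + Complex.exp (2 * Real.pi * (-τ : ℝ) * p.2 * Complex.I) * lineSpectrum ψ (p.1, -τ)) := by
    have : ∀ᵐ τ : ℝ, τ ≠ 0 := Measure.ae_ne volume 0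
    filter_upwards [this] with τ hτ
    simp only [hφ]
    exact integral_cos_mul_fracLaplacian ψ p hτ
  have hk := integrable_exp_phase_mul_lineSpectrum ψ p
  rw [integral_congr_ae hr, integral_const_mul, integral_add hk hk.comp_neg,
    integral_neg_eq_self (fun τ : ℝ =>
      Complex.exp (2 * Real.pi * τ * p.2 * Complex.I) * lineSpectrum ψ (p.1, τ))] at hswap
  have hpi : (((2 * Real.pi ^ 2 : ℝ)) : ℂ) ≠ 0 := by
    exact_mod_cast (by positivity : (2 * Real.pi ^ 2 : ℝ) ≠ 0)
  refine mul_left_cancel₀ hpi (hswap.trans ?_)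
  ring

theorem relu_eq (p : Weight d) (x : Space d) :
    relu p x = (⟪(p.1 : Space d), x⟫ - p.2) / 2 + |⟪(p.1 : Space d), x⟫ - p.2| / 2 := by
  unfold relu
  rcases le_total 0 (⟪(p.1 : Space d), x⟫ - p.2) with h | h
  · rw [max_eq_left h, abs_of_nonneg h]; ring
  · rw [max_eq_right h, abs_of_nonpos h]; ring

theorem integral_affine_mul_fracLaplacian [NeZero d] (ψ : 𝓢(Space d, ℂ)) (v : Space d) (δ : ℝ) :
    ∫ x, ((⟪v, x⟫ + δ : ℝ) : ℂ) * fracLaplacian (((d : ℝ) + 1) / 2) ψ x = 0 := by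
  have h1 : Integrable fun x => ((⟪v, x⟫ : ℝ) : ℂ) * fracLaplacian (((d : ℝ) + 1) / 2) ψ x :=
    integrable_mul_fracLaplacian ψ (C := ‖v‖) (Continuous.aestronglyMeasurable (by fun_prop))
      fun x => by
        rw [Complex.norm_real]
        exact (norm_inner_le_norm v x).trans (by gcongr; linarith)
  have h2 := (integrable_fracLaplacian ψ).const_mul (δ : ℂ)
  simp only [Complex.ofReal_add, add_mul]
  rw [integral_add h1 h2, integral_const_mul, integral_fracLaplacian,
    integral_inner_mul_fracLaplacian]
  simp

/-- Testing the ReLU ridge function against `(-Δ)^{(d+1)/2} ψ` gives, up to sign, the inverse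
Fourier transform of the spectrum of `ψ` on the line through `a`. -/
theorem integral_relu_mul_fracLaplacian [NeZero d] (ψ : 𝓢(Space d, ℂ)) (p : Weight d) :
    ∫ x, ((relu p x : ℝ) : ℂ) * fracLaplacian (((d : ℝ) + 1) / 2) ψ x
      = -∫ τ : ℝ, Complex.exp (2 * Real.pi * τ * p.2 * Complex.I) * lineSpectrum ψ (p.1, τ) := by
  set Ψ := fracLaplacian (((d : ℝ) + 1) / 2) ψ with hΨ
  have he : ∀ x, ((relu p x : ℝ) : ℂ) * Ψ x
      = (1 / 2 : ℂ) * (((⟪(p.1 : Space d), x⟫ + -p.2 : ℝ) : ℂ) * Ψ x)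
        + (1 / 2 : ℂ) * (((|⟪(p.1 : Space d), x⟫ - p.2| : ℝ) : ℂ) * Ψ x) := by
    intro x
    rw [relu_eq]
    push_cast
    ring
  have hb : ∀ x : Space d, |⟪(p.1 : Space d), x⟫ - p.2| ≤ (1 + |p.2|) * (1 + ‖x‖) := by
    intro x
    have h1 := abs_inner_sphere_le p.1 x
    have h3 := abs_sub (⟪(p.1 : Space d), x⟫) p.2
    nlinarith [abs_nonneg p.2, norm_nonneg x]
  have h1 : Integrable fun x => ((⟪(p.1 : Space d), x⟫ + -p.2 : ℝ) : ℂ) * Ψ x :=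
    integrable_mul_fracLaplacian ψ (C := 1 + |p.2|) (Continuous.aestronglyMeasurable (by fun_prop))
      fun x => by rw [Complex.norm_real, Real.norm_eq_abs, ← sub_eq_add_neg]; exact hb x
  have h2 : Integrable fun x => ((|⟪(p.1 : Space d), x⟫ - p.2| : ℝ) : ℂ) * Ψ x :=
    integrable_mul_fracLaplacian ψ (C := 1 + |p.2|) (Continuous.aestronglyMeasurable (by fun_prop))
      fun x => by rw [Complex.norm_real, Real.norm_eq_abs, abs_abs]; exact hb x
  rw [integral_congr_ae (Filter.Eventually.of_forall he),
    integral_add (h1.const_mul _) (h2.const_mul _), integral_const_mul, integral_const_mul,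
    integral_affine_mul_fracLaplacian, integral_abs_mul_fracLaplacian]
  ring

end Relu

/-! ### Polar coordinates and reflection on the parameter space -/

section Polar

variable {d : ℕ}

/-- The surface measure is defined through the volumes of cones, which reflection preserves. -/
theorem measurePreserving_neg_toSphere :
    MeasurePreserving (fun a : Metric.sphere (0 : Space d) 1 => -a)
      (volume : Measure (Space d)).toSphere (volume : Measure (Space d)).toSphere := by
  refine ⟨continuous_neg.measurable, Measure.ext fun s hs => ?_⟩
  rw [Measure.map_apply continuous_neg.measurable hs,
    Measure.toSphere_apply' _ (continuous_neg.measurable hs), Measure.toSphere_apply' _ hs]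
  congr 1
  rw [← Measure.measure_neg]
  congr 1
  ext x
  simp only [Set.mem_neg, Set.mem_smul, mem_image, mem_preimage]
  constructor
  · rintro ⟨r, hr, y, ⟨a, ha, rfl⟩, h⟩
    exact ⟨r, hr, _, ⟨-a, ha, rfl⟩, by simp [h]⟩
  · rintro ⟨r, hr, y, ⟨a, ha, rfl⟩, h⟩
    exact ⟨r, hr, _, ⟨-a, by simpa using ha, rfl⟩, by simp [h]⟩

instance : SFinite (weightMeasure d) := by unfold weightMeasure; infer_instance

theorem sFinite_comap_subtype_val_Ioi :
    SFinite (Measure.comap (Subtype.val : Ioi (0 : ℝ) → ℝ) volume) := by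
  have h : Measure.comap (Subtype.val : Ioi (0 : ℝ) → ℝ) volume = Measure.volumeIoiPow 0 := by
    simp only [Measure.volumeIoiPow, pow_zero, ENNReal.ofReal_one]
    exact withDensity_one.symm
  rw [h]; infer_instance

theorem measurePreserving_neg_weightMeasure :
    MeasurePreserving (fun p : Weight d => -p) (weightMeasure d) (weightMeasure d) :=
  measurePreserving_neg_toSphere.prod (Measure.measurePreserving_neg volume)

theorem measurePreserving_neg_weightMeasureOn (k : ℝ) :
    MeasurePreserving (fun p : Weight d => -p) (weightMeasureOn d k) (weightMeasureOn d k) := by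
  refine measurePreserving_neg_toSphere.prod ?_
  have h := (Measure.measurePreserving_neg (volume : Measure ℝ)).restrict_preimage
    (measurableSet_Icc (a := -k) (b := k))
  have h2 : Neg.neg ⁻¹' (Icc (-k) k) = Icc (-k) k := by
    ext x; simp only [mem_preimage, mem_Icc]; constructor <;> rintro ⟨h1, h2⟩ <;>
      constructor <;> linarith
  rwa [h2] at h

theorem measurableEmbedding_neg_weight : MeasurableEmbedding fun p : Weight d => -p :=
  (Homeomorph.neg (Weight d)).measurableEmbedding

/-- The product of the surface measure and Lebesgue measure on `(0, ∞)`, regarded as a measure on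
`𝕊^{d-1} × ℝ`. -/
noncomputable def halfMeasure (d : ℕ) : Measure (Weight d) :=
  (volume : Measure (Space d)).toSphere.prod (volume.restrict (Ioi 0))

theorem measurePreserving_subtype_val_Ioi :
    MeasurePreserving (fun q : Metric.sphere (0 : Space d) 1 × Ioi (0 : ℝ) => (q.1, (q.2 : ℝ)))
      ((volume : Measure (Space d)).toSphere.prod (Measure.comap Subtype.val volume))
      (halfMeasure d) := by
  have h : MeasurePreserving (Subtype.val : Ioi (0 : ℝ) → ℝ) (Measure.comap Subtype.val volume)
      (volume.restrict (Ioi 0)) :=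
    ⟨measurable_subtype_coe, map_comap_subtype_coe measurableSet_Ioi volume⟩
  have := sFinite_comap_subtype_val_Ioi
  exact (MeasurePreserving.id _).prod h

theorem measurableEmbedding_subtype_val_Ioi : MeasurableEmbedding
    (fun q : Metric.sphere (0 : Space d) 1 × Ioi (0 : ℝ) => (q.1, (q.2 : ℝ))) :=
  MeasurableEmbedding.id.prodMap (MeasurableEmbedding.subtype_coe measurableSet_Ioi)

theorem toSphere_prod_volumeIoiPow (n : ℕ) :
    (volume : Measure (Space d)).toSphere.prod (Measure.volumeIoiPow n)
      = ((volume : Measure (Space d)).toSphere.prod (Measure.comap Subtype.val volume)).withDensity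
        fun q : Metric.sphere (0 : Space d) 1 × Ioi (0 : ℝ) =>
          ((Real.toNNReal ((q.2 : ℝ) ^ n) : NNReal) : ℝ≥0∞) := by
  have := sFinite_comap_subtype_val_Ioi
  rw [Measure.volumeIoiPow, prod_withDensity_right]
  · rfl
  · fun_prop

/-- Integrability in polar coordinates. -/
theorem integrable_iff_polar {f : Space d → ℂ} [NeZero d] :
    Integrable f ↔
      Integrable (fun q : Weight d => ((q.2 ^ (d - 1) : ℝ) : ℂ) * f (q.2 • (q.1 : Space d)))
        (halfMeasure d) := by
  have hm : Measurable fun q : Metric.sphere (0 : Space d) 1 × Ioi (0 : ℝ) =>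
      Real.toNNReal ((q.2 : ℝ) ^ (d - 1)) := by fun_prop
  rw [← restrict_compl_singleton (μ := (volume : Measure (Space d))) 0, ← IntegrableOn,
    integrableOn_iff_comap_subtypeVal (by measurability),
    ← (measurePreserving_subtype_val_Ioi (d := d)).integrable_comp_emb
      measurableEmbedding_subtype_val_Ioi]
  have h := (volume : Measure (Space d)).measurePreserving_homeomorphUnitSphereProd.integrable_comp_emb
    (g := fun q => f ((q.2 : ℝ) • (q.1 : Space d))) (Homeomorph.measurableEmbedding _)
  rw [finrank_euclideanSpace_fin, toSphere_prod_volumeIoiPow,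
    integrable_withDensity_iff_integrable_smul hm] at h
  refine Iff.trans (integrable_congr (Filter.Eventually.of_forall fun x => ?_))
    (h.trans (integrable_congr (Filter.Eventually.of_forall fun q => ?_)))
  · have hx : ‖(x : Space d)‖ ≠ 0 := norm_ne_zero_iff.2 x.2
    simp [smul_smul, hx]
  · have := q.2.2.out.le
    simp only [NNReal.smul_def, Function.comp_apply]
    rw [Real.coe_toNNReal _ (by positivity)]
    rfl

theorem integral_eq_polar (f : Space d → ℂ) [NeZero d] :
    ∫ x, f x =
      ∫ q : Weight d, ((q.2 ^ (d - 1) : ℝ) : ℂ) * f (q.2 • (q.1 : Space d)) ∂(halfMeasure d) := by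
  have hm : Measurable fun q : Metric.sphere (0 : Space d) 1 × Ioi (0 : ℝ) =>
      Real.toNNReal ((q.2 : ℝ) ^ (d - 1)) := by fun_prop
  rw [← restrict_compl_singleton (μ := (volume : Measure (Space d))) 0,
    ← integral_subtype_comap (by measurability),
    ← (measurePreserving_subtype_val_Ioi (d := d)).integral_comp
      measurableEmbedding_subtype_val_Ioi]
  have h := (volume : Measure (Space d)).measurePreserving_homeomorphUnitSphereProd.integral_comp
    (Homeomorph.measurableEmbedding _) (fun q => f ((q.2 : ℝ) • (q.1 : Space d)))
  rw [finrank_euclideanSpace_fin, toSphere_prod_volumeIoiPow,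
    integral_withDensity_eq_integral_smul hm] at h
  refine Eq.trans (integral_congr_ae (Filter.Eventually.of_forall fun x => ?_))
    (h.trans (integral_congr_ae (Filter.Eventually.of_forall fun q => ?_)))
  · have hx : ‖(x : Space d)‖ ≠ 0 := norm_ne_zero_iff.2 x.2
    simp [smul_smul, hx]
  · have := q.2.2.out.le
    simp only [NNReal.smul_def]
    rw [Real.coe_toNNReal _ (by positivity)]
    rfl

theorem halfMeasure_eq : halfMeasure d = (weightMeasure d).restrict (univ ×ˢ Ioi 0) := by
  rw [weightMeasure, ← Measure.prod_restrict, Measure.restrict_univ, halfMeasure]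

/-- The reflection `(a, b) ↦ (-a, -b)` exchanges the two half-spaces `b > 0` and `b < 0`. -/
theorem integral_eq_two_mul_of_even {G : Weight d → ℂ} (hG : Integrable G (weightMeasure d))
    (he : ∀ q, G (-q) = G q) :
    ∫ q, G q ∂(weightMeasure d) = 2 * ∫ q, G q ∂(halfMeasure d) := by
  have hms : MeasurableSet (univ ×ˢ Ioi 0 : Set (Weight d)) :=
    MeasurableSet.univ.prod measurableSet_Ioi
  have hneg : ∫ q in (univ ×ˢ Ioi 0)ᶜ, G q ∂(weightMeasure d)
      = ∫ q in (univ ×ˢ Ioi 0), G q ∂(weightMeasure d) := by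
    have h1 := measurePreserving_neg_weightMeasure.setIntegral_preimage_emb
      measurableEmbedding_neg_weight G (univ ×ˢ Ioi 0 : Set (Weight d))
    simp only [he] at h1
    rw [← h1]
    refine setIntegral_congr_set ?_
    have h0 : weightMeasure d (univ ×ˢ {0}) = 0 := by
      rw [weightMeasure, Measure.prod_prod]; simp
    have h0' : ∀ᵐ q ∂(weightMeasure d), q ∉ (univ ×ˢ {(0 : ℝ)} : Set (Weight d)) :=
      measure_eq_zero_iff_ae_notMem.1 h0
    filter_upwards [h0'] with q hq
    have hq : q.2 ≠ 0 := by simpa using hq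
    apply propext
    change q ∈ (univ ×ˢ Ioi (0:ℝ) : Set (Weight d))ᶜ ↔ -q ∈ (univ ×ˢ Ioi (0:ℝ) : Set (Weight d))
    simp only [mem_compl_iff, mem_prod, mem_univ, true_and, mem_Ioi, Prod.snd_neg]
    constructor
    · intro h; rcases lt_or_gt_of_ne hq with h' | h' <;> [linarith; exact absurd h' h]
    · intro h; linarith
  rw [← integral_add_compl hms hG, hneg, halfMeasure_eq]
  ring

end Polar

/-! ### The weak Fourier slice identity -/

section Main

variable {d : ℕ}

/-- The exchange of the last two coordinates of `𝕊^{d-1} × ℝ × ℝ` preserves the measure. -/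
theorem measurePreserving_exchange :
    MeasurePreserving (fun r : Weight d × ℝ => ((r.1.1, r.2), r.1.2))
      ((weightMeasure d).prod volume) ((weightMeasure d).prod volume) := by
  have h1 := measurePreserving_prodAssoc (volume : Measure (Space d)).toSphere
    (volume : Measure ℝ) (volume : Measure ℝ)
  have h2 := (MeasurePreserving.id (volume : Measure (Space d)).toSphere).prod
    (Measure.measurePreserving_swap (μ := (volume : Measure ℝ)) (ν := (volume : Measure ℝ)))
  exact (h1.symm _).comp (h2.comp h1)

theorem measurableEmbedding_exchange :
    MeasurableEmbedding (fun r : Weight d × ℝ => (((r.1.1, r.2), r.1.2) : Weight d × ℝ)) :=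
  MeasurableEquiv.measurableEmbedding
    { toFun := fun r : Weight d × ℝ => (((r.1.1, r.2), r.1.2) : Weight d × ℝ)
      invFun := fun r : Weight d × ℝ => (((r.1.1, r.2), r.1.2) : Weight d × ℝ)
      left_inv := fun _ => rfl
      right_inv := fun _ => rfl
      measurable_toFun := Measurable.prodMk (by fun_prop) (by fun_prop)
      measurable_invFun := Measurable.prodMk (by fun_prop) (by fun_prop) }

theorem lineSpectrum_neg (ψ : 𝓢(Space d, ℂ)) (q : Weight d) :
    lineSpectrum ψ (-q) = lineSpectrum ψ q := by
  simp [lineSpectrum]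

/-- The one-dimensional (inverse) Fourier transform of a density in the bias `b`. -/
noncomputable def biasFourier (e : Weight d → ℝ) (q : Weight d) : ℂ :=
  ∫ b : ℝ, Complex.exp (2 * Real.pi * q.2 * b * Complex.I) * (e (q.1, b) : ℂ)

theorem biasFourier_neg {e : Weight d → ℝ} (he : IsEven e) (q : Weight d) :
    biasFourier e (-q) = biasFourier e q := by
  unfold biasFourier
  rw [← integral_neg_eq_self]
  refine integral_congr_ae (Filter.Eventually.of_forall fun b => ?_)
  simp only [Prod.fst_neg, Prod.snd_neg, he q.1 b]
  congr 2
  push_cast; ring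

theorem rayFourier_smul_sphere (e : Weight d → ℝ) (a : Metric.sphere (0 : Space d) 1) {τ : ℝ}
    (hτ : 0 < τ) : rayFourier e (τ • (a : Space d)) = biasFourier e (a, τ) := by
  rw [rayFourier_smul e hτ]
  simp [partialFourier, biasFourier, rayExtension_sphere]

/-- Parseval's identity in the bias, integrated over the sphere. -/
theorem integrable_lineSpectrum_mul_biasFourier (ψ : 𝓢(Space d, ℂ)) {e : Weight d → ℝ}
    (hi : Integrable e (weightMeasure d)) :
    Integrable (fun q => lineSpectrum ψ q * biasFourier e q) (weightMeasure d) ∧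
    ∫ p, (e p : ℂ) * (∫ τ : ℝ, Complex.exp (2 * Real.pi * τ * p.2 * Complex.I)
        * lineSpectrum ψ (p.1, τ)) ∂(weightMeasure d)
      = ∫ q, lineSpectrum ψ q * biasFourier e q ∂(weightMeasure d) := by
  obtain ⟨C, hC0, hC⟩ := exists_norm_lineSpectrum_le ψ
  have hL := continuous_lineSpectrum ψ
  have hiC : Integrable (fun p => (e p : ℂ)) (weightMeasure d) := hi.ofReal
  have hF : Integrable (fun r : Weight d × ℝ => (e r.1 : ℂ) *
      (Complex.exp (2 * Real.pi * r.2 * r.1.2 * Complex.I) * lineSpectrum ψ (r.1.1, r.2)))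
      ((weightMeasure d).prod volume) := by
    refine (hi.norm.mul_prod (integrable_inv_one_add_norm_sq.const_mul C)).mono' ?_
      (Filter.Eventually.of_forall fun r => ?_)
    · refine (hiC.aestronglyMeasurable.comp_fst).mul (Continuous.aestronglyMeasurable ?_)
      fun_prop
    · rw [norm_mul, norm_mul, norm_exp_phase, one_mul, Complex.norm_real]
      gcongr
      exact hC (r.1.1, r.2)
  have hF' := (measurePreserving_exchange (d := d)).integrable_comp_emb measurableEmbedding_exchange
    |>.2 hF
  have hint := (measurePreserving_exchange (d := d)).integral_comp measurableEmbedding_exchange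
    (fun r : Weight d × ℝ => (e r.1 : ℂ) *
      (Complex.exp (2 * Real.pi * r.2 * r.1.2 * Complex.I) * lineSpectrum ψ (r.1.1, r.2)))
  have hq : ∀ q : Weight d, ∫ b : ℝ, (e (q.1, b) : ℂ) *
      (Complex.exp (2 * Real.pi * q.2 * b * Complex.I) * lineSpectrum ψ (q.1, q.2))
      = lineSpectrum ψ q * biasFourier e q := by
    intro q
    rw [biasFourier, ← integral_const_mul]
    refine integral_congr_ae (Filter.Eventually.of_forall fun b => ?_)
    simp only [Prod.mk.eta]; ring
  constructor
  · have := hF'.integral_prod_left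
    refine this.congr (Filter.Eventually.of_forall fun q => hq q)
  · have hint' := (integral_prod _ hF').symm.trans (hint.trans (integral_prod _ hF))
    simp only [integral_const_mul] at hint'
    rw [← hint']
    exact integral_congr_ae (Filter.Eventually.of_forall fun q => hq q)

/-- The Fourier slice identity in weak form: pairing `(-Δ)^{(d+1)/2}` of the network with even
density `e` against `ψ` amounts to pairing `𝓕ψ` with a multiple of the Fourier transform of `e`
in the bias, read off along rays. -/
theorem integral_network_mul_fracLaplacian [NeZero d] (ψ : 𝓢(Space d, ℂ)) {e : Weight d → ℝ}
    (he : IsEven e) (hm : AEStronglyMeasurable e (weightMeasure d))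
    (hi : Integrable (fun p => (1 + |p.2|) * |e p|) (weightMeasure d)) :
    Integrable (fun ξ => 𝓕 (ψ : Space d → ℂ) ξ * rayFourier e ξ) ∧
    Integrable (fun x => ((∫ p, relu p x * e p ∂(weightMeasure d) : ℝ) : ℂ)
        * fracLaplacian (((d : ℝ) + 1) / 2) ψ x) ∧
    ∫ x, ((∫ p, relu p x * e p ∂(weightMeasure d) : ℝ) : ℂ)
        * fracLaplacian (((d : ℝ) + 1) / 2) ψ x
      = -(2 * (2 * Real.pi) ^ (d - 1) : ℝ) * ∫ ξ, 𝓕 (ψ : Space d → ℂ) ξ * rayFourier e ξ := by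
  set Ψ := fracLaplacian (((d : ℝ) + 1) / 2) ψ with hΨ
  have hΨc : Continuous Ψ := continuous_fracLaplacian ψ
  have hie : Integrable e (weightMeasure d) := hi.mono' hm (Filter.Eventually.of_forall fun p => by
    rw [Real.norm_eq_abs]; nlinarith [abs_nonneg p.2, abs_nonneg (e p)])
  obtain ⟨hG, hGe⟩ := integrable_lineSpectrum_mul_biasFourier ψ hie
  -- the factor `τ^{d-1}` in `lineSpectrum` is the Jacobian of polar coordinates
  have hhalf : (fun q : Weight d => lineSpectrum ψ q * biasFourier e q) =ᵐ[halfMeasure d]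
      fun q => (((2 * Real.pi) ^ (d - 1) : ℝ) : ℂ) * (((q.2 ^ (d - 1) : ℝ) : ℂ) *
        (𝓕 (ψ : Space d → ℂ) (q.2 • (q.1 : Space d)) * rayFourier e (q.2 • (q.1 : Space d)))) := by
    rw [halfMeasure_eq]
    filter_upwards [ae_restrict_mem (MeasurableSet.univ.prod measurableSet_Ioi)] with q hq
    have hq : 0 < q.2 := hq.2
    rw [rayFourier_smul_sphere e q.1 hq, lineSpectrum, abs_of_pos hq, mul_pow]
    push_cast; ring
  have hpi : (((2 * Real.pi) ^ (d - 1) : ℝ) : ℂ) ≠ 0 := by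
    exact_mod_cast (by positivity : ((2 * Real.pi) ^ (d - 1) : ℝ) ≠ 0)
  refine ⟨?_, ?_⟩
  · rw [integrable_iff_polar]
    have h1 : Integrable (fun q : Weight d => lineSpectrum ψ q * biasFourier e q) (halfMeasure d) := by
      rw [halfMeasure_eq]; exact hG.restrict
    have h2 := (h1.congr hhalf).const_mul (((2 * Real.pi) ^ (d - 1) : ℝ) : ℂ)⁻¹
    refine h2.congr (Filter.Eventually.of_forall fun q => ?_)
    simp only
    rw [inv_mul_cancel_left₀ hpi]
  · have hprod : Integrable (fun r : Space d × Weight d =>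
        (((relu r.2 r.1 * e r.2 : ℝ)) : ℂ) * Ψ r.1)
        ((volume : Measure (Space d)).prod (weightMeasure d)) := by
      refine ((integrable_one_add_norm_mul_fracLaplacian ψ).mul_prod hi).mono' ?_
        (Filter.Eventually.of_forall fun r => ?_)
      · have h1 : AEStronglyMeasurable (fun r : Space d × Weight d => relu r.2 r.1)
            ((volume : Measure (Space d)).prod (weightMeasure d)) :=
          (continuous_relu.comp continuous_swap).aestronglyMeasurable
        have h2 : AEStronglyMeasurable (fun r : Space d × Weight d => relu r.2 r.1 * e r.2)
            ((volume : Measure (Space d)).prod (weightMeasure d)) := h1.mul hm.comp_snd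
        exact (Complex.continuous_ofReal.comp_aestronglyMeasurable h2).mul
          (hΨc.aestronglyMeasurable.comp_fst)
      · rw [norm_mul, Complex.norm_real, Real.norm_eq_abs, abs_mul]
        calc _ ≤ ((1 + |r.2.2|) * (1 + ‖r.1‖)) * |e r.2| * ‖Ψ r.1‖ := by
              gcongr; exact abs_relu_le _ _
          _ = _ := by ring
    have hswap := integral_integral_swap
      (f := fun x p => (((relu p x * e p : ℝ)) : ℂ) * Ψ x) hprod
    have hl : ∀ x, ∫ p, (((relu p x * e p : ℝ)) : ℂ) * Ψ x ∂(weightMeasure d)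
        = ((∫ p, relu p x * e p ∂(weightMeasure d) : ℝ) : ℂ) * Ψ x := fun x => by
      rw [integral_mul_const, integral_complex_ofReal]
    have hr : ∀ p, ∫ x, (((relu p x * e p : ℝ)) : ℂ) * Ψ x
        = -((e p : ℂ) * (∫ τ : ℝ, Complex.exp (2 * Real.pi * τ * p.2 * Complex.I)
        * lineSpectrum ψ (p.1, τ))) := fun p => by
      rw [← mul_neg, ← integral_relu_mul_fracLaplacian, ← integral_const_mul]
      refine integral_congr_ae (Filter.Eventually.of_forall fun x => ?_)
      simp only
      push_cast; ring
    have hint := hprod.integral_prod_left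
    simp only [hl] at hint
    refine ⟨hint, ?_⟩
    simp only [hl, hr] at hswap
    rw [hswap, integral_neg, hGe, integral_eq_two_mul_of_even hG fun q => by
      rw [lineSpectrum_neg, biasFourier_neg he], integral_congr_ae hhalf, integral_const_mul,
      ← integral_eq_polar fun ξ => 𝓕 (ψ : Space d → ℂ) ξ * rayFourier e ξ]
    push_cast; ring

end Main

/-! ### Integrable functions with vanishing Fourier transform -/

section Testing

variable {E : Type*} [NormedAddCommGroup E] [InnerProductSpace ℝ E] [FiniteDimensional ℝ E]
  [MeasurableSpace E] [BorelSpace E]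

/-- A function whose products with all Schwartz functions are integrable, with vanishing integral,
vanishes almost everywhere. -/
theorem ae_eq_zero_of_integral_schwartz_mul {R : E → ℂ}
    (hi : ∀ φ : 𝓢(E, ℂ), Integrable fun x => φ x * R x)
    (h0 : ∀ φ : 𝓢(E, ℂ), ∫ x, φ x * R x = 0) : ∀ᵐ x, R x = 0 := by
  have key : ∀ g : E → ℝ, ContDiff ℝ ∞ g → HasCompactSupport g →
      ∃ φ : 𝓢(E, ℂ), ∀ x, φ x = (g x : ℂ) := by
    intro g hg hs
    have h1 : HasCompactSupport (fun x => (g x : ℂ)) := hs.comp_left (g := fun t : ℝ => (t : ℂ)) rfl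
    have h2 : ContDiff ℝ ∞ (fun x => (g x : ℂ)) := Complex.ofRealCLM.contDiff.comp hg
    exact ⟨h1.toSchwartzMap h2, fun x => rfl⟩
  refine ae_eq_zero_of_integral_contDiff_smul_eq_zero (fun x => ?_) fun g hg hs => ?_
  · let φ : ContDiffBump x := ⟨1, 2, one_pos, one_lt_two⟩
    obtain ⟨φ', hφ'⟩ := key φ φ.contDiff φ.hasCompactSupport
    refine ⟨Metric.closedBall x 1, Metric.closedBall_mem_nhds x one_pos, ?_⟩
    refine (hi φ').integrableOn.congr_fun (fun y hy => ?_) Metric.isClosed_closedBall.measurableSet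
    have : φ y = 1 := φ.one_of_mem_closedBall hy
    simp [hφ', this]
  · obtain ⟨φ, hφ⟩ := key g hg hs
    rw [← h0 φ]
    simp [hφ]

/-- The Fourier transform is self-adjoint for the bilinear pairing of integrable functions. -/
theorem integral_fourier_mul_eq_flip {f g : E → ℂ} (hf : Integrable f) (hg : Integrable g) :
    ∫ x, 𝓕 f x * g x = ∫ x, f x * 𝓕 g x := by
  have h := VectorFourier.integral_fourierIntegral_smul_eq_flip (L := innerₗ E)
    Real.continuous_fourierChar (by exact continuous_inner) hf hg
  simp only [flip_innerₗ] at h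
  exact h

/-- The Fourier transform is injective on integrable functions. -/
theorem ae_eq_zero_of_fourier_ae_eq_zero {f : E → ℂ} (hf : Integrable f)
    (h : ∀ᵐ ξ, 𝓕 f ξ = 0) : ∀ᵐ x, f x = 0 := by
  refine ae_eq_zero_of_integral_schwartz_mul (fun φ => ?_) fun φ => ?_
  · obtain ⟨C, hC0, hC⟩ := SchwartzMap.exists_one_add_pow_mul_norm_le φ 0
    exact hf.bdd_mul φ.continuous.aestronglyMeasurable (Filter.Eventually.of_forall fun x => by
      simpa using hC x)
  · have h1 : (φ : E → ℂ) = 𝓕 ((𝓕⁻ φ : 𝓢(E, ℂ)) : E → ℂ) := by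
      rw [← SchwartzMap.fourier_coe, FourierTransform.fourier_fourierInv_eq]
    rw [h1, integral_fourier_mul_eq_flip (𝓕⁻ φ).integrable hf]
    rw [integral_congr_ae (g := fun _ => (0 : ℂ))
      (by filter_upwards [h] with x hx; rw [hx, mul_zero])]
    simp

end Testing

/-! ### Injectivity on even densities -/

section Injectivity

variable {d : ℕ}

instance (k : ℝ) : IsFiniteMeasure (weightMeasureOn d k) := by
  unfold weightMeasureOn; infer_instance

theorem measurableSet_strip (k : ℝ) :
    MeasurableSet (univ ×ˢ Icc (-k) k : Set (Weight d)) :=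
  MeasurableSet.univ.prod measurableSet_Icc

theorem weightMeasureOn_eq (k : ℝ) :
    weightMeasureOn d k = (weightMeasure d).restrict (univ ×ˢ Icc (-k) k) := by
  rw [weightMeasure, ← Measure.prod_restrict, Measure.restrict_univ, weightMeasureOn]

theorem ae_weightMeasureOn_abs_le (k : ℝ) : ∀ᵐ p ∂(weightMeasureOn d k), |p.2| ≤ k := by
  rw [weightMeasureOn_eq]
  filter_upwards [ae_restrict_mem (measurableSet_strip k)] with p hp
  exact abs_le.2 hp.2

theorem biasFourier_conj (e : Weight d → ℝ) (a : Metric.sphere (0 : Space d) 1) (τ : ℝ) :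
    biasFourier e (a, -τ) = starRingEnd ℂ (biasFourier e (a, τ)) := by
  unfold biasFourier
  rw [← integral_conj]
  refine integral_congr_ae (Filter.Eventually.of_forall fun b => ?_)
  simp only [map_mul, Complex.conj_ofReal, ← Complex.exp_conj, Complex.conj_I]
  congr 2
  simp [map_ofNat]

/-- A density on `𝕊^{d-1} × ℝ` is determined by its Fourier transform along rays. -/
theorem ae_eq_zero_of_rayFourier_ae_eq_zero [NeZero d] {E : Weight d → ℝ}
    (hi : Integrable E (weightMeasure d)) (hR : ∀ᵐ ξ, rayFourier E ξ = 0) :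
    E =ᵐ[weightMeasure d] 0 := by
  -- in polar coordinates, the Fourier transforms of almost all slices vanish on `(0, ∞)`
  have hpolar : ∀ᵐ q ∂(halfMeasure d), biasFourier E q = 0 := by
    have hR' : (fun ξ => ((‖rayFourier E ξ‖ : ℝ) : ℂ)) =ᵐ[volume] fun _ => 0 := by
      filter_upwards [hR] with ξ hξ
      simp [hξ]
    have h1 := integrable_iff_polar.1 ((integrable_zero _ _ _).congr hR'.symm)
    have h2 := integral_eq_polar fun ξ => ((‖rayFourier E ξ‖ : ℝ) : ℂ)
    rw [integral_congr_ae hR', integral_zero] at h2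
    simp only [← Complex.ofReal_mul] at h1 h2
    rw [integral_complex_ofReal] at h2
    have h1' : Integrable (fun q : Weight d => q.2 ^ (d - 1) * ‖rayFourier E (q.2 • (q.1 : Space d))‖)
        (halfMeasure d) := by
      exact h1.re.congr (Filter.Eventually.of_forall fun q => Complex.ofReal_re _)
    have hpos : ∀ᵐ q ∂(halfMeasure d), 0 < q.2 := by
      rw [halfMeasure_eq]
      filter_upwards [ae_restrict_mem (MeasurableSet.univ.prod measurableSet_Ioi)] with q hq
      exact hq.2
    have h3 := (integral_eq_zero_iff_of_nonneg_ae (by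
      filter_upwards [hpos] with q hq
      simp only [Pi.zero_apply]
      positivity) h1').1 (by exact_mod_cast h2.symm)
    filter_upwards [h3, hpos] with q hq hp
    have : q.2 ^ (d - 1) ≠ 0 := by positivity
    simp only [Pi.zero_apply, mul_eq_zero, this, norm_eq_zero, false_or] at hq
    rwa [rayFourier_smul_sphere E q.1 hp] at hq
  have hslice : ∀ᵐ a ∂(volume : Measure (Space d)).toSphere, ∀ᵐ b : ℝ, E (a, b) = 0 := by
    have h1 := Measure.ae_ae_of_ae_prod hpolar
    have h2 := hi.prod_right_ae
    filter_upwards [h1, h2] with a ha1 ha2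
    rw [ae_restrict_iff' measurableSet_Ioi] at ha1
    have ha2' : Integrable (fun b => (E (a, b) : ℂ)) := ha2.ofReal
    have hneg := (Measure.measurePreserving_neg (volume : Measure ℝ)).quasiMeasurePreserving.ae ha1
    have hF : ∀ᵐ τ : ℝ, 𝓕 (fun b => (E (a, b) : ℂ)) τ = 0 := by
      have h0 : ∀ᵐ τ : ℝ, τ ≠ 0 := Measure.ae_ne volume 0
      filter_upwards [ha1, hneg, h0] with τ h1 h2 h0
      have h3 : 𝓕 (fun b => (E (a, b) : ℂ)) τ = biasFourier E (a, -τ) := by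
        rw [Real.fourier_eq', biasFourier]
        refine integral_congr_ae (Filter.Eventually.of_forall fun b => ?_)
        simp only [smul_eq_mul]
        congr 2
        simp only [RCLike.inner_apply, conj_trivial]
        push_cast; ring
      rw [h3]
      rcases lt_or_gt_of_ne h0 with h | h
      · exact h2 (by simpa using h)
      · rw [biasFourier_conj, h1 h, map_zero]
    filter_upwards [ae_eq_zero_of_fourier_ae_eq_zero ha2' hF] with b hb
    exact_mod_cast hb
  have hint : ∫ p, ‖E p‖ ∂(weightMeasure d) = 0 := by
    have h := integral_prod (fun p => ‖E p‖) hi.norm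
    rw [weightMeasure, h, integral_congr_ae (g := fun _ => (0 : ℝ))]
    · simp
    · filter_upwards [hslice] with a ha
      rw [integral_congr_ae (g := fun _ => (0 : ℝ))
        (by filter_upwards [ha] with b hb; simp [hb])]
      simp
  have := (integral_eq_zero_iff_of_nonneg (fun p => norm_nonneg (E p)) hi.norm).1 hint
  filter_upwards [this] with p hp
  simpa using hp

/-- An even density on the strip whose network is an affine function vanishes: affine functions are
orthogonal to all `(-Δ)^{(d+1)/2} ψ`, so the Fourier transform of the density along rays is zero. -/
theorem ae_eq_zero_of_integral_relu_mul_eq_affine [NeZero d] {k : ℝ} {e : Weight d → ℝ}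
    (he : IsEven e) (hi : Integrable e (weightMeasureOn d k)) (v : Space d) (δ : ℝ)
    (haff : ∀ x, ∫ p, relu p x * e p ∂(weightMeasureOn d k) = ⟪v, x⟫ + δ) :
    e =ᵐ[weightMeasureOn d k] 0 := by
  set S : Set (Weight d) := univ ×ˢ Icc (-k) k with hS
  have hSm : MeasurableSet S := measurableSet_strip k
  have hmem : ∀ p : Weight d, p ∈ S ↔ |p.2| ≤ k := fun p => by simp [hS, abs_le]
  rw [weightMeasureOn_eq] at hi ⊢
  have hE : Integrable (S.indicator e) (weightMeasure d) := (integrable_indicator_iff hSm).2 hi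
  have hEeven : IsEven (S.indicator e) := by
    intro a b
    have h1 : ((-a, -b) : Weight d) ∈ S ↔ ((a, b) : Weight d) ∈ S := by simp [hmem]
    by_cases hb : ((a, b) : Weight d) ∈ S
    · rw [indicator_of_mem hb, indicator_of_mem (h1.2 hb), he a b]
    · rw [indicator_of_notMem hb, indicator_of_notMem (fun h => hb (h1.1 h))]
  have hw : Integrable (fun p => (1 + |p.2|) * |S.indicator e p|) (weightMeasure d) := by
    refine (hE.norm.const_mul (1 + |k|)).mono' ?_ (Filter.Eventually.of_forall fun p => ?_)
    · exact (Continuous.aestronglyMeasurable (by fun_prop)).mul hE.norm.aestronglyMeasurable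
    · rw [Real.norm_of_nonneg (by positivity), Real.norm_eq_abs]
      by_cases hp : p ∈ S
      · have := (hmem p).1 hp
        have hk : |p.2| ≤ |k| := this.trans (le_abs_self k)
        gcongr
      · simp [indicator_of_notMem hp]
  have hnet : ∀ x, ∫ p, relu p x * S.indicator e p ∂(weightMeasure d) = ⟪v, x⟫ + δ := by
    intro x
    rw [← haff x, weightMeasureOn_eq, ← integral_indicator hSm]
    refine integral_congr_ae (Filter.Eventually.of_forall fun p => ?_)
    by_cases hp : p ∈ S <;> simp [hp]
  have hR : ∀ᵐ ξ, rayFourier (S.indicator e) ξ = 0 := by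
    have hφ : ∀ φ : 𝓢(Space d, ℂ), (φ : Space d → ℂ) = 𝓕 ((𝓕⁻ φ : 𝓢(Space d, ℂ)) : Space d → ℂ) := by
      intro φ
      rw [← SchwartzMap.fourier_coe, FourierTransform.fourier_fourierInv_eq]
    refine ae_eq_zero_of_integral_schwartz_mul (fun φ => ?_) fun φ => ?_
    · have h := (integral_network_mul_fracLaplacian (𝓕⁻ φ) hEeven hE.aestronglyMeasurable hw).1
      rwa [← hφ φ] at h
    · have h := (integral_network_mul_fracLaplacian (𝓕⁻ φ) hEeven hE.aestronglyMeasurable hw).2.2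
      simp only [hnet] at h
      rw [integral_affine_mul_fracLaplacian, ← hφ φ] at h
      have := (mul_eq_zero.1 h.symm).resolve_left (by
        refine neg_ne_zero.2 ?_
        exact_mod_cast (by positivity : (2 * (2 * Real.pi) ^ (d - 1) : ℝ) ≠ 0))
      exact this
  have h0 := ae_eq_zero_of_rayFourier_ae_eq_zero hE hR
  filter_upwards [ae_restrict_of_ae h0, ae_restrict_mem hSm] with p hp hpS
  rwa [indicator_of_mem hpS] at hp

end Injectivity

/-! ### Norm formulas and uniqueness -/

section Norm

variable {d : ℕ} {k : ℝ}

theorem memLp_relu (k : ℝ) (x : Space d) : MemLp (fun p => relu p x) 2 (weightMeasureOn d k) := by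
  refine MemLp.of_bound (C := (1 + k) * (1 + ‖x‖)) ?_ ?_
  · exact (continuous_relu.comp (by fun_prop : Continuous fun p : Weight d => (p, x))).aestronglyMeasurable
  · filter_upwards [ae_weightMeasureOn_abs_le k] with p hp
    exact (abs_relu_le p x).trans (by gcongr)

theorem integrable_relu_mul {e : Weight d → ℝ} (he : MemLp e 2 (weightMeasureOn d k))
    (x : Space d) : Integrable (fun p => relu p x * e p) (weightMeasureOn d k) :=
  (memLp_relu k x).integrable_mul he

theorem relu_neg (p : Weight d) (x : Space d) :
    relu (-p) x = relu p x - (⟪(p.1 : Space d), x⟫ - p.2) := by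
  unfold relu
  simp only [Prod.fst_neg, Prod.snd_neg, coe_neg_sphere, inner_neg_left]
  rcases le_total 0 (⟪(p.1 : Space d), x⟫ - p.2) with h | h
  · rw [max_eq_left h, max_eq_right (by linarith)]; ring
  · rw [max_eq_right h, max_eq_left (by linarith)]; ring

theorem memLp_comp_neg {e : Weight d → ℝ} (he : MemLp e 2 (weightMeasureOn d k)) :
    MemLp (fun p => e (-p)) 2 (weightMeasureOn d k) :=
  he.comp_measurePreserving (measurePreserving_neg_weightMeasureOn k)

theorem integral_comp_neg_weight (f : Weight d → ℝ) :
    ∫ p, f (-p) ∂(weightMeasureOn d k) = ∫ p, f p ∂(weightMeasureOn d k) :=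
  (measurePreserving_neg_weightMeasureOn k).integral_comp measurableEmbedding_neg_weight f

/-- Reflecting the density changes the network only by an affine function. -/
theorem exists_integral_relu_mul_comp_neg {e : Weight d → ℝ}
    (he : MemLp e 2 (weightMeasureOn d k)) :
    ∃ (v : Space d) (δ : ℝ), ∀ x, ∫ p, relu p x * e (-p) ∂(weightMeasureOn d k)
      = (∫ p, relu p x * e p ∂(weightMeasureOn d k)) + (⟪v, x⟫ + δ) := by
  have hie : Integrable e (weightMeasureOn d k) := he.integrable (by norm_num)
  have hv : Integrable (fun p : Weight d => e p • (p.1 : Space d)) (weightMeasureOn d k) := by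
    refine hie.norm.mono' (hie.aestronglyMeasurable.smul
      (Continuous.aestronglyMeasurable (by fun_prop))) (Filter.Eventually.of_forall fun p => ?_)
    rw [norm_smul]; simp
  have hb : Integrable (fun p : Weight d => p.2 * e p) (weightMeasureOn d k) := by
    refine (hie.norm.const_mul k).mono' ((Continuous.aestronglyMeasurable (by fun_prop)).mul
      hie.aestronglyMeasurable) ?_
    filter_upwards [ae_weightMeasureOn_abs_le k] with p hp
    rw [norm_mul]; gcongr; exact hp
  refine ⟨-∫ p, e p • (p.1 : Space d) ∂(weightMeasureOn d k),
    ∫ p, p.2 * e p ∂(weightMeasureOn d k), fun x => ?_⟩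
  rw [← integral_comp_neg_weight (fun p => relu p x * e (-p))]
  have h1 : ∀ p : Weight d, relu (-p) x * e (- -p)
      = relu p x * e p - (⟪x, e p • (p.1 : Space d)⟫ - p.2 * e p) := by
    intro p
    rw [relu_neg, neg_neg, real_inner_smul_right, real_inner_comm x]
    ring
  have hx : Integrable (fun p : Weight d => ⟪x, e p • (p.1 : Space d)⟫) (weightMeasureOn d k) :=
    hv.const_inner x
  have hxb : Integrable (fun p : Weight d => ⟪x, e p • (p.1 : Space d)⟫ - p.2 * e p)
    (weightMeasureOn d k) := hx.sub hb
  simp only [h1]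
  rw [integral_sub (integrable_relu_mul he x) hxb, integral_sub hx hb, integral_inner hv x,
    inner_neg_left, real_inner_comm x]
  ring

/-- A density whose network vanishes identically is odd, because its even part has an affine
network. -/
theorem ae_add_comp_neg_eq_zero [NeZero d] {e : Weight d → ℝ}
    (he : MemLp e 2 (weightMeasureOn d k))
    (h0 : ∀ x, ∫ p, relu p x * e p ∂(weightMeasureOn d k) = 0) :
    ∀ᵐ p ∂(weightMeasureOn d k), e p + e (-p) = 0 := by
  obtain ⟨v, δ, hvδ⟩ := exists_integral_relu_mul_comp_neg he
  have hs : MemLp (fun p => e p + e (-p)) 2 (weightMeasureOn d k) := he.add (memLp_comp_neg he)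
  refine ae_eq_zero_of_integral_relu_mul_eq_affine (e := fun p => e p + e (-p)) (fun a b => ?_)
    (hs.integrable (by norm_num)) v δ fun x => ?_
  · change e (-(a, b)) + e (- -(a, b)) = _
    rw [neg_neg, add_comm]
  · simp only [mul_add]
    rw [integral_add (integrable_relu_mul he x) (integrable_relu_mul (memLp_comp_neg he) x),
      hvδ, h0, zero_add, zero_add]

/-- Even densities are orthogonal to the densities of the zero function. -/
theorem integral_even_mul_eq_zero [NeZero d] {c e : Weight d → ℝ}
    (hc : IsEven c) (hcm : MemLp c 2 (weightMeasureOn d k))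
    (he : MemLp e 2 (weightMeasureOn d k))
    (h0 : ∀ x, ∫ p, relu p x * e p ∂(weightMeasureOn d k) = 0) :
    ∫ p, c p * e p ∂(weightMeasureOn d k) = 0 := by
  have h1 := integral_comp_neg_weight (k := k) fun p => c p * e p
  have hce : ∀ p, c (-p) = c p := fun p => hc p.1 p.2
  simp only [hce] at h1
  have h2 : ∫ p, (c p * e p + c p * e (-p)) ∂(weightMeasureOn d k) = 0 := by
    rw [integral_congr_ae (g := fun _ => (0 : ℝ))]
    · simp
    · filter_upwards [ae_add_comp_neg_eq_zero he h0] with p hp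
      rw [← mul_add, hp, mul_zero]
  have hi1 : Integrable (fun p => c p * e p) (weightMeasureOn d k) := hcm.integrable_mul he
  have hi2 : Integrable (fun p => c p * e (-p)) (weightMeasureOn d k) :=
    hcm.integrable_mul (memLp_comp_neg he)
  rw [integral_add hi1 hi2, h1] at h2
  linarith

theorem eLpNorm_two_eq {c : Weight d → ℝ} {μ : Measure (Weight d)} (hc : MemLp c 2 μ) :
    eLpNorm c 2 μ = ENNReal.ofReal (Real.sqrt (∫ p, c p ^ 2 ∂μ)) := by
  rw [hc.eLpNorm_eq_integral_rpow_norm (by norm_num) (by norm_num)]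
  simp [Real.sqrt_eq_rpow]

/-- An even density has the least `L²` norm among all densities of the same function: it is
orthogonal to the difference. -/
theorem integral_sq_le_of_even [NeZero d] {c c' : Weight d → ℝ}
    (hc : IsEven c) (hcm : MemLp c 2 (weightMeasureOn d k))
    (hcm' : MemLp c' 2 (weightMeasureOn d k))
    (h : ∀ x, ∫ p, relu p x * c' p ∂(weightMeasureOn d k)
      = ∫ p, relu p x * c p ∂(weightMeasureOn d k)) :
    ∫ p, c p ^ 2 ∂(weightMeasureOn d k) ≤ ∫ p, c' p ^ 2 ∂(weightMeasureOn d k) := by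
  have hem : MemLp (fun p => c' p - c p) 2 (weightMeasureOn d k) := hcm'.sub hcm
  have h0 : ∫ p, c p * (c' p - c p) ∂(weightMeasureOn d k) = 0 := by
    refine integral_even_mul_eq_zero hc hcm hem fun x => ?_
    simp only [mul_sub]
    rw [integral_sub (integrable_relu_mul hcm' x) (integrable_relu_mul hcm x), h, sub_self]
  have hi : Integrable (fun p => c p * (c' p - c p)) (weightMeasureOn d k) := hcm.integrable_mul hem
  have h1 : ∫ p, (c p ^ 2 + 2 * (c p * (c' p - c p))) ∂(weightMeasureOn d k)
      = ∫ p, c p ^ 2 ∂(weightMeasureOn d k) := by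
    rw [integral_add hcm.integrable_sq (hi.const_mul 2), integral_const_mul, h0]; ring
  rw [← h1]
  refine integral_mono (hcm.integrable_sq.add (hi.const_mul 2)) hcm'.integrable_sq fun p => ?_
  simp only
  nlinarith [sq_nonneg (c' p - c p)]

theorem IsEvenDensity.network_eq {c : Weight d → ℝ} (hc : IsEvenDensity k c) (v : Space d) (δ : ℝ)
    (x : Space d) : network c v δ x
      = (∫ p, relu p x * c p ∂(weightMeasureOn d k)) + ⟪v, x⟫ + δ := by
  rw [network, weightMeasureOn_eq, setIntegral_eq_integral_of_forall_compl_eq_zero]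
  intro p hp
  have : k < |p.2| := by
    by_contra hlt
    exact hp ⟨mem_univ _, abs_le.1 (not_lt.1 hlt)⟩
  rw [show c p = c (p.1, p.2) from rfl, hc.support p.1 p.2 this, mul_zero]

theorem rkhsNorm_network [NeZero d] {c : Weight d → ℝ} (hc : IsEvenDensity k c) :
    rkhsNorm k (network c 0 0) = ENNReal.ofReal
      (Real.sqrt (∫ p, c p ^ 2 ∂(weightMeasureOn d k))) := by
  have hn : ∀ x, network c 0 0 x = ∫ p, relu p x * c p ∂(weightMeasureOn d k) := fun x => by
    rw [hc.network_eq]; simp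
  refine le_antisymm ?_ (le_iInf₂ fun c' hc' => ?_)
  · rw [← eLpNorm_two_eq hc.memLp]
    exact iInf₂_le c ⟨hc.memLp, hn⟩
  · rw [eLpNorm_two_eq hc'.1]
    refine ENNReal.ofReal_le_ofReal (Real.sqrt_le_sqrt ?_)
    exact integral_sq_le_of_even hc.even hc.memLp hc'.1 fun x => by rw [← hc'.2, hn]

theorem IsEvenDensity.eq_of_network_eq [NeZero d] {c c' : Weight d → ℝ} {v v' : Space d}
    {δ δ' : ℝ} (hc : IsEvenDensity k c) (hc' : IsEvenDensity k c')
    (h : network c' v' δ' = network c v δ) :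
    c' =ᵐ[weightMeasureOn d k] c ∧ v' = v ∧ δ' = δ := by
  have hem : MemLp (fun p => c' p - c p) 2 (weightMeasureOn d k) := hc'.memLp.sub hc.memLp
  have hx : ∀ x, (∫ p, relu p x * (c' p - c p) ∂(weightMeasureOn d k))
      = ⟪v - v', x⟫ + (δ - δ') := by
    intro x
    have h1 := congrFun h x
    rw [hc.network_eq, hc'.network_eq] at h1
    simp only [mul_sub]
    rw [integral_sub (integrable_relu_mul hc'.memLp x) (integrable_relu_mul hc.memLp x),
      inner_sub_left]
    linarith
  have hae : (fun p => c' p - c p) =ᵐ[weightMeasureOn d k] 0 :=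
    ae_eq_zero_of_integral_relu_mul_eq_affine (fun a b => by simp only [hc'.even a b, hc.even a b])
      (hem.integrable (by norm_num)) _ _ hx
  have h0 : ∀ x, ⟪v - v', x⟫ + (δ - δ') = 0 := by
    intro x
    rw [← hx, integral_congr_ae (g := fun _ => (0 : ℝ))]
    · simp
    · filter_upwards [hae] with p hp
      rw [hp]; simp
  have hδ : δ - δ' = 0 := by simpa using h0 0
  have hv : v - v' = 0 := by
    have := h0 (v - v')
    rw [hδ, add_zero] at this
    exact inner_self_eq_zero.1 this
  refine ⟨?_, (sub_eq_zero.1 hv).symm, (sub_eq_zero.1 hδ).symm⟩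
  filter_upwards [hae] with p hp
  exact sub_eq_zero.1 hp

theorem networkNorm_network [NeZero d] {c : Weight d → ℝ} (hc : IsEvenDensity k c) (v : Space d)
    (δ : ℝ) : networkNorm k (network c v δ) = ENNReal.ofReal
      (Real.sqrt (∫ p, c p ^ 2 ∂(weightMeasureOn d k)) + ‖v‖ + |δ|) := by
  have hsum : ENNReal.ofReal (Real.sqrt (∫ p, c p ^ 2 ∂(weightMeasureOn d k)) + ‖v‖ + |δ|)
      = rkhsNorm k (network c 0 0) + ‖v‖ₑ + ‖δ‖ₑ := by
    rw [rkhsNorm_network hc, ENNReal.ofReal_add (by positivity) (by positivity),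
      ENNReal.ofReal_add (by positivity) (by positivity), ofReal_norm, Real.enorm_eq_ofReal_abs]
  rw [hsum]
  refine le_antisymm ?_ (le_iInf fun c' => le_iInf fun v' => le_iInf fun δ' => le_iInf fun h => ?_)
  · exact iInf_le_of_le c (iInf_le_of_le v (iInf_le_of_le δ (iInf_le_of_le ⟨hc, rfl⟩ le_rfl)))
  · obtain ⟨hcc, rfl, rfl⟩ := hc.eq_of_network_eq h.1 h.2.symm
    have : network c' 0 0 = network c 0 0 := by
      funext x
      rw [hc.network_eq, h.1.network_eq, integral_congr_ae]
      filter_upwards [hcc] with p hp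
      rw [hp]
    rw [this]

end Norm

/-! ### Hilbert spaces with the neural spline kernel -/

section Reproducing

variable {d : ℕ} {k : ℝ}

/-- The feature `[aᵀx - b]_+` as an element of `L²(𝕊^{d-1} × [-k, k])`. -/
noncomputable def reluLp (k : ℝ) (x : Space d) : Lp ℝ 2 (weightMeasureOn d k) :=
  (memLp_relu k x).toLp _

theorem inner_reluLp_toLp {e : Weight d → ℝ} (he : MemLp e 2 (weightMeasureOn d k))
    (x : Space d) : ⟪reluLp k x, he.toLp e⟫ = ∫ p, relu p x * e p ∂(weightMeasureOn d k) := by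
  rw [L2.inner_def]
  refine integral_congr_ae ?_
  filter_upwards [(memLp_relu k x).coeFn_toLp, he.coeFn_toLp] with p h1 h2
  simp only [reluLp, h1, h2, RCLike.inner_apply, conj_trivial]
  ring

theorem norm_toLp_two {e : Weight d → ℝ} (he : MemLp e 2 (weightMeasureOn d k)) :
    ‖he.toLp e‖ = Real.sqrt (∫ p, e p ^ 2 ∂(weightMeasureOn d k)) := by
  rw [Lp.norm_toLp, eLpNorm_two_eq he, ENNReal.toReal_ofReal (Real.sqrt_nonneg _)]

/-- Even densities lie in the closed span of the features: a density orthogonal to all features has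
a vanishing network, and is therefore orthogonal to every even density. -/
theorem toLp_mem_closure_span_reluLp [NeZero d] {c : Weight d → ℝ} (hc : IsEvenDensity k c) :
    hc.memLp.toLp c ∈ closure
      (Submodule.span ℝ (range (reluLp (d := d) k)) : Set (Lp ℝ 2 (weightMeasureOn d k))) := by
  rw [← Submodule.topologicalClosure_coe, ← Submodule.orthogonal_orthogonal_eq_closure]
  refine (Submodule.mem_orthogonal _ _).2 fun u hu => ?_
  have hum : MemLp u 2 (weightMeasureOn d k) := Lp.memLp u
  have h0 : ∀ x, ∫ p, relu p x * u p ∂(weightMeasureOn d k) = 0 := by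
    intro x
    rw [← inner_reluLp_toLp hum, Lp.toLp_coeFn]
    exact (Submodule.mem_orthogonal _ _).1 hu _ (Submodule.subset_span (mem_range_self x))
  rw [L2.inner_def, ← integral_even_mul_eq_zero hc.even hc.memLp hum h0]
  refine integral_congr_ae ?_
  filter_upwards [hc.memLp.coeFn_toLp] with p hp
  simp [hp]

/-- If two families of vectors have the same Gram matrix, then every vector in the closed span of
the first has a counterpart with the same norm and the same inner products with the family. -/
theorem exists_of_gram_eq {X F G : Type*} [NormedAddCommGroup F] [InnerProductSpace ℝ F]
    [NormedAddCommGroup G] [InnerProductSpace ℝ G] [CompleteSpace G] (r : X → F) (s : X → G)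
    (h : ∀ x y, ⟪s x, s y⟫ = ⟪r x, r y⟫) {u : F}
    (hu : u ∈ closure (Submodule.span ℝ (range r) : Set F)) :
    ∃ g : G, ‖g‖ = ‖u‖ ∧ ∀ x, ⟪s x, g⟫ = ⟪r x, u⟫ := by
  have hinner : ∀ (x : X) (α : X →₀ ℝ), ⟪s x, Finsupp.linearCombination ℝ s α⟫
      = ⟪r x, Finsupp.linearCombination ℝ r α⟫ := by
    intro x α
    simp [Finsupp.linearCombination_apply, Finsupp.sum, inner_sum, real_inner_smul_right, h]
  have hnorm : ∀ α : X →₀ ℝ,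
      ‖Finsupp.linearCombination ℝ s α‖ = ‖Finsupp.linearCombination ℝ r α‖ := by
    intro α
    rw [norm_eq_sqrt_real_inner, norm_eq_sqrt_real_inner (F := F)]
    congr 1
    conv_lhs => rw [Finsupp.linearCombination_apply, Finsupp.sum, sum_inner]
    conv_rhs => rw [Finsupp.linearCombination_apply, Finsupp.sum, sum_inner]
    refine Finset.sum_congr rfl fun x _ => ?_
    rw [real_inner_smul_left, real_inner_smul_left]
    have := hinner x α
    rw [Finsupp.linearCombination_apply, Finsupp.sum, Finsupp.linearCombination_apply,
      Finsupp.sum] at this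
    rw [this]
  obtain ⟨w, hw, hwu⟩ := mem_closure_iff_seq_limit.1 hu
  choose α hα using fun n => (Finsupp.mem_span_range_iff_exists_finsupp).1 (hw n)
  have hα' : ∀ n, Finsupp.linearCombination ℝ r (α n) = w n := hα
  have hcau : CauchySeq fun n => Finsupp.linearCombination ℝ s (α n) := by
    have hc := hwu.cauchySeq
    rw [Metric.cauchySeq_iff] at hc ⊢
    intro ε hε
    obtain ⟨N, hN⟩ := hc ε hε
    refine ⟨N, fun m hm n hn => ?_⟩
    have := hN m hm n hn
    rwa [dist_eq_norm, ← hα' m, ← hα' n, ← map_sub, ← hnorm, map_sub, ← dist_eq_norm] at this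
  obtain ⟨g, hg⟩ := cauchySeq_tendsto_of_complete hcau
  refine ⟨g, tendsto_nhds_unique hg.norm ?_, fun x => tendsto_nhds_unique
    (tendsto_const_nhds.inner hg) ?_⟩
  · simp only [hnorm, hα']; exact hwu.norm
  · simp only [hinner, hα']; exact tendsto_const_nhds.inner hwu

/-- The kernel functions `K(·, x)` have the same Gram matrix as the features `[aᵀx - b]_+`. -/
theorem exists_rkhs_eq_network [NeZero d] {c : Weight d → ℝ} (hc : IsEvenDensity k c)
    (H : Type*) [NormedAddCommGroup H] [InnerProductSpace ℝ H] [CompleteSpace H]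
    [RKHS ℝ H (Space d) ℝ] (hK : ∀ x y, RKHS.kernel H x y 1 = splineKernel k x y) :
    ∃ g : H, (∀ x, g x = network c 0 0 x) ∧
      ‖g‖ = Real.sqrt (∫ p, c p ^ 2 ∂(weightMeasureOn d k)) := by
  obtain ⟨g, hg, hgx⟩ := exists_of_gram_eq (reluLp (d := d) k)
    (fun x => RKHS.kerFun H x (1 : ℝ)) (fun x y => by
      rw [← RKHS.kernel_inner, hK]
      rw [reluLp, reluLp, ← reluLp, inner_reluLp_toLp]
      simp only [splineKernel, RCLike.inner_apply, conj_trivial, one_mul]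
      refine integral_congr_ae (Filter.Eventually.of_forall fun p => ?_)
      simp only
      ring) (toLp_mem_closure_span_reluLp hc)
  refine ⟨g, fun x => ?_, by rw [hg, norm_toLp_two]⟩
  have h := hgx x
  rw [RKHS.kerFun_inner, inner_reluLp_toLp] at h
  rw [hc.network_eq, ← h]
  simp

end Reproducing

/-! ### Projection-slice theorem -/

section Slice

section

variable {E : Type*} [NormedAddCommGroup E] [InnerProductSpace ℝ E]

theorem abs_le_norm_add_smul {a : E} (ha : ‖a‖ = 1) (η : (ℝ ∙ a)ᗮ) (τ : ℝ) :
    |τ| ≤ ‖(η : E) + τ • a‖ := by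
  have h0 : ⟪a, (η : E)⟫ = 0 := Submodule.mem_orthogonal_singleton_iff_inner_right.1 η.2
  have h1 : ⟪a, (η : E) + τ • a⟫ = τ := by
    rw [inner_add_right, real_inner_smul_right, h0, real_inner_self_eq_norm_sq, ha]; ring
  have h2 := abs_real_inner_le_norm a ((η : E) + τ • a)
  rwa [h1, ha, one_mul] at h2

theorem norm_le_norm_smul_add {a : E} (y : (ℝ ∙ a)ᗮ) (b : ℝ) :
    ‖y‖ ≤ ‖b • a + (y : E)‖ := by
  have h0 : ⟪a, (y : E)⟫ = 0 := Submodule.mem_orthogonal_singleton_iff_inner_right.1 y.2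
  have h1 : ‖b • a + (y : E)‖ * ‖b • a + (y : E)‖ = ‖b • a‖ * ‖b • a‖ + ‖(y : E)‖ * ‖(y : E)‖ :=
    norm_add_sq_eq_norm_sq_add_norm_sq_real (by rw [real_inner_smul_left, h0, mul_zero])
  change ‖(y : E)‖ ≤ _
  exact abs_le_of_sq_le_sq' (by nlinarith [mul_self_nonneg ‖b • a‖]) (norm_nonneg _) |>.2

end

variable {E : Type*} [NormedAddCommGroup E] [InnerProductSpace ℝ E] [FiniteDimensional ℝ E]
  [MeasurableSpace E] [BorelSpace E]

/-- Orthogonal coordinates adapted to the hyperplanes perpendicular to a unit vector. -/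
theorem measurePreserving_add_smul {a : E} (ha : ‖a‖ = 1) :
    MeasurePreserving (fun r : (ℝ ∙ a)ᗮ × ℝ => (r.1 : E) + r.2 • a)
      ((volume : Measure (ℝ ∙ a)ᗮ).prod volume) volume := by
  have h1 : MeasurePreserving (LinearIsometryEquiv.toSpanUnitSingleton (𝕜 := ℝ) a ha) volume volume :=
    LinearIsometryEquiv.measurePreserving _
  have h2 := h1.prod (MeasurePreserving.id (volume : Measure (ℝ ∙ a)ᗮ))
  have h3 := (WithLp.volume_preserving_symm_measurableEquiv_toLp_prod (ℝ ∙ a) (ℝ ∙ a)ᗮ).symm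
  have h4 : MeasurePreserving (Submodule.orthogonalDecomposition (ℝ ∙ a)).symm volume volume :=
    LinearIsometryEquiv.measurePreserving _
  have h5 : MeasurePreserving Prod.swap ((volume : Measure (ℝ ∙ a)ᗮ).prod (volume : Measure ℝ))
    ((volume : Measure ℝ).prod (volume : Measure (ℝ ∙ a)ᗮ)) := Measure.measurePreserving_swap
  have h := h4.comp (h3.comp (h2.comp h5))
  convert h using 1
  funext r
  simp [add_comm]

/-- Projection-slice theorem: the integral of `𝓕 g` over a hyperplane is a one-dimensional Fourier
integral of `g` over the perpendicular line through the origin. -/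
theorem integral_fourier_hyperplane {g : E → ℂ} {a : E} (ha : ‖a‖ = 1) (b : ℝ)
    (hg : Integrable g) (hgc : ContinuousOn g {0}ᶜ) {C : ℝ}
    (hC : ∀ ξ, ξ ≠ 0 → ‖g ξ‖ ≤ C * ((1 + ‖ξ‖) ^ 2)⁻¹) (hC0 : 0 ≤ C)
    (hF : Integrable fun y : (ℝ ∙ a)ᗮ => 𝓕 g (b • a + (y : E))) :
    ∫ y : (ℝ ∙ a)ᗮ, 𝓕 g (b • a + (y : E))
      = ∫ τ : ℝ, Complex.exp (((-2 * Real.pi * (τ * b) : ℝ) : ℂ) * Complex.I) * g (τ • a) := by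
  have hmp := measurePreserving_add_smul ha
  set G : (ℝ ∙ a)ᗮ × ℝ → ℂ := fun r =>
    Complex.exp (((-2 * Real.pi * (r.2 * b) : ℝ) : ℂ) * Complex.I) * g ((r.1 : E) + r.2 • a) with hG
  set M : (ℝ ∙ a)ᗮ → ℂ := fun η => ∫ τ : ℝ, G (η, τ) with hM
  have hgi : Integrable (fun r : (ℝ ∙ a)ᗮ × ℝ => g ((r.1 : E) + r.2 • a))
      ((volume : Measure (ℝ ∙ a)ᗮ).prod volume) := hmp.integrable_comp_of_integrable hg
  have hGi : Integrable G ((volume : Measure (ℝ ∙ a)ᗮ).prod volume) := by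
    refine hgi.bdd_mul (c := 1) (Continuous.aestronglyMeasurable (by fun_prop))
      (Filter.Eventually.of_forall fun r => ?_)
    rw [Complex.norm_exp_ofReal_mul_I]
  have hMi : Integrable M := hGi.integral_prod_left
  have hFM : ∀ y : (ℝ ∙ a)ᗮ, 𝓕 M y = 𝓕 g (b • a + (y : E)) := by
    intro y
    have hi : Integrable (fun r : (ℝ ∙ a)ᗮ × ℝ =>
        Complex.exp (((-2 * Real.pi * ⟪r.1, y⟫ : ℝ) : ℂ) * Complex.I) * G r)
        ((volume : Measure (ℝ ∙ a)ᗮ).prod volume) := by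
      refine hGi.bdd_mul (c := 1) (Continuous.aestronglyMeasurable (by fun_prop))
        (Filter.Eventually.of_forall fun r => ?_)
      rw [Complex.norm_exp_ofReal_mul_I]
    rw [Real.fourier_eq', Real.fourier_eq']
    have h1 : ∀ η : (ℝ ∙ a)ᗮ, Complex.exp (((-2 * Real.pi * ⟪η, y⟫ : ℝ) : ℂ) * Complex.I) • M η
        = ∫ τ : ℝ, Complex.exp (((-2 * Real.pi * ⟪η, y⟫ : ℝ) : ℂ) * Complex.I) * G (η, τ) := by
      intro η
      rw [smul_eq_mul, hM, integral_const_mul]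
    simp only [h1]
    rw [← integral_prod _ hi]
    have hm : AEStronglyMeasurable (fun ξ => Complex.exp (((-2 * Real.pi * ⟪ξ, b • a + (y : E)⟫ : ℝ)
        : ℂ) * Complex.I) • g ξ)
        (Measure.map (fun r : (ℝ ∙ a)ᗮ × ℝ => (r.1 : E) + r.2 • a)
          ((volume : Measure (ℝ ∙ a)ᗮ).prod volume)) := by
      rw [hmp.map_eq]
      have hk : Continuous fun ξ : E =>
          Complex.exp (((-2 * Real.pi * ⟪ξ, b • a + (y : E)⟫ : ℝ) : ℂ) * Complex.I) := by fun_prop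
      exact hk.aestronglyMeasurable.smul hg.aestronglyMeasurable
    rw [← hmp.map_eq, integral_map hmp.measurable.aemeasurable hm]
    refine integral_congr_ae (Filter.Eventually.of_forall fun r => ?_)
    have e1 : ⟪(r.1 : E), a⟫ = 0 := Submodule.mem_orthogonal_singleton_iff_inner_left.1 r.1.2
    have e2 : ⟪a, (y : E)⟫ = 0 := Submodule.mem_orthogonal_singleton_iff_inner_right.1 y.2
    have e3 : ⟪a, a⟫ = 1 := by rw [real_inner_self_eq_norm_sq, ha]; norm_num
    have e4 : ⟪(r.1 : E) + r.2 • a, b • a + (y : E)⟫ = r.2 * b + ⟪r.1, y⟫ := by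
      rw [inner_add_left, inner_add_right, inner_add_right, real_inner_smul_right,
        real_inner_smul_left, real_inner_smul_right, real_inner_smul_left, e1, e2, e3,
        Submodule.coe_inner]
      ring
    simp only [hG, e4, smul_eq_mul]
    rw [← mul_assoc, ← Complex.exp_add]
    congr 2
    push_cast; ring
  have hne : ∀ (η : (ℝ ∙ a)ᗮ) (τ : ℝ), τ ≠ 0 → (η : E) + τ • a ≠ 0 := by
    intro η τ hτ h
    have := abs_le_norm_add_smul ha η τ
    rw [h, norm_zero] at this
    exact hτ (abs_nonpos_iff.1 this)
  have h0 : ∀ᵐ τ : ℝ, τ ≠ 0 := Measure.ae_ne volume 0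
  -- dominated convergence; the possible singularity of `g` at the origin is met for `τ = 0` only
  have hMc : ContinuousAt M 0 := by
    refine continuousAt_of_dominated (bound := fun τ : ℝ => C * ((1 + ‖τ‖) ^ 2)⁻¹)
      (Filter.Eventually.of_forall fun η => ?_) (Filter.Eventually.of_forall fun η => ?_)
      (integrable_inv_one_add_norm_sq.const_mul C) ?_
    · refine (Continuous.aestronglyMeasurable (by fun_prop)).mul ?_
      rw [← restrict_compl_singleton (μ := (volume : Measure ℝ)) 0]
      refine ContinuousOn.aestronglyMeasurable ?_ (measurableSet_singleton _).compl
      exact hgc.comp (by fun_prop) fun τ hτ => hne η τ hτ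
    · filter_upwards [h0] with τ hτ
      rw [norm_mul, Complex.norm_exp_ofReal_mul_I, one_mul]
      refine (hC _ (hne η τ hτ)).trans ?_
      have := abs_le_norm_add_smul ha η τ
      rw [Real.norm_eq_abs]
      gcongr
    · filter_upwards [h0] with τ hτ
      have h2 : ContinuousAt g (((0 : (ℝ ∙ a)ᗮ) : E) + τ • a) :=
        hgc.continuousAt (isOpen_compl_singleton.mem_nhds (hne 0 τ hτ))
      have h3 : ContinuousAt (fun η : (ℝ ∙ a)ᗮ => g ((η : E) + τ • a)) 0 :=
        ContinuousAt.comp (f := fun η : (ℝ ∙ a)ᗮ => (η : E) + τ • a) h2 (by fun_prop)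
      exact continuousAt_const.mul h3
  have hFMi : Integrable (𝓕 M) := by rw [funext hFM]; exact hF
  have hinv := hMi.fourierInv_fourier_eq hFMi hMc
  rw [Real.fourierInv_eq'] at hinv
  simp only [inner_zero_right, mul_zero, Complex.ofReal_zero, zero_mul, Complex.exp_zero,
    one_smul, hFM] at hinv
  rw [hinv, hM]
  simp [hG]

end Slice

/-! ### Inversion formula -/

section Inversion

variable {d : ℕ} {c : Weight d → ℝ}

theorem rayExtension_neg (hc : IsEven c) (ξ : Space d) (b : ℝ) :
    rayExtension c (-ξ, -b) = rayExtension c (ξ, b) := by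
  unfold rayExtension
  by_cases h : ξ = 0
  · simp [h]
  · have h' : -ξ ≠ 0 := neg_ne_zero.2 h
    simp only [h, h', dif_neg, not_false_eq_true]
    rw [← hc]
    congr 2
    · ext1
      simp
    · simp

theorem rayFourier_conj (hc : IsEven c) (ξ : Space d) :
    starRingEnd ℂ (rayFourier c ξ) = rayFourier c (-ξ) := by
  unfold rayFourier partialFourier
  rw [← integral_conj, ← integral_neg_eq_self]
  refine integral_congr_ae (Filter.Eventually.of_forall fun b => ?_)
  have h := rayExtension_neg hc (-ξ) b
  rw [neg_neg] at h
  simp only [smul_eq_mul, map_mul, Complex.conj_ofReal, ← Complex.exp_conj, Complex.conj_I,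
    norm_neg, h, map_ofNat]
  congr 2
  push_cast; ring

theorem IsRapidlyDecreasing.continuous (hc : IsRapidlyDecreasing c) : Continuous c := by
  have h : ContinuousOn (rayExtension c) {p | p.1 ≠ 0} := hc.smooth.continuousOn
  have h2 : Continuous fun p : Weight d => rayExtension c ((p.1 : Space d), p.2) :=
    h.comp_continuous (by fun_prop) fun p => by
      have : ‖(p.1 : Space d)‖ = 1 := by simp
      exact norm_ne_zero_iff.1 (by rw [this]; exact one_ne_zero)
  have h3 : (fun p : Weight d => rayExtension c ((p.1 : Space d), p.2)) = c :=
    funext fun p => rayExtension_sphere c p.1 p.2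
  rwa [h3] at h2

theorem IsRapidlyDecreasing.exists_abs_le (hc : IsRapidlyDecreasing c) :
    ∃ C : ℝ, 0 ≤ C ∧ ∀ p, (1 + |p.2|) * |c p| ≤ C * ((1 + ‖p.2‖) ^ 2)⁻¹ := by
  obtain ⟨C₀, hC₀, h₀⟩ := hc.exists_bound 0 0
  obtain ⟨C₃, hC₃, h₃⟩ := hc.exists_bound 0 3
  refine ⟨4 * (C₀ + C₃), by positivity, fun p => ?_⟩
  have e0 := h₀ 0 le_rfl p.1 p.2
  have e3 := h₃ 0 le_rfl p.1 p.2
  rw [norm_iteratedFDeriv_zero, rayExtension_sphere, Real.norm_eq_abs] at e0 e3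
  rw [← div_eq_mul_inv, le_div_iff₀ (by positivity), Real.norm_eq_abs]
  have hb := abs_nonneg p.2
  have hpow : (1 + |p.2|) ^ 3 ≤ 4 * (1 + |p.2| ^ 3) := by
    nlinarith [mul_nonneg (by linarith : (0:ℝ) ≤ 1 + |p.2|) (sq_nonneg (1 - |p.2|))]
  calc (1 + |p.2|) * |c p| * (1 + |p.2|) ^ 2 = (1 + |p.2|) ^ 3 * |c p| := by ring
    _ ≤ 4 * (1 + |p.2| ^ 3) * |c p| := by gcongr
    _ = 4 * (|p.2| ^ 0 * |c p| + |p.2| ^ 3 * |c p|) := by ring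
    _ ≤ 4 * (C₀ + C₃) := by gcongr

theorem IsRapidlyDecreasing.integrable (hc : IsRapidlyDecreasing c) :
    Integrable (fun p => (1 + |p.2|) * |c p|) (weightMeasure d) := by
  obtain ⟨C, hC0, hC⟩ := hc.exists_abs_le
  have hcc := hc.continuous
  have h1 : Integrable (fun p : Weight d => C * ((1 + ‖p.2‖) ^ 2)⁻¹) (weightMeasure d) :=
    (integrable_inv_one_add_norm_sq.const_mul C).comp_snd _
  refine h1.mono' (Continuous.aestronglyMeasurable (by fun_prop))
    (Filter.Eventually.of_forall fun p => ?_)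
  rw [Real.norm_of_nonneg (by positivity)]
  exact hC p

theorem IsRapidlyDecreasing.integrable_slice (hc : IsRapidlyDecreasing c)
    (a : Metric.sphere (0 : Space d) 1) : Integrable fun b : ℝ => (c (a, b) : ℂ) := by
  obtain ⟨C, hC0, hC⟩ := hc.exists_abs_le
  have hcc := hc.continuous
  refine (integrable_inv_one_add_norm_sq.const_mul C).mono'
    (Continuous.aestronglyMeasurable (by fun_prop)) (Filter.Eventually.of_forall fun b => ?_)
  rw [Complex.norm_real, Real.norm_eq_abs]
  refine le_trans ?_ (hC (a, b))
  nlinarith [abs_nonneg b, abs_nonneg (c (a, b))]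

theorem rayFourier_smul_sphere_of_ne_zero (hc : IsEven c) (a : Metric.sphere (0 : Space d) 1)
    {τ : ℝ} (hτ : τ ≠ 0) : rayFourier c (τ • (a : Space d)) = biasFourier c (a, τ) := by
  rcases lt_or_gt_of_ne hτ with h | h
  · have h1 := rayFourier_smul_sphere c (-a) (neg_pos.2 h)
    rw [coe_neg_sphere, neg_smul_neg] at h1
    rw [h1, ← biasFourier_neg hc]
    simp
  · exact rayFourier_smul_sphere c a h

theorem biasFourier_eq_fourierInv (a : Metric.sphere (0 : Space d) 1) (τ : ℝ) :
    biasFourier c (a, τ) = 𝓕⁻ (fun b => (c (a, b) : ℂ)) τ := by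
  rw [Real.fourierInv_eq', biasFourier]
  refine integral_congr_ae (Filter.Eventually.of_forall fun b => ?_)
  simp only [smul_eq_mul, RCLike.inner_apply, conj_trivial]
  congr 2
  push_cast; ring

/-- One-dimensional Fourier inversion on the line through `a`. -/
theorem integral_rayFourier_line (hc : IsEven c) (hs : IsRapidlyDecreasing c)
    (p : Weight d) :
    ∫ τ : ℝ, Complex.exp (((-2 * Real.pi * (τ * p.2) : ℝ) : ℂ) * Complex.I)
      * rayFourier c (τ • (p.1 : Space d)) = c p := by
  set u : ℝ → ℂ := fun b => (c (p.1, b) : ℂ) with hu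
  have hui : Integrable u := hs.integrable_slice p.1
  have huc : Continuous u := by
    have := hs.continuous
    fun_prop
  have hray : ∀ᵐ τ : ℝ, rayFourier c (τ • (p.1 : Space d)) = 𝓕⁻ u τ := by
    have h0 : ∀ᵐ τ : ℝ, τ ≠ 0 := Measure.ae_ne volume 0
    filter_upwards [h0] with τ hτ
    rw [rayFourier_smul_sphere_of_ne_zero hc p.1 hτ, biasFourier_eq_fourierInv]
  have hinvc : Continuous (𝓕⁻ u) := continuous_fourierInv hui
  obtain ⟨C, hC0, hC⟩ := (isSymbol_rayFourier hs 2).norm_le (r := 2) (by norm_num)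
  have hinvi : Integrable (𝓕⁻ u) := by
    have h0 : ∀ᵐ τ : ℝ, τ ≠ 0 := Measure.ae_ne volume 0
    refine (integrable_inv_one_add_norm_sq.const_mul C).mono' hinvc.aestronglyMeasurable ?_
    filter_upwards [h0, hray] with τ hτ h
    have hn : ‖τ • (p.1 : Space d)‖ = ‖τ‖ := by rw [norm_smul]; simp
    have := hC (τ • (p.1 : Space d)) (by rw [← norm_ne_zero_iff, hn]; simpa using hτ)
    rwa [h, hn] at this
  have hF : Integrable (𝓕 u) := by
    have := hinvi.comp_neg
    simpa [Real.fourierInv_eq_fourier_neg] using this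
  have h := congrFun (huc.fourier_fourierInv_eq hui hF) p.2
  rw [Real.fourier_eq'] at h
  rw [← show u p.2 = (c p : ℂ) from rfl, ← h]
  refine integral_congr_ae ?_
  filter_upwards [hray] with τ hτ
  rw [hτ, smul_eq_mul]
  congr 3
  simp [mul_comm]

/-- The function `(-Δ)^{(d+1)/2} f` for the network `f` with even density `c`: the Fourier
transform of the density's ray-wise Fourier transform, up to a constant. -/
noncomputable def networkLaplacian (c : Weight d → ℝ) (x : Space d) : ℝ :=
  -(2 * (2 * Real.pi) ^ (d - 1)) * (𝓕 (rayFourier c) x).re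

theorem fourier_rayFourier_re (hc : IsEven c) (x : Space d) :
    (((𝓕 (rayFourier c) x).re : ℝ) : ℂ) = 𝓕 (rayFourier c) x := by
  refine Complex.conj_eq_iff_re.1 ?_
  rw [Real.fourier_eq', ← integral_conj, ← integral_neg_eq_self]
  refine integral_congr_ae (Filter.Eventually.of_forall fun ξ => ?_)
  simp only [smul_eq_mul, map_mul, rayFourier_conj hc, neg_neg, ← Complex.exp_conj,
    Complex.conj_ofReal, Complex.conj_I, inner_neg_left]
  congr 2
  push_cast; ring

theorem networkLaplacian_eq (hc : IsEven c) (x : Space d) :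
    (networkLaplacian c x : ℂ)
      = -(2 * (2 * Real.pi) ^ (d - 1) : ℝ) * 𝓕 (rayFourier c) x := by
  rw [← fourier_rayFourier_re hc x, networkLaplacian]
  push_cast; ring

theorem integrable_rayFourier [NeZero d] (hs : IsRapidlyDecreasing c) :
    Integrable (rayFourier c) :=
  (isSymbol_rayFourier hs (d + 1)).integrable (by simp)

theorem continuous_fourier_rayFourier [NeZero d] (hs : IsRapidlyDecreasing c) :
    Continuous (𝓕 (rayFourier c)) :=
  VectorFourier.fourierIntegral_continuous Real.continuous_fourierChar
    (by exact continuous_inner) (integrable_rayFourier hs)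

theorem continuous_networkLaplacian [NeZero d] (hs : IsRapidlyDecreasing c) :
    Continuous (networkLaplacian c) := by
  have := continuous_fourier_rayFourier hs
  unfold networkLaplacian
  fun_prop

theorem exists_norm_fourier_rayFourier_le [NeZero d] (hs : IsRapidlyDecreasing c) :
    ∃ C : ℝ, 0 ≤ C ∧ ∀ x, ‖𝓕 (rayFourier c) x‖ ≤ C * ((1 + ‖x‖) ^ d)⁻¹ := by
  simpa using (isSymbol_rayFourier hs (d + 1)).exists_norm_fourier_le (by simp)

/-- The weak Fourier slice identity, with the Fourier transform moved from `ψ` to `rayFourier c`;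
the affine part of the network is annihilated. -/
theorem isWeakFracLaplacian_network [NeZero d] (hc : IsEven c) (hs : IsRapidlyDecreasing c)
    (v : Space d) (δ : ℝ) :
    IsWeakFracLaplacian (((d : ℝ) + 1) / 2) (network c v δ) (networkLaplacian c) := by
  intro ψ
  obtain ⟨-, h1, h2⟩ := integral_network_mul_fracLaplacian ψ hc
    hs.continuous.aestronglyMeasurable hs.integrable
  set Ψ := fracLaplacian (((d : ℝ) + 1) / 2) ψ with hΨ
  have haff : Integrable fun x => ((⟪v, x⟫ + δ : ℝ) : ℂ) * Ψ x := by
    refine integrable_mul_fracLaplacian ψ (C := ‖v‖ + |δ|)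
      (Continuous.aestronglyMeasurable (by fun_prop)) fun x => ?_
    rw [Complex.norm_real, Real.norm_eq_abs]
    have e1 := abs_real_inner_le_norm v x
    have e2 := abs_add_le ⟪v, x⟫ δ
    nlinarith [norm_nonneg x, norm_nonneg v, abs_nonneg δ, mul_nonneg (abs_nonneg δ) (norm_nonneg x)]
  have hsplit : ∀ x, (network c v δ x : ℂ) * Ψ x
      = ((∫ p, relu p x * c p ∂(weightMeasure d) : ℝ) : ℂ) * Ψ x
        + ((⟪v, x⟫ + δ : ℝ) : ℂ) * Ψ x := by
    intro x
    rw [network, ← add_mul]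
    push_cast; ring
  have hψ : Integrable (ψ : Space d → ℂ) := ψ.integrable
  obtain ⟨C, hC0, hC⟩ := exists_norm_fourier_rayFourier_le hs
  have hRψ : Integrable fun x => 𝓕 (rayFourier c) x * ψ x := by
    refine hψ.bdd_mul (c := C) (continuous_fourier_rayFourier hs).aestronglyMeasurable
      (Filter.Eventually.of_forall fun x => (hC x).trans ?_)
    have : 1 ≤ (1 + ‖x‖) ^ d := one_le_pow₀ (by linarith [norm_nonneg x])
    exact mul_le_of_le_one_right hC0 (inv_le_one_of_one_le₀ this)
  refine ⟨?_, ?_, ?_⟩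
  · simp only [hsplit]; exact h1.add haff
  · simp only [networkLaplacian_eq hc, mul_assoc]; exact hRψ.const_mul _
  · simp only [hsplit, networkLaplacian_eq hc, mul_assoc]
    rw [integral_add h1 haff, h2, integral_affine_mul_fracLaplacian, add_zero, integral_const_mul,
      integral_fourier_mul_eq_flip (integrable_rayFourier hs) hψ]
    simp only [mul_comm]

theorem integrable_fourier_rayFourier_hyperplane [NeZero d] (hs : IsRapidlyDecreasing c)
    (p : Weight d) : Integrable fun y : (ℝ ∙ (p.1 : Space d))ᗮ =>
      𝓕 (rayFourier c) (p.2 • (p.1 : Space d) + (y : Space d)) := by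
  obtain ⟨C, hC0, hC⟩ := exists_norm_fourier_rayFourier_le hs
  have hcont := continuous_fourier_rayFourier hs
  have hd : 0 < d := Nat.pos_of_ne_zero (NeZero.ne d)
  have ha : (p.1 : Space d) ≠ 0 := norm_ne_zero_iff.1 (by simp)
  have hfr : Module.finrank ℝ (ℝ ∙ (p.1 : Space d))ᗮ < d := by
    have : Fact (Module.finrank ℝ (Space d) = (d - 1) + 1) := ⟨by simp; omega⟩
    rw [Submodule.finrank_orthogonal_span_singleton (n := d - 1) ha]
    omega
  refine ((inv_one_add_norm_pow_integrable _ hfr).const_mul C).mono'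
    (Continuous.aestronglyMeasurable (by fun_prop)) (Filter.Eventually.of_forall fun y => ?_)
  refine (hC _).trans ?_
  have := norm_le_norm_smul_add y p.2
  gcongr

theorem radonIntegrable_networkLaplacian [NeZero d] (hs : IsRapidlyDecreasing c) (p : Weight d) :
    RadonIntegrable (networkLaplacian c) p :=
  (integrable_fourier_rayFourier_hyperplane hs p).re.const_mul _

/-- The projection-slice theorem followed by Fourier inversion on the line through `a`. -/
theorem radon_networkLaplacian [NeZero d] (hc : IsEven c) (hs : IsRapidlyDecreasing c)
    (p : Weight d) : radon (networkLaplacian c) p = -(2 * (2 * Real.pi) ^ (d - 1)) * c p := by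
  obtain ⟨C, hC0, hC⟩ := (isSymbol_rayFourier hs 2).norm_le (r := 2) (by norm_num)
  have h := integral_fourier_hyperplane (a := (p.1 : Space d)) (by simp) p.2
    (integrable_rayFourier hs) (isSymbol_rayFourier hs 2).smooth.continuousOn hC hC0
    (integrable_fourier_rayFourier_hyperplane hs p)
  rw [integral_rayFourier_line hc hs p] at h
  have h2 : ((radon (networkLaplacian c) p : ℝ) : ℂ)
      = ((-(2 * (2 * Real.pi) ^ (d - 1)) * c p : ℝ) : ℂ) := by
    rw [radon, ← integral_complex_ofReal]
    simp only [networkLaplacian_eq hc]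
    rw [integral_const_mul, h]
    push_cast; ring
  exact_mod_cast h2

end Inversion

end NeuralSpline

theorem mainTheorem7 (d : ℕ) (hd : 1 ≤ d) (k : ℝ) (hk : 0 < k) :
    -- the norm formula, for even densities on `𝕊^{d-1} × [-k, k]`
    (∀ c : NeuralSpline.Weight d → ℝ, NeuralSpline.IsEvenDensity k c →
      -- without linear and bias terms: the RKHS norm is the `L²` norm of `c`,
      (NeuralSpline.rkhsNorm k (NeuralSpline.network c 0 0) = ENNReal.ofReal
          (Real.sqrt (∫ p, c p ^ 2 ∂(NeuralSpline.weightMeasureOn d k)))) ∧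
      -- also in every Hilbert space of functions with the neural spline kernel
      (∀ (H : Type*) [NormedAddCommGroup H] [InnerProductSpace ℝ H] [CompleteSpace H]
          [RKHS ℝ H (NeuralSpline.Space d) ℝ],
        (∀ x y, RKHS.kernel H x y 1 = NeuralSpline.splineKernel k x y) →
        ∃ g : H, (∀ x, g x = NeuralSpline.network c 0 0 x) ∧
          ‖g‖ = Real.sqrt (∫ p, c p ^ 2 ∂(NeuralSpline.weightMeasureOn d k))) ∧
      ∀ (v : NeuralSpline.Space d) (δ : ℝ),
        NeuralSpline.networkNorm k (NeuralSpline.network c v δ) = ENNReal.ofReal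
          (Real.sqrt (∫ p, c p ^ 2 ∂(NeuralSpline.weightMeasureOn d k)) + ‖v‖ + |δ|) ∧
        -- the function determines its even density, its linear term and its bias
        ∀ (c' : NeuralSpline.Weight d → ℝ) (v' : NeuralSpline.Space d) (δ' : ℝ),
          NeuralSpline.IsEvenDensity k c' →
          NeuralSpline.network c' v' δ' = NeuralSpline.network c v δ →
          c' =ᵐ[NeuralSpline.weightMeasureOn d k] c ∧ v' = v ∧ δ' = δ) ∧
    -- the inversion formula `c = -γ_d R{(-Δ)^{(d+1)/2} f}`
    (∀ c : NeuralSpline.Weight d → ℝ, NeuralSpline.IsEven c →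
      NeuralSpline.IsRapidlyDecreasing c →
      ∀ (v : NeuralSpline.Space d) (δ : ℝ), ∃ h : NeuralSpline.Space d → ℝ,
        Continuous h ∧
        NeuralSpline.IsWeakFracLaplacian (((d : ℝ) + 1) / 2) (NeuralSpline.network c v δ) h ∧
        ∀ p : NeuralSpline.Weight d, NeuralSpline.RadonIntegrable h p ∧
          c p = -NeuralSpline.radonConst d * NeuralSpline.radon h p) := by
  have : NeZero d := ⟨by omega⟩
  refine ⟨fun c hc => ⟨NeuralSpline.rkhsNorm_network hc, fun H _ _ _ _ hK =>
      NeuralSpline.exists_rkhs_eq_network hc H hK, fun v δ =>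
      ⟨NeuralSpline.networkNorm_network hc v δ, fun c' v' δ' hc' h => hc.eq_of_network_eq hc' h⟩⟩,
    fun c hc hs v δ => ⟨NeuralSpline.networkLaplacian c,
      NeuralSpline.continuous_networkLaplacian hs,
      NeuralSpline.isWeakFracLaplacian_network hc hs v δ, fun p =>
      ⟨NeuralSpline.radonIntegrable_networkLaplacian hs p, ?_⟩⟩⟩
  rw [NeuralSpline.radon_networkLaplacian hc hs p, NeuralSpline.radonConst]
  have : (2 * (2 * Real.pi) ^ (d - 1) : ℝ) ≠ 0 := by positivity
  field_simp
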